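/- All ordinals carry the order topology, and a cardinal is identified with its initial ordinal. A topological space is an \emph{interval space} if its topology is the order topology of some linear ordering of its points. A space is \emph{scattered} if every nonempty subset has an isolated point in its relative topology. We define the following spaces. \begin{itemize} \item For infinite cardinals $\kappa,\lambda,\mu$, the space $X_{\kappa,\lambda,\mu}$ is the quotient of the disjoint union of the interval spaces $\kappa+1$, $\lambda+1$ and $\mu+1$ in which the three points $\kappa,\lambda,\mu$ are identified. The triple $(\kappa,\lambda,\mu)$ is \emph{legal} if $\kappa,\lambda,\mu$ are (infinite) regular cardinals and $\lambda,\mu>\aleph_0$. \item Let $\lambda$ be an uncountable regular cardinal, $S\subseteq\lambda$, and let $\vec\mu=(\mu_\alpha)_{\alpha\in S}$ be a family of uncountable regular cardinals; write $\mathrm{Dom}(\vec\mu)=S$. Let $\hat\omega$ be the set of negative integers. The space $X_{\lambda,\vec\mu}$ has the underlying set $$(\lambda+1)\ \cup\ \bigcup_{\alpha\in S}\{\alpha\}\times(\mu_\alpha\cup\hat\omega)$$ (a disjoint union), and an open base of its topology consists of: (1) the sets $\{\alpha\}\times U$ and $\{\alpha\}\times V$, where $\alpha\in S$, $U\subseteq\mu_\alpha$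 is open and $V\subseteq\hat\omega$ is arbitrary; (2) the sets $$\Bigl(W\cup\bigcup_{\alpha\in W\cap S}\{\alpha\}\times(\mu_\alpha\cup\hat\omega)\Bigr)\setminus\bigcup_{i\in\sigma}\{i\}\times(F_i\cup G_i),$$ where $W\subseteq\lambda+1$ is open, $\sigma\subseteq W\cap S$ is finite, and for each $i\in\sigma$, $F_i$ is a closed subset of $\mu_i+1$ with $\mu_i\notin F_i$ and $G_i\subseteq\hat\omega$ is finite. \item $X_{\aleph_1}$ is the one-point compactification of a discrete space of cardinality $\aleph_1$. \end{itemize} Let $\mathcal O$ be the class consisting of the spaces $X_{\kappa,\lambda,\mu}$ for all legal triples $(\kappa,\lambda,\mu)$, the spaces $X_{\lambda,\vec\mu}$ (with $\lambda$ and $\vec\mu$ as above) for which $\mathrm{Dom}(\vec\mu)$ is a stationary subset of $\lambda$, and the space $X_{\aleph_1}$. \textbf{Theorem.} Let $X$ be a scattered Hausdorff space which is a continuous image of a compact interval space. Then $X$ is an interval space if and only if no subspace of $X$ is homeomorphic to a member of $\mathcal O$. -/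

import Mathlib

open Cardinal Set

universe u v

noncomputable section

namespace IntervalSpaces

/-- The topology of `X` is the order topology of some linear ordering of `X`. -/
def IsIntervalSpace (X : Type u) [TopologicalSpace X] : Prop :=
  ∃ _ : LinearOrder X, OrderTopology X

/-- Every nonempty subset has a point that is isolated in the relative topology. -/
def IsScattered (X : Type u) [TopologicalSpace X] : Prop :=
  ∀ A : Set X, A.Nonempty → ∃ x ∈ A, ∃ U : Set X, IsOpen U ∧ U ∩ A = {x}

/-- Every ordinal carries its order topology. -/
instance (o : Ordinal.{u}) : TopologicalSpace o.ToType := Preorder.topology _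

instance (o : Ordinal.{u}) : OrderTopology o.ToType := ⟨rfl⟩

/-- A cardinal `κ`, regarded as the (initial) ordinal `κ`. -/
abbrev Below (κ : Cardinal.{u}) : Type u := κ.ord.ToType

/-- The interval space `κ + 1`; the point `κ` is `⊤`. Mathlib gives `WithTop` of a space with the
order topology its order topology. -/
abbrev UpTo (κ : Cardinal.{u}) : Type u := WithTop (Below κ)

/-! ### The spaces `X_{κ,l,μ}` -/

/-- The disjoint union of `κ + 1`, `l + 1` and `μ + 1`. -/
abbrev TripleSum (κ l μ : Cardinal.{u}) : Type u := UpTo κ ⊕ UpTo l ⊕ UpTo μ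

/-- The three last points of the summands. -/
def tripleEnds (κ l μ : Cardinal.{u}) : Set (TripleSum κ l μ) :=
  {.inl ⊤, .inr (.inl ⊤), .inr (.inr ⊤)}

/-- The equivalence relation which identifies the three last points. -/
def tripleSetoid (κ l μ : Cardinal.{u}) : Setoid (TripleSum κ l μ) where
  r x y := x = y ∨ (x ∈ tripleEnds κ l μ ∧ y ∈ tripleEnds κ l μ)
  iseqv :=
    { refl := fun _ => Or.inl rfl
      symm := by
        rintro x y (h | ⟨hx, hy⟩)
        · exact Or.inl h.symm
        · exact Or.inr ⟨hy, hx⟩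
      trans := by
        rintro x y z (rfl | ⟨hx, hy⟩) (rfl | ⟨hy', hz⟩)
        · exact Or.inl rfl
        · exact Or.inr ⟨hy', hz⟩
        · exact Or.inr ⟨hx, hy⟩
        · exact Or.inr ⟨hx, hz⟩ }

/-- `X_{κ,l,μ}`, with the quotient topology. -/
abbrev TripleSpace (κ l μ : Cardinal.{u}) : Type u := Quotient (tripleSetoid κ l μ)

/-- `(κ, l, μ)` is a legal triple. -/
def IsLegalTriple (κ l μ : Cardinal.{u}) : Prop :=
  κ.IsRegular ∧ l.IsRegular ∧ μ.IsRegular ∧ ℵ₀ < l ∧ ℵ₀ < μ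

/-! ### The spaces `X_{l,μ⃗}` -/

/-- The universe `(l + 1) ∪ ⋃_{α ∈ S} {α} × (μ_α ∪ ω̂)` of `X_{l,μ⃗}`, where `μ⃗` is a function
with domain `S ⊆ l`. The natural number `n` stands for the negative integer `-n - 1` of `ω̂`. -/
def StationarySpace (l : Cardinal.{u}) (S : Set (Below l)) (μ : S → Cardinal.{u}) : Type u :=
  UpTo l ⊕ (Σ α : S, Below (μ α) ⊕ ℕ)

namespace StationarySpace

variable {l : Cardinal.{u}} {S : Set (Below l)} {μ : S → Cardinal.{u}}

/-- The point `β` of `l + 1`. -/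
def base (β : UpTo l) : StationarySpace l S μ := Sum.inl β

/-- The point `(α, γ)` with `γ ∈ μ_α`. -/
def long (α : S) (γ : Below (μ α)) : StationarySpace l S μ := Sum.inr ⟨α, Sum.inl γ⟩

/-- The point `(α, -n - 1)` with `-n - 1 ∈ ω̂`. -/
def short (α : S) (n : ℕ) : StationarySpace l S μ := Sum.inr ⟨α, Sum.inr n⟩

/-- The set `{α} × (μ_α ∪ ω̂)`. -/
def fiber (α : S) : Set (StationarySpace l S μ) := range (long α) ∪ range (short α)

/-- The basic set
`W ∪ ⋃_{α ∈ W ∩ S} {α} × (μ_α ∪ ω̂) - ⋃_{i ∈ σ} {i} × (F_i ∪ G_i)`. -/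
def basicSet (W : Set (UpTo l)) (σ : Finset S) (F : ∀ i : S, Set (UpTo (μ i)))
    (G : S → Set ℕ) : Set (StationarySpace l S μ) :=
  (base '' W ∪ ⋃ α ∈ {α : S | ((α : Below l) : UpTo l) ∈ W}, fiber α) \
    ⋃ i ∈ σ, (long i '' {γ | (γ : UpTo (μ i)) ∈ F i} ∪ short i '' G i)

/-- The open base of `X_{l,μ⃗}`. -/
inductive IsBasic : Set (StationarySpace l S μ) → Prop
  | long (α : S) (U : Set (Below (μ α))) (hU : IsOpen U) : IsBasic (long α '' U)
  | short (α : S) (V : Set ℕ) : IsBasic (short α '' V)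
  | base (W : Set (UpTo l)) (hW : IsOpen W) (σ : Finset S)
      (hσ : ∀ i ∈ σ, ((i : Below l) : UpTo l) ∈ W)
      (F : ∀ i : S, Set (UpTo (μ i))) (hF : ∀ i ∈ σ, IsClosed (F i) ∧ ⊤ ∉ F i)
      (G : S → Set ℕ) (hG : ∀ i ∈ σ, (G i).Finite) : IsBasic (basicSet W σ F G)

instance : TopologicalSpace (StationarySpace l S μ) :=
  TopologicalSpace.generateFrom {B | IsBasic B}

end StationarySpace

/-! ### The class of obstructions -/

/-- `Y` is homeomorphic to `X_{κ,l,μ}` for some legal triple. -/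
def IsTripleObstruction (Y : Type u) [TopologicalSpace Y] : Prop :=
  ∃ κ l μ : Cardinal.{u}, IsLegalTriple κ l μ ∧ Nonempty (Y ≃ₜ TripleSpace κ l μ)

/-- `Y` is homeomorphic to `X_{l,μ⃗}` for some uncountable regular `l` and some function `μ⃗`, whose
values are uncountable regular cardinals and whose domain `S` is stationary in `l`. -/
def IsStationaryObstruction (Y : Type u) [TopologicalSpace Y] : Prop :=
  ∃ (l : Cardinal.{u}) (S : Set (Below l)) (μ : S → Cardinal.{u}),
    l.IsRegular ∧ ℵ₀ < l ∧ (∀ α, (μ α).IsRegular ∧ ℵ₀ < μ α) ∧ IsStationary S ∧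
      Nonempty (Y ≃ₜ StationarySpace l S μ)

/-- `Y` is homeomorphic to `X_{ℵ₁}`, the one-point compactification of a discrete space of
cardinality `ℵ₁`. -/
def IsAlephOneObstruction (Y : Type u) [TopologicalSpace Y] : Prop :=
  ∃ (D : Type u) (_ : TopologicalSpace D),
    DiscreteTopology D ∧ #D = ℵ_ 1 ∧ Nonempty (Y ≃ₜ OnePoint D)

/-- `Y` is homeomorphic to a member of the class of obstructions. -/
def IsObstruction (Y : Type u) [TopologicalSpace Y] : Prop :=
  IsTripleObstruction Y ∨ IsStationaryObstruction Y ∨ IsAlephOneObstruction Y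

end IntervalSpaces

end

noncomputable section

namespace IntervalSpaces

open Order Filter Topology

/-! ### Regular cardinals as well-orders -/

/-! A linear order with closed rays on a compact space induces its topology. Hence every compact
space that injects continuously into an interval space is one, and for the "only if" half it
suffices that the obstructions, all compact, are not interval spaces. Under a linear order, two legs
of `TripleSpace` would approach the common point from the same side. Two closed sequences of
uncountable regular lengths doing so interleave and share a limit, while a countable set cannot keep
pace with an uncountable regular sequence. In a space over a stationary set, a closing-off argument
finds `i ∈ S` whose fibre lies wholly on one side of `i`, although an uncountable sequence and a
countable one converge to `i` inside it. In the compactification of a discrete space every closed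
set omitting `∞` is finite, so each side of `∞` is countable.

For the converse, consider the points without an orderable clopen neighbourhood. If there are any,
scatteredness isolates one of them, `p`, and inside a small clopen set every closed set omitting `p`
is orderable. It remains to order the space at `p`.

Let `f : L → X` be the given surjection. The convex components of `L` minus the fibre of `p`, each
cut at a point, have as images a family converging to `p` (`exists_isFan`). A half-open interval of
countable cofinality has a σ-compact image. For uncountable cofinality the images of its final
segments, taken along a club, form a strand `T i` with a closed sequence of cut points `y i`, and
`p` together with all `y i` is a copy of `κ + 1` (`isArm_or_isSigmaCompact_image_Ico`). Without
`X_{ℵ₁}` the family is countable. Without triple obstructions it has finitely many arms, and merging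
arms that meet cofinally leaves at most two disjoint ones (`IsFan.exists_isSigmaCompact`). The rest
is σ-compact and can be ordered towards `p` by a clopen exhaustion.

The core is `IsArm.ordMax`: an arm can be ordered with `p` at its end. Cut it into pieces `M i`
containing `y i`. At a limit `i` the earlier pieces accumulate at `y i`, so `M i` should begin with
`y i`. If it cannot, then `y i` is approached from both sides within `M i`, with uncountable
cofinality from at least one side (`Orderable.ordMin_or_exists_arm`). If both are uncountable, the
strand below `i` is a third leg and a triple obstruction appears. If one is countable for
stationarily many `i`, these data form a space over a stationary set. Otherwise the bad `i` avoid a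
club, and cutting only along that club gives the order. Finally at most two ordered parts are glued
at `p`. When there are two arms the σ-compact remainder cannot accumulate at `p`, as it would supply
a leg of length `ℵ₀`. -/

theorem isSuccLimit_iff_forall_exists {α : Type*} [LinearOrder α] {i : α} :
    IsSuccLimit i ↔ (∃ j, j < i) ∧ ∀ j < i, ∃ k, j < k ∧ k < i := by
  constructor
  · intro h
    refine ⟨not_isMin_iff.1 h.1, fun j hj => ?_⟩
    by_contra! hc
    exact h.2 j ⟨hj, fun k hjk hki => (hc k hjk).not_gt hki⟩
  · rintro ⟨h1, h2⟩
    refine ⟨not_isMin_iff.2 h1, fun j hj => ?_⟩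
    obtain ⟨k, hjk, hki⟩ := h2 j hj.1
    exact hj.2 hjk hki

theorem exists_isLUB_of_wellFoundedLT {α : Type*} [LinearOrder α] [WellFoundedLT α] {s : Set α}
    (hs : BddAbove s) : ∃ a, IsLUB s a := by
  refine ⟨WellFounded.min wellFounded_lt (upperBounds s) hs, WellFounded.min_mem _ _ hs, ?_⟩
  intro b hb
  exact not_lt.1 (WellFounded.not_lt_min _ _ hb)

section Regular

variable {κ : Cardinal.{u}}

theorem cof_below (hκ : κ.IsRegular) : Order.cof (Below κ) = κ := by
  rw [Ordinal.cof_toType, hκ.cof_ord]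

theorem isRegularCardinalOrder_below (hκ : κ.IsRegular) : IsRegularCardinalOrder (Below κ) := by
  refine ⟨?_⟩
  rw [cof_below hκ, Ordinal.type_toType]

theorem exists_forall_lt_of_mk_lt (hκ : κ.IsRegular) {s : Set (Below κ)} (hs : #s < κ) :
    ∃ b, ∀ x ∈ s, x < b := by
  rw [← not_isCofinal_iff]
  intro h
  exact (Order.cof_le h).not_gt (by rwa [cof_below hκ])

theorem noMaxOrder_below (hκ : κ.IsRegular) : NoMaxOrder (Below κ) := by
  refine ⟨fun a => ?_⟩
  obtain ⟨b, hb⟩ := exists_forall_lt_of_mk_lt hκ (s := {a})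
    (by simpa using one_lt_aleph0.trans_le hκ.aleph0_le)
  exact ⟨b, hb a rfl⟩

theorem nonempty_below (hκ : κ.IsRegular) : Nonempty (Below κ) := by
  obtain ⟨b, -⟩ := exists_forall_lt_of_mk_lt hκ (s := ∅) (by simpa using hκ.pos)
  exact ⟨b⟩

theorem mk_Iio_lt (i : Below κ) : #(Iio i) < κ := by
  simpa using Cardinal.mk_Iio_lt i (by simp)

theorem exists_forall_lt_of_countable (hκ : κ.IsRegular) (hω : ℵ₀ < κ) {ι : Sort*} [Countable ι]
    (g : ι → Below κ) : ∃ b, ∀ i, g i < b := by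
  obtain ⟨b, hb⟩ := exists_forall_lt_of_mk_lt hκ (s := range g)
    ((le_aleph0_iff_set_countable.2 (countable_range g)).trans_lt hω)
  exact ⟨b, fun i => hb _ ⟨i, rfl⟩⟩

/-- Closure points of a function on an uncountable regular cardinal form a club. -/
theorem isClub_closurePoints (hκ : κ.IsRegular) (hω : ℵ₀ < κ) (g : Below κ → Below κ) :
    IsClub {i | IsSuccLimit i ∧ ∀ j < i, g j < i} := by
  have hmax := noMaxOrder_below hκ
  constructor
  · intro t ht htne _ x hx
    have key : ∀ j < x, ∃ k ∈ t, j < k := fun j hj => by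
      simpa using (lt_isLUB_iff hx).1 hj
    obtain ⟨k, hk⟩ := htne
    refine ⟨isSuccLimit_iff_forall_exists.2 ⟨?_, fun j hj => ?_⟩, fun j hj => ?_⟩
    · obtain ⟨j, hj⟩ := not_isMin_iff.1 (ht hk).1.1
      exact ⟨j, hj.trans_le (hx.1 hk)⟩
    · obtain ⟨m, hm, hjm⟩ := key j hj
      obtain ⟨n, hn, hnm⟩ := (isSuccLimit_iff_forall_exists.1 (ht hm).1).2 j hjm
      exact ⟨n, hn, hnm.trans_le (hx.1 hm)⟩
    · obtain ⟨m, hm, hjm⟩ := key j hj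
      exact ((ht hm).2 j hjm).trans_le (hx.1 hm)
  · intro a
    have hh : ∀ j, ∃ b, j < b ∧ ∀ k ≤ j, g k < b := by
      intro j
      obtain ⟨j', hj'⟩ := exists_gt j
      have : #(g '' Iic j) < κ :=
        mk_image_le.trans_lt ((mk_le_mk_of_subset (Iic_subset_Iio.2 hj')).trans_lt (mk_Iio_lt j'))
      obtain ⟨b, hb⟩ := exists_forall_lt_of_mk_lt hκ this
      exact ⟨max b j', lt_max_of_lt_right hj',
        fun k hk => lt_max_of_lt_left (hb _ (mem_image_of_mem _ hk))⟩
    choose h hlt hg using hh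
    -- Uncountability of `κ` bounds the `ω` iterates, and their supremum is a closure point above
    -- `a`.
    obtain ⟨b, hb⟩ := exists_forall_lt_of_countable hκ hω (fun n : ℕ => h^[n] a)
    obtain ⟨i, hi⟩ := exists_isLUB_of_wellFoundedLT (s := range fun n : ℕ => h^[n] a)
      ⟨b, by rintro _ ⟨n, rfl⟩; exact (hb n).le⟩
    have hlt' : ∀ n, h^[n] a < i := fun n =>
      (hlt _).trans_le (by rw [← Function.iterate_succ_apply' h]; exact hi.1 ⟨n + 1, rfl⟩)
    have key : ∀ j < i, ∃ n, j < h^[n] a := fun j hj => by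
      simpa using (lt_isLUB_iff hi).1 hj
    refine ⟨i, ⟨isSuccLimit_iff_forall_exists.2 ⟨⟨a, hlt' 0⟩, fun j hj => ?_⟩, fun j hj => ?_⟩,
      (hlt' 0).le⟩
    · obtain ⟨n, hn⟩ := key j hj
      exact ⟨_, hn, hlt' n⟩
    · obtain ⟨n, hn⟩ := key j hj
      refine (hg _ j hn.le).trans ?_
      rw [← Function.iterate_succ_apply' h]
      exact hlt' _

theorem isClub_Ioi (hκ : κ.IsRegular) (a : Below κ) : IsClub (Ioi a) := by
  have hmax := noMaxOrder_below hκ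
  constructor
  · rintro t ht ⟨k, hk⟩ _ x hx
    exact (ht hk).trans_le (hx.1 hk)
  · intro b
    obtain ⟨c, hc⟩ := exists_gt (max a b)
    exact ⟨c, (le_max_left _ _).trans_lt hc, ((le_max_right _ _).trans_lt hc).le⟩

/-- The increasing enumeration of a club is normal. Strands are thinned out along such an
enumeration without changing their length or losing continuity at limits. -/
theorem exists_isNormal_of_isClub (hκ : κ.IsRegular) {C : Set (Below κ)} (hC : IsClub C) :
    ∃ e : Below κ → Below κ, IsNormal e ∧ ∀ i, e i ∈ C := by
  have := isRegularCardinalOrder_below hκ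
  exact ⟨_, hC.isNormal_enum, fun i => (enum C hC.isCofinal i).2⟩

end Regular

/-! ### Order topologies on well-orders and on compact spaces -/

theorem isOpen_Iic_of_wellFoundedLT {W : Type*} [LinearOrder W] [WellFoundedLT W]
    [TopologicalSpace W] [OrderTopology W] (i : W) : IsOpen (Iic i) := by
  by_cases h : ∃ j, i < j
  · have : Iic i = Iio (WellFounded.min wellFounded_lt (Ioi i) h) := by
      ext k
      refine ⟨fun hk => lt_of_le_of_lt hk (WellFounded.min_mem wellFounded_lt (Ioi i) h),
        fun hk => ?_⟩
      by_contra hc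
      exact WellFounded.not_lt_min wellFounded_lt (Ioi i) (not_le.1 hc) hk
    rw [this]
    exact isOpen_Iio
  · push Not at h
    rw [eq_univ_of_forall (s := Iic i) h]
    exact isOpen_univ

/-- Initial segments `Iic i` are open in a well-order, so a point that is not a limit is isolated
and imposes no condition. -/
theorem isOpen_of_forall_isSuccLimit {W : Type*} [LinearOrder W] [WellFoundedLT W]
    [TopologicalSpace W] [OrderTopology W] {O : Set W}
    (h : ∀ i ∈ O, IsSuccLimit i → ∃ j < i, Ioc j i ⊆ O) : IsOpen O := by
  refine isOpen_iff_mem_nhds.2 fun i hi => ?_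
  by_cases hl : IsSuccLimit i
  · obtain ⟨j, hj, hjO⟩ := h i hi hl
    refine mem_of_superset ?_ hjO
    exact (isOpen_Ioi.inter (isOpen_Iic_of_wellFoundedLT i)).mem_nhds ⟨hj, le_rfl⟩
  · have : ∃ V : Set W, IsOpen V ∧ V ∩ Iic i = {i} := by
      rw [isSuccLimit_iff_forall_exists, not_and_or] at hl
      rcases hl with hl | hl
      · push Not at hl
        refine ⟨univ, isOpen_univ, ?_⟩
        ext k
        simpa using ⟨fun hk => le_antisymm hk (hl k), fun hk => hk.le⟩
      · push Not at hl
        obtain ⟨j, hj, hjk⟩ := hl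
        refine ⟨Ioi j, isOpen_Ioi, ?_⟩
        ext k
        exact ⟨fun hk => le_antisymm hk.2 (hjk k hk.1), by rintro rfl; exact ⟨hj, le_rfl⟩⟩
    obtain ⟨V, hV, hVi⟩ := this
    refine mem_of_superset ((hV.inter (isOpen_Iic_of_wellFoundedLT i)).mem_nhds ?_)
      (hVi.trans_subset (singleton_subset_iff.2 hi))
    rw [hVi]
    rfl

theorem compactSpace_of_wellFoundedLT {W : Type*} [LinearOrder W] [WellFoundedLT W] [OrderTop W]
    [TopologicalSpace W] [OrderTopology W] : CompactSpace W := by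
  let : OrderBot W := WellFoundedLT.toOrderBot W
  let := WellFoundedLT.conditionallyCompleteLinearOrderBot W
  refine ⟨?_⟩
  have : IsCompact (Icc (⊥ : W) ⊤) := isCompact_Icc
  rwa [eq_univ_of_forall (s := Icc (⊥ : W) ⊤) fun x => ⟨bot_le, le_top⟩] at this

instance (κ : Cardinal.{u}) : CompactSpace (UpTo κ) := compactSpace_of_wellFoundedLT

/-- On a compact space, a linear order with closed rays induces the topology. -/
theorem orderTopology_of_isClosed_rays {Y : Type*} [TopologicalSpace Y] [CompactSpace Y]
    [LinearOrder Y] (h1 : ∀ x : Y, IsClosed (Iic x)) (h2 : ∀ x : Y, IsClosed (Ici x)) :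
    OrderTopology Y := by
  have hle : ‹TopologicalSpace Y› ≤ Preorder.topology Y := by
    refine le_generateFrom ?_
    rintro s ⟨a, rfl | rfl⟩
    · rw [← compl_Iic]; exact (h1 a).isOpen_compl
    · rw [← compl_Ici]; exact (h2 a).isOpen_compl
  refine ⟨?_⟩
  have hT2 : @T2Space Y (Preorder.topology Y) := by
    let := Preorder.topology Y
    have : OrderTopology Y := ⟨rfl⟩
    infer_instance
  have hcont := continuous_id_iff_le.2 hle
  refine le_antisymm hle ?_
  -- The identity is continuous from a compact topology to the Hausdorff order topology, hence
  -- closed, so the two coincide.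
  have hcl : @IsClosedMap Y Y _ (Preorder.topology Y) id :=
    @Continuous.isClosedMap Y Y _ (Preorder.topology Y) _ hT2 id hcont
  intro s hs
  have := hcl sᶜ (isClosed_compl_iff.2 hs)
  rw [image_id] at this
  simpa using this.isOpen_compl

/-- A compact subspace of a linearly ordered space carries the order topology of the restricted
order. -/
theorem orderTopology_subtype {L : Type*} [TopologicalSpace L] [LinearOrder L] [OrderTopology L]
    {K : Set L} (hK : IsCompact K) : OrderTopology K := by
  have := isCompact_iff_compactSpace.1 hK
  exact orderTopology_of_isClosed_rays (fun x => isClosed_Iic.preimage continuous_subtype_val)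
    (fun x => isClosed_Ici.preimage continuous_subtype_val)

theorem exists_isLUB_of_compactSpace {L : Type*} [TopologicalSpace L] [LinearOrder L]
    [OrderTopology L] [CompactSpace L] {s : Set L} (hs : s.Nonempty) : ∃ a, IsLUB s a := by
  obtain ⟨a, ha⟩ := (isClosed_closure (s := s)).isCompact.exists_isLUB hs.closure
  exact ⟨a, by simpa [IsLUB, upperBounds_closure] using ha.2⟩

/-! ### Orderable subsets -/

section Orderable

variable {X : Type u}

/-- `r` is a (non-strict) linear order on `S`. -/
structure LinOn (r : X → X → Prop) (S : Set X) : Prop where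
  total : ∀ x ∈ S, ∀ y ∈ S, r x y ∨ r y x
  antisymm : ∀ x ∈ S, ∀ y ∈ S, r x y → r y x → x = y
  trans : ∀ x ∈ S, ∀ y ∈ S, ∀ z ∈ S, r x y → r y z → r x z

theorem LinOn.refl {r : X → X → Prop} {S : Set X} (h : LinOn r S) {x : X} (hx : x ∈ S) : r x x :=
  (h.total x hx x hx).elim id id

theorem LinOn.mono {r : X → X → Prop} {S T : Set X} (h : LinOn r S) (hT : T ⊆ S) : LinOn r T :=
  ⟨fun x hx y hy => h.total x (hT hx) y (hT hy),
    fun x hx y hy => h.antisymm x (hT hx) y (hT hy),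
    fun x hx y hy z hz => h.trans x (hT hx) y (hT hy) z (hT hz)⟩

/-- The lexicographic order given by a map to a linear order and relations on its fibers. -/
def lexRel {I : Type*} [LinearOrder I] (π : X → I) (r : I → X → X → Prop) (x y : X) : Prop :=
  π x < π y ∨ π x = π y ∧ r (π x) x y

theorem LinOn.lex {I : Type*} [LinearOrder I] {π : X → I} {r : I → X → X → Prop} {S : Set X}
    (h : ∀ i, LinOn (r i) (S ∩ π ⁻¹' {i})) : LinOn (lexRel π r) S where
  total x hx y hy := by
    rcases lt_trichotomy (π x) (π y) with hxy | hxy | hxy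
    · exact .inl (.inl hxy)
    · rcases (h (π x)).total x ⟨hx, rfl⟩ y ⟨hy, hxy.symm⟩ with hr | hr
      · exact .inl (.inr ⟨hxy, hr⟩)
      · exact .inr (.inr ⟨hxy.symm, hxy ▸ hr⟩)
    · exact .inr (.inl hxy)
  antisymm x hx y hy := by
    rintro (hxy | ⟨hxy, hr⟩) (hyx | ⟨hyx, hr'⟩)
    · exact absurd hxy hyx.not_gt
    · exact absurd hyx hxy.ne'
    · exact absurd hxy hyx.ne'
    · exact (h (π x)).antisymm x ⟨hx, rfl⟩ y ⟨hy, hxy.symm⟩ hr (hyx ▸ hr')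
  trans x hx y hy z hz := by
    rintro (hxy | ⟨hxy, hr⟩) (hyz | ⟨hyz, hr'⟩)
    · exact .inl (hxy.trans hyz)
    · exact .inl (hyz ▸ hxy)
    · exact .inl (hxy ▸ hyz)
    · exact .inr ⟨hxy.trans hyz, (h (π x)).trans x ⟨hx, rfl⟩ y ⟨hy, hxy.symm⟩ z
        ⟨hz, (hxy.trans hyz).symm⟩ hr (hxy ▸ hr')⟩

variable [TopologicalSpace X]

/-- `r` is a linear order on `S` whose closed rays are closed in `X`. -/
structure OrdOn (r : X → X → Prop) (S : Set X) : Prop extends LinOn r S where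
  lower : ∀ x ∈ S, IsClosed {y ∈ S | r y x}
  upper : ∀ x ∈ S, IsClosed {y ∈ S | r x y}

theorem OrdOn.mono {r : X → X → Prop} {S T : Set X} (h : OrdOn r S) (hT : T ⊆ S)
    (hTc : IsClosed T) : OrdOn r T := by
  refine ⟨h.toLinOn.mono hT, fun x hx => ?_, fun x hx => ?_⟩
  · convert hTc.inter (h.lower x (hT hx)) using 1
    ext y
    exact ⟨fun hy => ⟨hy.1, hT hy.1, hy.2⟩, fun hy => ⟨hy.1, hy.2.2⟩⟩
  · convert hTc.inter (h.upper x (hT hx)) using 1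
    ext y
    exact ⟨fun hy => ⟨hy.1, hT hy.1, hy.2⟩, fun hy => ⟨hy.1, hy.2.2⟩⟩

theorem OrdOn.flip {r : X → X → Prop} {S : Set X} (h : OrdOn r S) : OrdOn (flip r) S where
  total x hx y hy := h.total y hy x hx
  antisymm x hx y hy h1 h2 := h.antisymm x hx y hy h2 h1
  trans x hx y hy z hz h1 h2 := h.trans z hz y hy x hx h2 h1
  lower := h.upper
  upper := h.lower

/-- `S` has a linear order with closed rays. -/
def Orderable (S : Set X) : Prop := ∃ r, OrdOn r S

/-- `S` has a linear order with closed rays and with largest element `p`. -/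
def OrdMax (S : Set X) (p : X) : Prop := ∃ r, OrdOn r S ∧ p ∈ S ∧ ∀ x ∈ S, r x p

/-- `S` has a linear order with closed rays and with least element `p`. -/
def OrdMin (S : Set X) (p : X) : Prop := ∃ r, OrdOn r S ∧ p ∈ S ∧ ∀ x ∈ S, r p x

theorem OrdMax.ordMin {S : Set X} {p : X} : OrdMax S p → OrdMin S p :=
  fun ⟨r, hr, hp, h⟩ => ⟨flip r, hr.flip, hp, h⟩

theorem OrdMax.orderable {S : Set X} {p : X} : OrdMax S p → Orderable S :=
  fun ⟨r, hr, _⟩ => ⟨r, hr⟩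

theorem Orderable.mono {S T : Set X} (h : Orderable S) (hT : T ⊆ S) (hTc : IsClosed T) :
    Orderable T :=
  let ⟨r, hr⟩ := h
  ⟨r, hr.mono hT hTc⟩

theorem orderable_empty : Orderable (∅ : Set X) :=
  ⟨fun _ _ => True, ⟨by simp, by simp, by simp⟩, by simp, by simp⟩

/-- Relations on subsets of one ambient space are convenient while sets are cut and glued. On a
compact set, closed rays are all that is needed to return to a genuine ordered space. -/
theorem OrdOn.exists_linearOrder {r : X → X → Prop} {S : Set X} (hS : IsCompact S)
    (hr : OrdOn r S) :
    ∃ _ : LinearOrder S, OrderTopology S ∧ ∀ x y : S, x ≤ y ↔ r x y := by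
  classical
  have := isCompact_iff_compactSpace.1 hS
  let lo : LinearOrder S :=
    { le := fun x y => r x y
      le_refl := fun x => hr.refl x.2
      le_trans := fun x y z => hr.trans x x.2 y y.2 z z.2
      le_antisymm := fun x y h1 h2 => Subtype.ext (hr.antisymm x x.2 y y.2 h1 h2)
      le_total := fun x y => hr.total x x.2 y y.2
      toDecidableLE := Classical.decRel _ }
  refine ⟨lo, orderTopology_of_isClosed_rays (fun x => ?_) (fun x => ?_), fun _ _ => Iff.rfl⟩
  · convert (hr.lower x x.2).preimage continuous_subtype_val using 1
    ext y
    exact ⟨fun hy => ⟨y.2, hy⟩, fun hy => hy.2⟩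
  · convert (hr.upper x x.2).preimage continuous_subtype_val using 1
    ext y
    exact ⟨fun hy => ⟨y.2, hy⟩, fun hy => hy.2⟩

theorem Orderable.isIntervalSpace {S : Set X} (hS : IsCompact S) (h : Orderable S) :
    IsIntervalSpace S := by
  obtain ⟨r, hr⟩ := h
  obtain ⟨lo, ho, -⟩ := hr.exists_linearOrder hS
  exact ⟨lo, ho⟩

theorem IsIntervalSpace.orderable {S : Set X} (hS : IsClosed S) (h : IsIntervalSpace S) :
    Orderable S := by
  obtain ⟨lo, hlo⟩ := h
  refine ⟨fun x y => ∃ (hx : x ∈ S) (hy : y ∈ S), (⟨x, hx⟩ : S) ≤ ⟨y, hy⟩, ⟨?_, ?_, ?_⟩, ?_, ?_⟩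
  · intro x hx y hy
    rcases le_total (⟨x, hx⟩ : S) ⟨y, hy⟩ with h | h
    exacts [.inl ⟨hx, hy, h⟩, .inr ⟨hy, hx, h⟩]
  · rintro x hx y hy ⟨_, _, h1⟩ ⟨_, _, h2⟩
    exact congrArg Subtype.val (le_antisymm h1 h2)
  · rintro x hx y hy z hz ⟨_, _, h1⟩ ⟨_, _, h2⟩
    exact ⟨hx, hz, h1.trans h2⟩
  · intro x hx
    convert hS.isClosedEmbedding_subtypeVal.isClosedMap _ (isClosed_Iic (a := (⟨x, hx⟩ : S)))
    ext y
    constructor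
    · rintro ⟨hy, _, _, h⟩
      exact ⟨⟨y, hy⟩, h, rfl⟩
    · rintro ⟨y, hy, rfl⟩
      exact ⟨y.2, y.2, hx, hy⟩
  · intro x hx
    convert hS.isClosedEmbedding_subtypeVal.isClosedMap _ (isClosed_Ici (a := (⟨x, hx⟩ : S)))
    ext y
    constructor
    · rintro ⟨hy, _, _, h⟩
      exact ⟨⟨y, hy⟩, h, rfl⟩
    · rintro ⟨y, hy, rfl⟩
      exact ⟨y.2, hx, y.2, hy⟩

theorem OrdOn.preimage {Z : Type*} [TopologicalSpace Z] {g : Z → X} (hg : Continuous g)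
    (hinj : Function.Injective g) {r : X → X → Prop} {S : Set X} (h : OrdOn r S) :
    OrdOn (fun x y => r (g x) (g y)) (g ⁻¹' S) where
  total _ hx _ hy := h.total _ hx _ hy
  antisymm _ hx _ hy h1 h2 := hinj (h.antisymm _ hx _ hy h1 h2)
  trans _ hx _ hy _ hz := h.trans _ hx _ hy _ hz
  lower _ hx := (h.lower _ hx).preimage hg
  upper _ hx := (h.upper _ hx).preimage hg

/-- Two disjoint closed ordered sets can be put one after the other. -/
theorem OrdOn.exists_sum {r₁ r₂ : X → X → Prop} {S₁ S₂ : Set X} (h₁ : OrdOn r₁ S₁)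
    (h₂ : OrdOn r₂ S₂) (hS₁ : IsClosed S₁) (hS₂ : IsClosed S₂) (hd : Disjoint S₁ S₂) :
    ∃ r, OrdOn r (S₁ ∪ S₂) ∧ (∀ x ∈ S₁, ∀ y ∈ S₂, r x y) ∧ ∀ x ∈ S₂, ∀ y ∈ S₂, r₂ x y → r x y := by
  classical
  have hne : ∀ x ∈ S₂, x ∉ S₁ := fun x hx hx' => disjoint_left.1 hd hx' hx
  let π : X → ℕ := fun x => if x ∈ S₁ then 0 else 1
  have hπ₁ : ∀ x ∈ S₁, π x = 0 := fun x hx => if_pos hx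
  have hπ₂ : ∀ x ∈ S₂, π x = 1 := fun x hx => if_neg (hne x hx)
  let R : ℕ → X → X → Prop := fun n => if n = 0 then r₁ else r₂
  have hlin : LinOn (lexRel π R) (S₁ ∪ S₂) := by
    refine LinOn.lex fun i => ?_
    by_cases hi : i = 0
    · subst hi
      refine h₁.toLinOn.mono ?_
      rintro x ⟨hx | hx, hi⟩
      · exact hx
      · simp [hπ₂ x hx] at hi
    · simp only [R, if_neg hi]
      refine h₂.toLinOn.mono ?_
      rintro x ⟨hx | hx, hi'⟩
      · simp only [mem_preimage, hπ₁ x hx, mem_singleton_iff] at hi'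
        exact absurd hi'.symm hi
      · exact hx
  refine ⟨lexRel π R, ⟨hlin, ?_, ?_⟩, ?_, ?_⟩
  · rintro x (hx | hx)
    · convert h₁.lower x hx using 1
      ext y
      constructor
      · rintro ⟨hy | hy, hr⟩
        · simpa [lexRel, hπ₁ x hx, hπ₁ y hy, R, hy] using hr
        · simp [lexRel, hπ₁ x hx, hπ₂ y hy] at hr
      · rintro ⟨hy, hr⟩
        exact ⟨.inl hy, by simpa [lexRel, hπ₁ x hx, hπ₁ y hy, R] using hr⟩
    · convert hS₁.union (h₂.lower x hx) using 1
      ext y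
      constructor
      · rintro ⟨hy | hy, hr⟩
        · exact .inl hy
        · exact .inr ⟨hy, by simpa [lexRel, hπ₂ x hx, hπ₂ y hy, R] using hr⟩
      · rintro (hy | ⟨hy, hr⟩)
        · exact ⟨.inl hy, by simp [lexRel, hπ₂ x hx, hπ₁ y hy]⟩
        · exact ⟨.inr hy, by simpa [lexRel, hπ₂ x hx, hπ₂ y hy, R] using hr⟩
  · rintro x (hx | hx)
    · convert (h₁.upper x hx).union hS₂ using 1
      ext y
      constructor
      · rintro ⟨hy | hy, hr⟩
        · exact .inl ⟨hy, by simpa [lexRel, hπ₁ x hx, hπ₁ y hy, R] using hr⟩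
        · exact .inr hy
      · rintro (⟨hy, hr⟩ | hy)
        · exact ⟨.inl hy, by simpa [lexRel, hπ₁ x hx, hπ₁ y hy, R] using hr⟩
        · exact ⟨.inr hy, by simp [lexRel, hπ₁ x hx, hπ₂ y hy]⟩
    · convert h₂.upper x hx using 1
      ext y
      constructor
      · rintro ⟨hy | hy, hr⟩
        · simp [lexRel, hπ₂ x hx, hπ₁ y hy] at hr
        · exact ⟨hy, by simpa [lexRel, hπ₂ x hx, hπ₂ y hy, R] using hr⟩
      · rintro ⟨hy, hr⟩
        exact ⟨.inr hy, by simpa [lexRel, hπ₂ x hx, hπ₂ y hy, R] using hr⟩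
  · intro x hx y hy
    simp [lexRel, hπ₁ x hx, hπ₂ y hy]
  · intro x hx y hy hr
    simpa [lexRel, hπ₂ x hx, hπ₂ y hy, R] using hr

theorem Orderable.union {S₁ S₂ : Set X} (h₁ : Orderable S₁) (h₂ : Orderable S₂)
    (hS₁ : IsClosed S₁) (hS₂ : IsClosed S₂) (hd : Disjoint S₁ S₂) : Orderable (S₁ ∪ S₂) := by
  obtain ⟨r₁, h₁⟩ := h₁
  obtain ⟨r₂, h₂⟩ := h₂
  obtain ⟨r, hr, -⟩ := h₁.exists_sum h₂ hS₁ hS₂ hd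
  exact ⟨r, hr⟩

theorem OrdMax.union_left {S₁ S₂ : Set X} {p : X} (h₁ : Orderable S₁) (h₂ : OrdMax S₂ p)
    (hS₁ : IsClosed S₁) (hS₂ : IsClosed S₂) (hd : Disjoint S₁ S₂) : OrdMax (S₁ ∪ S₂) p := by
  obtain ⟨r₁, h₁⟩ := h₁
  obtain ⟨r₂, h₂, hp, hmax⟩ := h₂
  obtain ⟨r, hr, hlt, hrr⟩ := h₁.exists_sum h₂ hS₁ hS₂ hd
  refine ⟨r, hr, .inr hp, ?_⟩
  rintro x (hx | hx)
  · exact hlt x hx p hp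
  · exact hrr x hx p hp (hmax x hx)

/-- Two closed ordered sets can be glued at a common extreme point. -/
theorem OrdMax.glue {S₁ S₂ : Set X} {p : X} (h₁ : OrdMax S₁ p) (h₂ : OrdMin S₂ p)
    (hS₁ : IsClosed S₁) (hS₂ : IsClosed S₂) (hd : S₁ ∩ S₂ = {p}) : Orderable (S₁ ∪ S₂) := by
  classical
  obtain ⟨r₁, h₁, hp₁, hmax⟩ := h₁
  obtain ⟨r₂, h₂, hp₂, hmin⟩ := h₂
  have hne : ∀ x ∈ S₂, x ∈ S₁ → x = p := fun x hx hx' => by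
    have : x ∈ S₁ ∩ S₂ := ⟨hx', hx⟩
    rwa [hd] at this
  -- The shared point `p` is counted with `S₁`; being its maximum, it still stands directly before
  -- the rest of `S₂`.
  let π : X → ℕ := fun x => if x ∈ S₁ then 0 else 1
  have hπ₁ : ∀ x ∈ S₁, π x = 0 := fun x hx => if_pos hx
  have hπ₂ : ∀ x ∉ S₁, π x = 1 := fun x hx => if_neg hx
  let R : ℕ → X → X → Prop := fun n => if n = 0 then r₁ else r₂
  have hlin : LinOn (lexRel π R) (S₁ ∪ S₂) := by
    refine LinOn.lex fun i => ?_
    by_cases hi : i = 0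
    · subst hi
      refine h₁.toLinOn.mono ?_
      rintro x ⟨hx, hi⟩
      by_contra hx'
      simp [hπ₂ x hx'] at hi
    · simp only [R, if_neg hi]
      refine h₂.toLinOn.mono ?_
      rintro x ⟨hx | hx, hi'⟩
      · simp only [mem_preimage, hπ₁ x hx, mem_singleton_iff] at hi'
        exact absurd hi'.symm hi
      · exact hx
  refine ⟨lexRel π R, hlin, fun x hx => ?_, fun x hx => ?_⟩
  · by_cases hx₁ : x ∈ S₁
    · convert h₁.lower x hx₁ using 1
      ext y
      constructor
      · rintro ⟨-, hr⟩
        by_cases hy : y ∈ S₁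
        · exact ⟨hy, by simpa [lexRel, hπ₁ x hx₁, hπ₁ y hy, R] using hr⟩
        · simp [lexRel, hπ₁ x hx₁, hπ₂ y hy] at hr
      · rintro ⟨hy, hr⟩
        exact ⟨.inl hy, by simpa [lexRel, hπ₁ x hx₁, hπ₁ y hy, R] using hr⟩
    · have hx₂ := hx.resolve_left hx₁
      convert hS₁.union (h₂.lower x hx₂) using 1
      ext y
      constructor
      · rintro ⟨hy, hr⟩
        by_cases hy₁ : y ∈ S₁
        · exact .inl hy₁
        · exact .inr ⟨hy.resolve_left hy₁, by simpa [lexRel, hπ₂ x hx₁, hπ₂ y hy₁, R] using hr⟩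
      · intro hy
        by_cases hy₁ : y ∈ S₁
        · exact ⟨.inl hy₁, by simp [lexRel, hπ₂ x hx₁, hπ₁ y hy₁]⟩
        · obtain ⟨hy, hr⟩ := hy.resolve_left hy₁
          exact ⟨.inr hy, by simpa [lexRel, hπ₂ x hx₁, hπ₂ y hy₁, R] using hr⟩
  · by_cases hx₁ : x ∈ S₁
    · convert (h₁.upper x hx₁).union hS₂ using 1
      ext y
      constructor
      · rintro ⟨hy, hr⟩
        by_cases hy₁ : y ∈ S₁
        · exact .inl ⟨hy₁, by simpa [lexRel, hπ₁ x hx₁, hπ₁ y hy₁, R] using hr⟩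
        · exact .inr (hy.resolve_left hy₁)
      · intro hy
        by_cases hy₁ : y ∈ S₁
        · refine ⟨.inl hy₁, ?_⟩
          have : r₁ x y := by
            rcases hy with hy | hy
            · exact hy.2
            · rw [hne y hy hy₁]; exact hmax x hx₁
          simpa [lexRel, hπ₁ x hx₁, hπ₁ y hy₁, R] using this
        · refine ⟨.inr (hy.resolve_left fun h => hy₁ h.1), ?_⟩
          simp [lexRel, hπ₁ x hx₁, hπ₂ y hy₁]
    · have hx₂ := hx.resolve_left hx₁
      convert h₂.upper x hx₂ using 1
      ext y
      constructor
      · rintro ⟨hy, hr⟩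
        by_cases hy₁ : y ∈ S₁
        · simp [lexRel, hπ₂ x hx₁, hπ₁ y hy₁] at hr
        · exact ⟨hy.resolve_left hy₁, by simpa [lexRel, hπ₂ x hx₁, hπ₂ y hy₁, R] using hr⟩
      · rintro ⟨hy, hr⟩
        have hy₁ : y ∉ S₁ := by
          intro hy₁
          have hyp := hne y hy hy₁
          subst hyp
          exact hx₁ (h₂.antisymm x hx₂ y hy hr (hmin x hx₂) ▸ hy₁)
        exact ⟨.inr hy, by simpa [lexRel, hπ₂ x hx₁, hπ₂ y hy₁, R] using hr⟩

/-- A closed set which is exhausted, up to the point `p`, by a well-ordered chain of clopen sets can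
be ordered with largest element `p` if its successive differences can be ordered suitably. -/
theorem ordMax_of_chain [T1Space X] {I : Type*} [LinearOrder I] [WellFoundedLT I] {Y : Set X}
    {p : X} (hY : IsClosed Y) (hp : p ∈ Y) {U : I → Set X} (hU : ∀ i, IsClopen (U i))
    (hmono : Monotone U) (hpU : ∀ i, p ∉ U i) (hcov : ∀ x ∈ Y, x ≠ p → ∃ i, x ∈ U i)
    (hpiece : ∀ i, (IsClosed (Y ∩ ⋃ j < i, U j) ∧ Orderable (Y ∩ (U i \ ⋃ j < i, U j))) ∨
      ∃ z, IsClosed (insert z (Y ∩ ⋃ j < i, U j)) ∧ OrdMin (Y ∩ (U i \ ⋃ j < i, U j)) z) :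
    OrdMax Y p := by
  classical
  -- Both alternatives give closed lower rays. In the second, `z` is the only point that the earlier
  -- stages may lack for being closed, and as least element of the new piece it lies in every lower
  -- ray that meets the piece.
  have key : ∀ i, ∃ r, OrdOn r (Y ∩ (U i \ ⋃ j < i, U j)) ∧ ∀ x ∈ Y ∩ (U i \ ⋃ j < i, U j),
      IsClosed ((Y ∩ ⋃ j < i, U j) ∪ {y ∈ Y ∩ (U i \ ⋃ j < i, U j) | r y x}) := by
    intro i
    rcases hpiece i with ⟨hc, r, hr⟩ | ⟨z, hc, r, hr, hz, hmin⟩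
    · exact ⟨r, hr, fun x hx => hc.union (hr.lower x hx)⟩
    · refine ⟨r, hr, fun x hx => ?_⟩
      convert hc.union (hr.lower x hx) using 1
      rw [insert_union, eq_comm, insert_eq_self]
      exact .inr ⟨hz, hmin x hx⟩
  choose r hr hlow using key
  -- The first stage that contains `x`; within `Y` the default `⊤` is taken at `p` alone.
  let π : X → WithTop I := fun x =>
    if h : ∃ i, x ∈ U i then ((WellFounded.min wellFounded_lt {i | x ∈ U i} h : I) : WithTop I)
    else ⊤
  have hπ : ∀ x (i : I), π x = i ↔ x ∈ U i \ ⋃ j < i, U j := by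
    intro x i
    have hmem : (x ∈ U i \ ⋃ j < i, U j) ↔ x ∈ U i ∧ ∀ j < i, x ∉ U j := by simp
    rw [hmem]
    by_cases h : ∃ i, x ∈ U i
    · simp only [π, dif_pos h, WithTop.coe_inj]
      constructor
      · rintro rfl
        exact ⟨WellFounded.min_mem wellFounded_lt {i | x ∈ U i} h, fun j hj hx =>
          WellFounded.not_lt_min wellFounded_lt {i | x ∈ U i} hx hj⟩
      · rintro ⟨h1, h2⟩
        refine le_antisymm (not_lt.1 (WellFounded.not_lt_min wellFounded_lt {i | x ∈ U i} h1)) ?_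
        by_contra hc
        exact h2 _ (not_le.1 hc) (WellFounded.min_mem wellFounded_lt {i | x ∈ U i} h)
    · simp only [π, dif_neg h]
      push Not at h
      simp [h]
  have hπlt : ∀ x (i : I), π x < i ↔ x ∈ ⋃ j < i, U j := by
    intro x i
    constructor
    · intro h
      obtain ⟨j, hj⟩ := WithTop.ne_top_iff_exists.1 h.ne_top
      rw [← hj, WithTop.coe_lt_coe] at h
      exact mem_biUnion h ((hπ x j).1 hj.symm).1
    · intro h
      simp only [mem_iUnion, exists_prop] at h
      obtain ⟨j, hji, hx⟩ := h
      have hex : ∃ i, x ∈ U i := ⟨j, hx⟩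
      simp only [π, dif_pos hex, WithTop.coe_lt_coe]
      exact (not_lt.1 (WellFounded.not_lt_min wellFounded_lt {i | x ∈ U i} hx)).trans_lt hji
  have hπtop : ∀ x ∈ Y, π x = ⊤ ↔ x = p := by
    intro x hx
    constructor
    · intro h
      by_contra hc
      have hex := hcov x hx hc
      simp [π, dif_pos hex] at h
    · rintro rfl
      exact dif_neg (by simpa using hpU)
  let R : WithTop I → X → X → Prop := fun k => k.recTopCoe (fun _ _ => True) r
  have hlin : LinOn (lexRel π R) Y := by
    refine LinOn.lex fun k => ?_
    induction k using WithTop.recTopCoe with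
    | top =>
      have : ∀ x ∈ Y ∩ π ⁻¹' {⊤}, x = p := fun x hx => (hπtop x hx.1).1 hx.2
      exact ⟨fun x _ y _ => .inl trivial, fun x hx y hy _ _ => (this x hx).trans (this y hy).symm,
        fun _ _ _ _ _ _ _ _ => trivial⟩
    | coe i =>
      exact (hr i).toLinOn.mono fun x hx => ⟨hx.1, (hπ x i).1 hx.2⟩
  refine ⟨lexRel π R, ⟨hlin, fun x hx => ?_, fun x hx => ?_⟩, hp, fun x hx => ?_⟩
  · by_cases hxp : x = p
    · convert hY using 1
      ext y
      refine ⟨fun h => h.1, fun hy => ⟨hy, ?_⟩⟩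
      have hx' := (hπtop x hx).2 hxp
      by_cases hyp : y = p
      · exact .inr ⟨by rw [hxp, hyp], by rw [(hπtop y hy).2 hyp]; trivial⟩
      · exact .inl (by rw [hx']; exact lt_top_iff_ne_top.2 fun h => hyp ((hπtop y hy).1 h))
    · obtain ⟨i, hi⟩ := WithTop.ne_top_iff_exists.1 fun h => hxp ((hπtop x hx).1 h)
      have hxi : x ∈ Y ∩ (U i \ ⋃ j < i, U j) := ⟨hx, (hπ x i).1 hi.symm⟩
      convert hlow i x hxi using 1
      ext y
      constructor
      · rintro ⟨hy, h | ⟨h, h'⟩⟩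
        · rw [← hi] at h
          exact .inl ⟨hy, (hπlt y i).1 h⟩
        · rw [← hi] at h
          rw [h] at h'
          exact .inr ⟨⟨hy, (hπ y i).1 h⟩, h'⟩
      · rintro (⟨hy, h⟩ | ⟨⟨hy, h⟩, h'⟩)
        · exact ⟨hy, .inl (by rw [← hi]; exact (hπlt y i).2 h)⟩
        · have h := (hπ y i).2 h
          exact ⟨hy, .inr ⟨by rw [← hi, h], by rw [h]; exact h'⟩⟩
  · by_cases hxp : x = p
    · convert isClosed_singleton (x := p) using 1
      ext y
      constructor
      · rintro ⟨hy, h | ⟨h, -⟩⟩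
        · rw [(hπtop x hx).2 hxp] at h
          exact absurd h not_top_lt
        · exact (hπtop y hy).1 (h.symm.trans ((hπtop x hx).2 hxp))
      · intro hy
        rw [mem_singleton_iff] at hy
        rw [hy, hxp]
        exact ⟨hp, .inr ⟨rfl, by rw [(hπtop p hp).2 rfl]; trivial⟩⟩
    · obtain ⟨i, hi⟩ := WithTop.ne_top_iff_exists.1 fun h => hxp ((hπtop x hx).1 h)
      have hxi : x ∈ Y ∩ (U i \ ⋃ j < i, U j) := ⟨hx, (hπ x i).1 hi.symm⟩
      convert (hY.sdiff (hU i).2).union ((hr i).upper x hxi) using 1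
      ext y
      constructor
      · rintro ⟨hy, h | ⟨h, h'⟩⟩
        · rw [← hi] at h
          refine .inl ⟨hy, fun hyU => ?_⟩
          by_cases hyV : y ∈ ⋃ j < i, U j
          · exact h.not_gt ((hπlt y i).2 hyV)
          · exact h.ne' ((hπ y i).2 ⟨hyU, hyV⟩)
        · rw [← hi] at h h'
          exact .inr ⟨⟨hy, (hπ y i).1 h.symm⟩, h'⟩
      · rintro (⟨hy, h⟩ | ⟨⟨hy, h⟩, h'⟩)
        · refine ⟨hy, .inl ?_⟩
          rw [← hi]
          refine lt_of_not_ge fun hle => ?_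
          rcases hle.lt_or_eq with hlt | heq
          · obtain ⟨j, hj⟩ := WithTop.ne_top_iff_exists.1 hlt.ne_top
            have hyj := ((hπ y j).1 hj.symm).1
            rw [← hj, WithTop.coe_lt_coe] at hlt
            exact h (hmono hlt.le hyj)
          · exact h ((hπ y i).1 heq).1
        · have h := (hπ y i).2 h
          exact ⟨hy, .inr ⟨by rw [← hi, h], by rw [← hi]; exact h'⟩⟩
  · by_cases hxp : x = p
    · exact .inr ⟨by rw [hxp], by rw [(hπtop x hx).2 hxp]; trivial⟩
    · refine .inl ?_
      rw [(hπtop p hp).2 rfl]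
      exact lt_top_iff_ne_top.2 fun h => hxp ((hπtop x hx).1 h)

end Orderable

/-! ### Strands -/

/-- The extension of a sequence of length `κ` to `κ + 1`. -/
def tower {X : Type u} {κ : Cardinal.{u}} (p : X) (y : Below κ → X) : UpTo κ → X :=
  WithTop.recTopCoe p y

@[simp] theorem tower_coe {X : Type u} {κ : Cardinal.{u}} (p : X) (y : Below κ → X) (i : Below κ) :
    tower p y i = y i := rfl

section Strand

variable {X : Type u} [TopologicalSpace X]

/-- A decreasing sequence of sets `T i`, indexed by the cardinal `κ`, which converges to `p`, such
that each `T j` is the union of `T i` and a closed set that meets `T i` exactly in `y i`. -/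
structure IsStrand (p : X) (κ : Cardinal.{u}) (T : Below κ → Set X) (y : Below κ → X) :
    Prop where
  anti : Antitone T
  closed : ∀ i, IsClosed (insert p (T i))
  notMem : ∀ i, p ∉ T i
  mem : ∀ i, y i ∈ T i
  notMem_of_lt : ∀ i k, i < k → y i ∉ T k
  closed_diff : ∀ j i, j ≤ i → IsClosed (insert (y i) (T j \ T i))
  limit : ∀ i, IsSuccLimit i → ∀ x, (∀ j < i, x ∈ T j) → x ∈ T i
  exhaust : ∀ x, ∃ i, x ∉ T i

variable {p : X} {κ : Cardinal.{u}} {T : Below κ → Set X} {y : Below κ → X}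

namespace IsStrand

theorem ne (h : IsStrand p κ T y) (i : Below κ) : y i ≠ p :=
  fun he => h.notMem i (he ▸ h.mem i)

theorem injective (h : IsStrand p κ T y) : Function.Injective y := by
  intro i j hij
  by_contra hne
  rcases lt_or_gt_of_ne hne with hlt | hlt
  · exact h.notMem_of_lt i j hlt (hij ▸ h.mem j)
  · exact h.notMem_of_lt j i hlt (hij ▸ h.mem i)

theorem injective_tower (h : IsStrand p κ T y) : Function.Injective (tower p y) := by
  intro i j hij
  induction i using WithTop.recTopCoe with
  | top =>
    induction j using WithTop.recTopCoe with
    | top => rfl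
    | coe j => exact absurd hij.symm (h.ne j)
  | coe i =>
    induction j using WithTop.recTopCoe with
    | top => exact absurd hij (h.ne i)
    | coe j => exact congrArg _ (h.injective hij)

/-- Composition with a normal function. -/
theorem comp (h : IsStrand p κ T y) {e : Below κ → Below κ} (he : IsNormal e) :
    IsStrand p κ (T ∘ e) (y ∘ e) where
  anti := h.anti.comp_monotone he.monotone
  closed i := h.closed _
  notMem i := h.notMem _
  mem i := h.mem _
  notMem_of_lt i k hik := h.notMem_of_lt _ _ (he.strictMono hik)
  closed_diff j i hji := h.closed_diff _ _ (he.monotone hji)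
  limit i hi x hx := by
    refine h.limit _ (he.map_isSuccLimit hi) x fun k hk => ?_
    obtain ⟨j, hj, hkj⟩ := (he.lt_iff_exists_lt hi).1 hk
    exact h.anti hkj.le (hx j hj)
  exhaust x := by
    obtain ⟨i, hi⟩ := h.exhaust x
    exact ⟨i, fun hx => hi (h.anti he.strictMono.le_apply hx)⟩

variable [CompactSpace X]

/-- Compactness: the closed sets `insert p (T i)` decrease to `{p}`. -/
theorem exists_disjoint (h : IsStrand p κ T y) (hκ : κ.IsRegular) {K : Set X} (hK : IsClosed K)
    (hp : p ∉ K) : ∃ i, Disjoint K (T i) := by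
  have := nonempty_below hκ
  obtain ⟨i, hi⟩ := hK.isCompact.elim_directed_family_closed
    (fun i => insert p (T i)) h.closed (by
      refine eq_empty_of_forall_notMem fun x hx => ?_
      obtain ⟨i, hi⟩ := h.exhaust x
      rcases mem_iInter.1 hx.2 i with rfl | h'
      · exact hp hx.1
      · exact hi h')
    (fun i j => ⟨max i j, insert_subset_insert (h.anti (le_max_left _ _)),
      insert_subset_insert (h.anti (le_max_right _ _))⟩)
  exact ⟨i, (disjoint_iff_inter_eq_empty.2 hi).mono_right (subset_insert _ _)⟩

theorem exists_subset (h : IsStrand p κ T y) (hκ : κ.IsRegular) {V : Set X} (hV : IsOpen V)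
    (hp : p ∈ V) : ∃ i, T i ⊆ V := by
  obtain ⟨i, hi⟩ := h.exists_disjoint hκ hV.isClosed_compl (not_not.2 hp)
  exact ⟨i, disjoint_compl_left_iff_subset.1 hi⟩

/-- The same compactness argument at a limit index: by the `limit` condition the closed sets `insert
(y i) (T j \ T i)`, for `j < i`, decrease to `{y i}`. -/
theorem exists_diff_subset (h : IsStrand p κ T y) {i : Below κ} (hi : IsSuccLimit i) {V : Set X}
    (hV : IsOpen V) (hy : y i ∈ V) : ∃ j < i, T j \ T i ⊆ V := by
  obtain ⟨j₀, hj₀⟩ := not_isMin_iff.1 hi.1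
  have : Nonempty (Iio i) := ⟨⟨j₀, hj₀⟩⟩
  obtain ⟨j, hj⟩ := hV.isClosed_compl.isCompact.elim_directed_family_closed
    (fun j : Iio i => insert (y i) (T j \ T i)) (fun j => h.closed_diff _ _ (le_of_lt j.2)) (by
      refine eq_empty_of_forall_notMem fun x hx => ?_
      have hx' : ∀ j < i, x ∈ T j ∧ x ∉ T i := by
        intro j hj
        rcases mem_iInter.1 hx.2 ⟨j, hj⟩ with rfl | h'
        · exact absurd hy hx.1
        · exact h'
      exact (hx' j₀ hj₀).2 (h.limit i hi x fun j hj => (hx' j hj).1))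
    (fun j k => ⟨max j k,
      insert_subset_insert (sdiff_subset_sdiff_left (h.anti (le_max_left j.1 k.1))),
      insert_subset_insert (sdiff_subset_sdiff_left (h.anti (le_max_right j.1 k.1)))⟩)
  refine ⟨j, j.2, fun x hx => ?_⟩
  by_contra hc
  exact (eq_empty_iff_forall_notMem.1 hj) x ⟨hc, .inr hx⟩

/-- Only limits matter in a well-order. The strand shrinks to `p` at the top, and its segments
shrink to `y i` at a limit `i`. With `injective_tower` this embeds `κ + 1`. -/
theorem continuous_tower (h : IsStrand p κ T y) (hκ : κ.IsRegular) : Continuous (tower p y) := by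
  refine ⟨fun V hV => isOpen_of_forall_isSuccLimit fun i hi hlim => ?_⟩
  induction i using WithTop.recTopCoe with
  | top =>
    obtain ⟨j, hj⟩ := h.exists_subset hκ hV hi
    refine ⟨j, WithTop.coe_lt_top j, fun k hk => ?_⟩
    induction k using WithTop.recTopCoe with
    | top => exact hi
    | coe k => exact hj (h.anti (WithTop.coe_le_coe.1 hk.1.le) (h.mem k))
  | coe i =>
    have hlim' : IsSuccLimit i := by
      rw [isSuccLimit_iff_forall_exists] at hlim ⊢
      obtain ⟨⟨j, hj⟩, h2⟩ := hlim
      lift j to Below κ using hj.ne_top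
      refine ⟨⟨j, WithTop.coe_lt_coe.1 hj⟩, fun j hj => ?_⟩
      obtain ⟨k, hk, hki⟩ := h2 j (WithTop.coe_lt_coe.2 hj)
      lift k to Below κ using hki.ne_top
      exact ⟨k, WithTop.coe_lt_coe.1 hk, WithTop.coe_lt_coe.1 hki⟩
    obtain ⟨j, hj, hjV⟩ := h.exists_diff_subset hlim' hV hi
    refine ⟨j, WithTop.coe_lt_coe.2 hj, fun k hk => ?_⟩
    lift k to Below κ using (hk.2.trans_lt (WithTop.coe_lt_top i)).ne
    rcases (WithTop.coe_le_coe.1 hk.2).lt_or_eq with hlt | rfl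
    · exact hjV ⟨h.anti (WithTop.coe_lt_coe.1 hk.1).le (h.mem k), h.notMem_of_lt _ _ hlt⟩
    · exact hi

end IsStrand

/-! ### Arms -/

/-- `S` is covered by `S'` and a closed set which omits `p`. -/
def CoverMod (p : X) (S S' : Set X) : Prop := ∃ K, IsClosed K ∧ p ∉ K ∧ S ⊆ K ∪ S'

theorem CoverMod.of_subset {S S' : Set X} (h : S ⊆ S') : CoverMod p S S' :=
  ⟨∅, isClosed_empty, notMem_empty p, h.trans subset_union_right⟩

theorem CoverMod.union {S S' R R' : Set X} (h : CoverMod p S S') (h' : CoverMod p R R') :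
    CoverMod p (S ∪ R) (S' ∪ R') := by
  obtain ⟨K, hK, hp, hS⟩ := h
  obtain ⟨K', hK', hp', hS'⟩ := h'
  refine ⟨K ∪ K', hK.union hK', fun h => h.elim hp hp', union_subset ?_ ?_⟩
  · exact hS.trans (union_subset_union subset_union_left subset_union_left)
  · exact hS'.trans (union_subset_union subset_union_right subset_union_right)

theorem CoverMod.trans {S S' R : Set X} (h : CoverMod p S S') (h' : CoverMod p S' R) :
    CoverMod p S R := by
  obtain ⟨K, hK, hp, hS⟩ := h
  obtain ⟨K', hK', hp', hR⟩ := h'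
  refine ⟨K ∪ K', hK.union hK', fun h => h.elim hp hp', hS.trans ?_⟩
  rw [union_assoc]
  exact union_subset_union_right _ hR

/-- The union of a strand of uncountable regular length. -/
def IsArm (p : X) (E : Set X) : Prop :=
  ∃ (κ : Cardinal.{u}) (T : Below κ → Set X) (y : Below κ → X),
    κ.IsRegular ∧ ℵ₀ < κ ∧ IsStrand p κ T y ∧ E = ⋃ i, T i

theorem exists_forall_le_below (hκ : κ.IsRegular) : ∃ m : Below κ, ∀ i, m ≤ i := by
  have := nonempty_below hκ
  exact ⟨WellFounded.min wellFounded_lt univ univ_nonempty,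
    fun i => not_lt.1 (WellFounded.not_lt_min wellFounded_lt univ (mem_univ i))⟩

/-- A tail discards only part of a set which is closed once `y i` is added, and that closed set
omits `p`. Near `p` nothing is lost. -/
theorem IsStrand.coverMod (h : IsStrand p κ T y) (hκ : κ.IsRegular) (i : Below κ) :
    CoverMod p (⋃ j, T j) (T i) := by
  obtain ⟨m, hm⟩ := exists_forall_le_below hκ
  refine ⟨insert (y i) (T m \ T i), h.closed_diff _ _ (hm i), ?_, ?_⟩
  · rintro (hp | hp)
    · exact h.ne i hp.symm
    · exact h.notMem m hp.1
  · refine iUnion_subset fun j x hx => ?_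
    by_cases hxi : x ∈ T i
    · exact .inr hxi
    · exact .inl (.inr ⟨h.anti (hm j) hx, hxi⟩)

theorem IsStrand.isArm_tail (h : IsStrand p κ T y) (hκ : κ.IsRegular) (hω : ℵ₀ < κ)
    (i : Below κ) : ∃ E, IsArm p E ∧ E ⊆ T i ∧ CoverMod p (⋃ j, T j) E := by
  obtain ⟨e, he, hei⟩ := exists_isNormal_of_isClub hκ (isClub_Ioi hκ i)
  refine ⟨⋃ j, T (e j), ⟨κ, _, _, hκ, hω, h.comp he, rfl⟩,
    iUnion_subset fun j => h.anti (le_of_lt (hei j)), ?_⟩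
  obtain ⟨m, -⟩ := exists_forall_le_below hκ
  exact (h.coverMod hκ (e m)).trans (.of_subset (subset_iUnion (fun j => T (e j)) m))

theorem IsArm.notMem {E : Set X} (h : IsArm p E) : p ∉ E := by
  obtain ⟨κ, T, y, hκ, hω, hs, rfl⟩ := h
  simpa using hs.notMem

theorem IsArm.isClosed_insert {E : Set X} (h : IsArm p E) : IsClosed (insert p E) := by
  obtain ⟨κ, T, y, hκ, hω, hs, rfl⟩ := h
  obtain ⟨m, hm⟩ := exists_forall_le_below hκ
  have : ⋃ i, T i = T m :=
    (iUnion_subset fun i => hs.anti (hm i)).antisymm (subset_iUnion T m)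
  rw [this]
  exact hs.closed m

variable [CompactSpace X]

/-- Each compact piece is left behind at some index, and an uncountable regular length bounds
countably many such indices. This separates arms from σ-compact sets. -/
theorem IsStrand.exists_disjoint_of_isSigmaCompact [T2Space X] (hs : IsStrand p κ T y)
    (hκ : κ.IsRegular) (hω : ℵ₀ < κ) {D : Set X} (hD : IsSigmaCompact D) (hp : p ∉ D) :
    ∃ i, Disjoint D (T i) := by
  obtain ⟨C, hC, rfl⟩ := hD
  have : ∀ n, ∃ i, Disjoint (C n) (T i) := fun n =>
    hs.exists_disjoint hκ (hC n).isClosed fun hpn => hp (mem_iUnion_of_mem n hpn)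
  choose i hi using this
  obtain ⟨b, hb⟩ := exists_forall_lt_of_countable hκ hω i
  exact ⟨b, disjoint_iUnion_left.2 fun n => (hi n).mono_right (hs.anti (hb n).le)⟩

theorem IsArm.exists_disjoint [T2Space X] {E D : Set X} (h : IsArm p E) (hD : IsSigmaCompact D)
    (hp : p ∉ D) : ∃ E', IsArm p E' ∧ E' ⊆ E ∧ CoverMod p E E' ∧ Disjoint D E' := by
  obtain ⟨κ, T, y, hκ, hω, hs, rfl⟩ := h
  obtain ⟨i, hi⟩ := hs.exists_disjoint_of_isSigmaCompact hκ hω hD hp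
  obtain ⟨E, hE, hEi, hcov⟩ := hs.isArm_tail hκ hω i
  exact ⟨E, hE, hEi.trans (subset_iUnion T i), hcov, hi.mono_right hEi⟩

/-- Strands of different lengths have disjoint tails. -/
theorem IsStrand.exists_disjoint_tail_of_lt (hs : IsStrand p κ T y) (hκ : κ.IsRegular)
    {κ' : Cardinal.{u}} {T' : Below κ' → Set X} {y' : Below κ' → X} (hs' : IsStrand p κ' T' y')
    (hκ' : κ'.IsRegular) (hlt : κ < κ') : ∃ i', Disjoint (⋃ i, T i) (T' i') := by
  obtain ⟨m, hm⟩ := exists_forall_le_below hκ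
  have : ∀ i, ∃ i', Disjoint (insert (y i) (T m \ T i)) (T' i') := fun i =>
    hs'.exists_disjoint hκ' (hs.closed_diff m i (hm i)) (by
      rintro (hp | hp)
      · exact hs.ne i hp.symm
      · exact hs.notMem m hp.1)
  choose g hg using this
  -- There is one threshold for each index of the shorter strand, fewer than `κ'` in all.
  obtain ⟨b, hb⟩ := exists_forall_lt_of_mk_lt hκ' (s := range g)
    (mk_range_le.trans_lt (by simpa using hlt))
  refine ⟨b, disjoint_left.2 fun x hx hxb => ?_⟩
  obtain ⟨j, hj⟩ := mem_iUnion.1 hx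
  obtain ⟨i, hi⟩ := hs.exhaust x
  exact disjoint_left.1 (hg i) (.inr ⟨hs.anti (hm j) hj, hi⟩) (hs'.anti (hb _ ⟨i, rfl⟩).le hxb)

/-- Two strands of the same length without disjoint tails can be united. -/
theorem IsStrand.exists_merge [T2Space X] (hκ : κ.IsRegular) (hω : ℵ₀ < κ)
    (hs : IsStrand p κ T y) {T' : Below κ → Set X} {y' : Below κ → X} (hs' : IsStrand p κ T' y')
    (hmeet : ∀ i, ¬ Disjoint (T i) (T' i)) :
    ∃ e : Below κ → Below κ, IsNormal e ∧
      IsStrand p κ (fun i => T (e i) ∪ T' (e i)) (y ∘ e) := by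
  obtain ⟨m, hm⟩ := exists_forall_le_below hκ
  choose z hz hz' using fun i => not_disjoint_iff.1 (hmeet i)
  -- By stage `k` the common point `z j` has left both strands, and the part of either strand before
  -- `j` misses the tail of the other.
  have hg : ∀ j, ∃ k, z j ∉ T k ∧ z j ∉ T' k ∧ Disjoint (insert (y j) (T m \ T j)) (T' k) ∧
      Disjoint (insert (y' j) (T' m \ T' j)) (T k) := by
    intro j
    obtain ⟨k₁, h₁⟩ := hs.exhaust (z j)
    obtain ⟨k₂, h₂⟩ := hs'.exhaust (z j)
    obtain ⟨k₃, h₃⟩ := hs'.exists_disjoint hκ (hs.closed_diff m j (hm j)) (by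
      rintro (hp | hp)
      · exact hs.ne j hp.symm
      · exact hs.notMem m hp.1)
    obtain ⟨k₄, h₄⟩ := hs.exists_disjoint hκ (hs'.closed_diff m j (hm j)) (by
      rintro (hp | hp)
      · exact hs'.ne j hp.symm
      · exact hs'.notMem m hp.1)
    refine ⟨max (max k₁ k₂) (max k₃ k₄), fun h => h₁ (hs.anti (by simp) h),
      fun h => h₂ (hs'.anti (by simp) h), h₃.mono_right (hs'.anti (by simp)),
      h₄.mono_right (hs.anti (by simp))⟩
  choose g hg₁ hg₂ hg₃ hg₄ using hg
  obtain ⟨e, he, heC⟩ := exists_isNormal_of_isClub hκ (isClub_closurePoints hκ hω g)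
  -- At a limit closed under `g`, the common points `z j` with `j < i` lie in the segments of both
  -- strands that shrink to `y i` and to `y' i`.
  have hy : ∀ i, IsSuccLimit i → (∀ j < i, g j < i) → y i = y' i := by
    intro i hi hgi
    by_contra hne
    obtain ⟨V, V', hV, hV', hyV, hyV', hVV⟩ := t2_separation hne
    obtain ⟨j, hj, hjV⟩ := hs.exists_diff_subset hi hV hyV
    obtain ⟨j', hj', hjV'⟩ := hs'.exists_diff_subset hi hV' hyV'
    have hk : max j j' < i := max_lt hj hj'
    refine disjoint_left.1 hVV (hjV ⟨hs.anti (le_max_left j j') (hz _), fun h => ?_⟩)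
      (hjV' ⟨hs'.anti (le_max_right j j') (hz' _), fun h => ?_⟩)
    · exact hg₁ _ (hs.anti (hgi _ hk).le h)
    · exact hg₂ _ (hs'.anti (hgi _ hk).le h)
  -- What one strand loses before a closure point does not reappear in the other. Hence the
  -- differences of the unions are the unions of the differences.
  have hd : ∀ i, IsSuccLimit i → (∀ j < i, g j < i) → ∀ j, ∀ x ∈ T j \ T i, x ∉ T' i := by
    intro i hi hgi j x hx hx'
    have : ∃ k < i, x ∉ T k := by
      by_contra! hc
      exact hx.2 (hs.limit i hi x hc)
    obtain ⟨k, hk, hxk⟩ := this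
    exact disjoint_left.1 (hg₃ k) (.inr ⟨hs.anti (hm j) hx.1, hxk⟩) (hs'.anti (hgi k hk).le hx')
  have hd' : ∀ i, IsSuccLimit i → (∀ j < i, g j < i) → ∀ j, ∀ x ∈ T' j \ T' i, x ∉ T i := by
    intro i hi hgi j x hx hx'
    have : ∃ k < i, x ∉ T' k := by
      by_contra! hc
      exact hx.2 (hs'.limit i hi x hc)
    obtain ⟨k, hk, hxk⟩ := this
    exact disjoint_left.1 (hg₄ k) (.inr ⟨hs'.anti (hm j) hx.1, hxk⟩) (hs.anti (hgi k hk).le hx')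
  have h1 := hs.comp he
  have h2 := hs'.comp he
  have hye : ∀ i, y (e i) = y' (e i) := fun i => hy _ (heC i).1 (heC i).2
  refine ⟨e, he, fun i j hij => union_subset_union (h1.anti hij) (h2.anti hij), fun i => ?_,
    fun i h => h.elim (h1.notMem i) (h2.notMem i), fun i => .inl (h1.mem i), fun i k hik h => ?_,
    fun j i hji => ?_, fun i hi x hx => ?_, fun x => ?_⟩
  · convert (h1.closed i).union (h2.closed i) using 1
    ext x; simp; tauto
  · rcases h with h | h
    · exact h1.notMem_of_lt i k hik h
    · exact h2.notMem_of_lt i k hik (by simpa [← hye] using h)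
  · convert (h1.closed_diff j i hji).union (h2.closed_diff j i hji) using 1
    ext x
    have a := hd _ (heC i).1 (heC i).2 (e j) x
    have b := hd' _ (heC i).1 (heC i).2 (e j) x
    simp only [Function.comp, mem_insert_iff, Set.mem_sdiff, mem_union, ← hye] at a b ⊢
    tauto
  · by_cases hxi : x ∈ T (e i)
    · exact .inl hxi
    · right
      have : ∃ k < i, x ∉ T (e k) := by
        by_contra! hc
        exact hxi (h1.limit i hi x hc)
      obtain ⟨k, hk, hxk⟩ := this
      refine h2.limit i hi x fun j hj => ?_
      rcases hx _ (max_lt hj hk) with h | h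
      · exact absurd (h1.anti (le_max_right j k) h) hxk
      · exact h2.anti (le_max_left j k) h
  · obtain ⟨i, hi⟩ := h1.exhaust x
    obtain ⟨j, hj⟩ := h2.exhaust x
    exact ⟨max i j, fun h => h.elim (fun h => hi (h1.anti (le_max_left _ _) h))
      (fun h => hj (h2.anti (le_max_right _ _) h))⟩

/-- Two arms either have disjoint tails or are almost covered by a single arm. -/
theorem IsArm.merge_or_disjoint [T2Space X] {E E' : Set X} (h : IsArm p E) (h' : IsArm p E') :
    (∃ F, IsArm p F ∧ F ⊆ E ∪ E' ∧ CoverMod p (E ∪ E') F) ∨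
    ∃ F F', IsArm p F ∧ IsArm p F' ∧ F ⊆ E ∧ F' ⊆ E' ∧ CoverMod p E F ∧ CoverMod p E' F' ∧
      Disjoint F F' := by
  obtain ⟨κ, T, y, hκ, hω, hs, rfl⟩ := h
  obtain ⟨κ', T', y', hκ', hω', hs', rfl⟩ := h'
  by_cases hd : ∃ i i', Disjoint (T i) (T' i')
  · right
    obtain ⟨i, i', hd⟩ := hd
    obtain ⟨F, hF, hFi, hcov⟩ := hs.isArm_tail hκ hω i
    obtain ⟨F', hF', hFi', hcov'⟩ := hs'.isArm_tail hκ' hω' i'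
    exact ⟨F, F', hF, hF', hFi.trans (subset_iUnion T i), hFi'.trans (subset_iUnion T' i'), hcov,
      hcov', hd.mono hFi hFi'⟩
  · left
    push Not at hd
    obtain ⟨m, hm⟩ := exists_forall_le_below hκ
    obtain ⟨m', hm'⟩ := exists_forall_le_below hκ'
    rcases lt_trichotomy κ κ' with hlt | rfl | hlt
    · obtain ⟨i', hi'⟩ := hs.exists_disjoint_tail_of_lt hκ hs' hκ' hlt
      exact absurd (hi'.mono_left (subset_iUnion T m)) (hd m i')
    · obtain ⟨e, he, hm⟩ := hs.exists_merge hκ hω hs' fun i => hd i i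
      refine ⟨⋃ i, (T (e i) ∪ T' (e i)), ⟨κ, _, _, hκ, hω, hm, rfl⟩, iUnion_subset fun i =>
        union_subset_union (subset_iUnion T (e i)) (subset_iUnion T' (e i)), ?_⟩
      exact ((hs.coverMod hκ (e m)).union (hs'.coverMod hκ (e m))).trans
        (.of_subset (subset_iUnion (fun i => T (e i) ∪ T' (e i)) m))
    · obtain ⟨i, hi⟩ := hs'.exists_disjoint_tail_of_lt hκ' hs hκ hlt
      exact absurd (hi.mono_left (subset_iUnion T' m')).symm (hd i m')

end Strand

/-! ### Arms in continuous images of compact ordered spaces -/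

/-- The elements that exceed all their predecessors in an auxiliary well-ordering form a cofinal,
well-ordered subset. This reduces the claim to idempotence of cofinality for well-orders. -/
theorem isRegular_cof_of_aleph0_le {A : Type v} [LinearOrder A] (h : ℵ₀ ≤ Order.cof A) :
    (Order.cof A).IsRegular := by
  have hs := isCofinal_setOfPred_imp_lt (WellOrderingRel (α := A))
  set s : Set A := {a | ∀ b, WellOrderingRel b a → b < a}
  have hwf : WellFoundedLT s := by
    refine ⟨Subrelation.wf (r := InvImage WellOrderingRel Subtype.val) ?_
      (InvImage.wf _ IsWellFounded.wf)⟩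
    intro a b hab
    rcases trichotomous_of (WellOrderingRel (α := A)) a.1 b.1 with h | h | h
    · exact h
    · exact absurd h (ne_of_lt hab)
    · exact absurd (a.2 b h) (not_lt.2 (le_of_lt hab))
  have hc : Order.cof s = Order.cof A := Order.cof_eq_of_isCofinal hs
  refine ⟨h, ?_⟩
  rw [← hc, Order.cof_ord_cof]

section

variable {X : Type u} [TopologicalSpace X] [T2Space X]
  {L : Type v} [TopologicalSpace L] [LinearOrder L] [OrderTopology L]

/-- The cofinality of a half-open interval whose image converges to `p` is at most `#X`. -/
theorem lift_cof_Ico_le {f : L → X} (hf : Continuous f) {c b : L} (hcb : c < b)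
    (hne : ∀ x ∈ Ico c b, f x ≠ f b) :
    Cardinal.lift.{u} (Order.cof (Ico c b)) ≤ Cardinal.lift.{v} #X := by
  -- By continuity at `b`, the fibre of any `x ≠ f b` is bounded below `b`. One bound for each point
  -- of `X` makes a cofinal set.
  have hh : ∀ x : X, ∃ a : Ico c b, ∀ w : Ico c b, f w = x → w ≤ a := by
    intro x
    by_cases hx : x = f b
    · exact ⟨⟨c, le_rfl, hcb⟩, fun w hw => absurd (hw.trans hx) (hne w w.2)⟩
    · have : f ⁻¹' {x}ᶜ ∈ 𝓝 b :=
        hf.continuousAt.preimage_mem_nhds (isOpen_compl_singleton.mem_nhds (Ne.symm hx))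
      obtain ⟨l, hl, hlb⟩ := exists_Ioc_subset_of_mem_nhds this ⟨c, hcb⟩
      refine ⟨⟨max l c, le_max_right _ _, max_lt hl hcb⟩, fun w hw => ?_⟩
      by_contra hlt
      have hlt : max l c < w := not_le.1 hlt
      exact hlb ⟨(le_max_left _ _).trans_lt hlt, w.2.2.le⟩ hw
  choose h hh using hh
  have hcof : IsCofinal (range h) := fun a => ⟨h (f a), mem_range_self _, hh _ a rfl⟩
  exact (Cardinal.lift_le.2 (Order.cof_le hcof)).trans mk_range_le_lift

/-- For countable cofinality the image is a countable union of images of compact intervals.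
Otherwise a continuous cofinal sequence `d` is thinned to a club on which the images before and
after each cut point are disjoint; the images of the final segments then form a strand. -/
theorem isArm_or_isSigmaCompact_image_Ico [CompactSpace L] {p : X} {f : L → X} (hf : Continuous f)
    {c b : L} (hcb : c < b) (hb : f b = p) (hne : ∀ x ∈ Ico c b, f x ≠ p) :
    IsSigmaCompact (f '' Ico c b) ∨
      ∃ E, IsArm p E ∧ E ⊆ f '' Ico c b ∧ CoverMod p (f '' Ico c b) E := by
  obtain ⟨s, hs, hsc⟩ := Order.exists_cof_eq (Ico c b)
  have hIcc : ∀ a d, IsCompact (f '' Icc a d) := fun a d => isClosed_Icc.isCompact.image hf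
  by_cases hω : Order.cof (Ico c b) ≤ ℵ₀
  · left
    rw [← hsc, le_aleph0_iff_set_countable] at hω
    have : f '' Ico c b = ⋃ a ∈ s, f '' Icc c a := by
      ext x
      simp only [mem_iUnion, exists_prop]
      constructor
      · rintro ⟨w, hw, rfl⟩
        obtain ⟨a, ha, hwa⟩ := hs ⟨w, hw⟩
        exact ⟨a, ha, w, ⟨hw.1, hwa⟩, rfl⟩
      · rintro ⟨a, ha, w, hw, rfl⟩
        exact ⟨w, ⟨hw.1, hw.2.trans_lt a.2.2⟩, rfl⟩
    rw [this]
    exact isSigmaCompact_biUnion hω fun a _ => (hIcc c a).isSigmaCompact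
  right
  push Not at hω
  -- A strand length must live in the universe of `X`, while `L` may live elsewhere; the bound by
  -- the cardinality of `X` moves the cofinality there.
  obtain ⟨κ, hκ'⟩ := Cardinal.mem_range_lift_of_le
    (lift_cof_Ico_le hf hcb (by simpa [hb] using hne))
  have hκ : κ.IsRegular := by
    rw [← isRegular_lift_iff, hκ', isRegular_lift_iff]
    exact isRegular_cof_of_aleph0_le hω.le
  have hκω : ℵ₀ < κ := by
    rw [← Cardinal.lift_lt.{u, v}, hκ']
    simpa using hω
  have hmax := noMaxOrder_below hκ
  obtain ⟨m, hm⟩ := exists_forall_le_below hκ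
  have hcard : Cardinal.lift.{v} #(Below κ) = Cardinal.lift.{u} #s := by
    rw [hsc, ← hκ']
    simp
  obtain ⟨g⟩ := Cardinal.lift_mk_eq'.1 hcard
  have hbdd : ∀ i : Below κ, ∃ x : Ico c b, ∀ j < i, (g j : Ico c b) < x := by
    intro i
    have hlt : #((fun j => (g j : Ico c b)) '' Iio i) < Order.cof (Ico c b) := by
      rw [← Cardinal.lift_lt.{v, u}, ← hκ']
      exact mk_image_le_lift.trans_lt (Cardinal.lift_lt.2 (mk_Iio_lt i))
    have := not_isCofinal_iff.1 fun h => (Order.cof_le h).not_gt hlt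
    simpa using this
  have hgt : ∀ a : Ico c b, ∃ x : Ico c b, a < x := by
    intro a
    have hlt : #({a} : Set (Ico c b)) < Order.cof (Ico c b) := by
      simpa using one_lt_aleph0.trans hω
    have := not_isCofinal_iff.1 fun h => (Order.cof_le h).not_gt hlt
    simpa using this
  -- Suprema of initial parts of an enumerated cofinal set make `d` continuous at limits; the point
  -- `c` keeps the sets nonempty.
  choose d hd using fun i : Below κ =>
    exists_isLUB_of_compactSpace (s := insert c ((fun j => ((g j : Ico c b) : L)) '' Iio i))
      (insert_nonempty _ _)
  have hcd : ∀ i, c ≤ d i := fun i => (hd i).1 (mem_insert _ _)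
  have hdb : ∀ i, d i < b := by
    intro i
    obtain ⟨x, hx⟩ := hbdd i
    refine ((hd i).2 ?_).trans_lt x.2.2
    rintro _ (rfl | ⟨j, hj, rfl⟩)
    · exact x.2.1
    · exact (hx j hj).le
  have hdmono : Monotone d := fun i j hij => (hd i).2 fun x hx => (hd j).1 <| by
    rcases hx with rfl | ⟨k, hk, rfl⟩
    · exact mem_insert _ _
    · exact .inr ⟨k, lt_of_lt_of_le hk hij, rfl⟩
  have hdcof : ∀ a ∈ Ico c b, ∃ i, a ≤ d i := by
    intro a ha
    obtain ⟨x, hx, hax⟩ := hs ⟨a, ha⟩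
    obtain ⟨i, hi⟩ := exists_gt (g.symm ⟨x, hx⟩)
    refine ⟨i, (show a ≤ x from hax).trans ((hd i).1 (.inr ⟨_, hi, ?_⟩))⟩
    simp
  have hdlim : ∀ i, IsSuccLimit i → ∀ w, w < d i → ∃ j < i, w < d j := by
    intro i hi w hw
    obtain ⟨a, ha, hwa⟩ := (lt_isLUB_iff (hd i)).1 hw
    rcases ha with rfl | ⟨j, hj, rfl⟩
    · obtain ⟨j, hj⟩ := not_isMin_iff.1 hi.1
      exact ⟨j, hj, hwa.trans_le (hcd j)⟩
    · obtain ⟨k, hjk, hki⟩ := (isSuccLimit_iff_forall_exists.1 hi).2 j hj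
      exact ⟨k, hki, lt_of_lt_of_le hwa ((hd k).1 (.inr ⟨j, hjk, rfl⟩))⟩
  have hpIcc : ∀ i, p ∉ f '' Icc c (d i) := by
    rintro i ⟨w, hw, hwp⟩
    exact hne w ⟨hw.1, hw.2.trans_lt (hdb i)⟩ hwp
  have hsep : ∀ j, ∃ k, Disjoint (f '' Icc c (d j)) (f '' Ico (d k) b) := by
    intro j
    have : f ⁻¹' (f '' Icc c (d j))ᶜ ∈ 𝓝 b := hf.continuousAt.preimage_mem_nhds
      ((hIcc c (d j)).isClosed.isOpen_compl.mem_nhds (by rw [hb]; exact hpIcc j))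
    obtain ⟨l, hl, hlb⟩ := exists_Ioc_subset_of_mem_nhds this ⟨c, hcb⟩
    obtain ⟨x, hx⟩ := hgt ⟨max l c, le_max_right _ _, max_lt hl hcb⟩
    obtain ⟨k, hk⟩ := hdcof x x.2
    refine ⟨k, disjoint_left.2 ?_⟩
    rintro _ hw ⟨w', hw', rfl⟩
    have hlx : l < x := (le_max_left _ _).trans_lt (show max l c < (x : L) from hx)
    exact hlb ⟨hlx.trans_le (hk.trans hw'.1), hw'.2.le⟩ hw
  choose k hk using hsep
  obtain ⟨e, he, heC⟩ := exists_isNormal_of_isClub hκ (isClub_closurePoints hκ hκω k)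
  have hkey : ∀ i, ∀ j < e i, Disjoint (f '' Icc c (d j)) (f '' Ico (d (e i)) b) := fun i j hj =>
    (hk j).mono_right (image_mono (Ico_subset_Ico_left (hdmono ((heC i).2 j hj).le)))
  -- Although `f` need not be injective, on the club the image of a final segment can be removed
  -- without damaging the image of what precedes it.
  have hkey' : ∀ i, Disjoint (f '' Ico c (d (e i))) (f '' Ico (d (e i)) b) := by
    intro i
    refine disjoint_left.2 ?_
    rintro _ ⟨w, hw, rfl⟩ hx
    obtain ⟨j, hj, hwj⟩ := hdlim _ (heC i).1 w hw.2
    exact disjoint_left.1 (hkey i j hj) ⟨w, ⟨hw.1, hwj.le⟩, rfl⟩ hx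
  have hstrand : IsStrand p κ (fun i => f '' Ico (d (e i)) b) (fun i => f (d (e i))) := by
    refine ⟨fun i j hij => image_mono (Ico_subset_Ico_left (hdmono (he.monotone hij))),
      fun i => ?_, ?_, fun i => ⟨_, ⟨le_rfl, hdb _⟩, rfl⟩, fun i j hij => ?_,
      fun j i hji => ?_, fun i hi x hx => ?_, fun x => ?_⟩
    · convert (hIcc (d (e i)) b).isClosed using 1
      rw [← Ico_insert_right (hdb (e i)).le, image_insert_eq, hb]
    · rintro i ⟨w, hw, hwp⟩
      exact hne w ⟨(hcd _).trans hw.1, hw.2⟩ hwp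
    · exact disjoint_left.1 (hkey j _ (he.strictMono hij)) ⟨_, ⟨hcd _, le_rfl⟩, rfl⟩
    · convert (hIcc (d (e j)) (d (e i))).isClosed using 1
      rw [← Ico_insert_right (hdmono (he.monotone hji)), image_insert_eq]
      congr 1
      ext x
      constructor
      · rintro ⟨⟨w, hw, rfl⟩, hx⟩
        refine ⟨w, ⟨hw.1, ?_⟩, rfl⟩
        by_contra hc
        exact hx ⟨w, ⟨not_lt.1 hc, hw.2⟩, rfl⟩
      · rintro ⟨w, hw, rfl⟩
        exact ⟨⟨w, ⟨hw.1, hw.2.trans (hdb _)⟩, rfl⟩,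
          disjoint_left.1 (hkey' i) ⟨w, ⟨(hcd _).trans hw.1, hw.2⟩, rfl⟩⟩
    · obtain ⟨j₀, hj₀⟩ := not_isMin_iff.1 hi.1
      obtain ⟨w, hw, rfl⟩ := hx j₀ hj₀
      by_contra hc
      have hwlt : w < d (e i) := by
        by_contra hc'
        exact hc ⟨w, ⟨not_lt.1 hc', hw.2⟩, rfl⟩
      obtain ⟨l, hl, hwl⟩ := hdlim _ (heC i).1 w hwlt
      obtain ⟨j, hj, hlj⟩ := (he.lt_iff_exists_lt hi).1 hl
      exact disjoint_left.1 (hkey j l hlj) ⟨w, ⟨(hcd _).trans hw.1, hwl.le⟩, rfl⟩ (hx j hj)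
    · by_contra! hc
      obtain ⟨w, hw, rfl⟩ := hc m
      obtain ⟨l, hl⟩ := hdcof w ⟨(hcd _).trans hw.1, hw.2⟩
      obtain ⟨l', hl'⟩ := exists_gt l
      exact disjoint_left.1 (hkey l' l (hl'.trans_le he.strictMono.le_apply))
        ⟨w, ⟨(hcd _).trans hw.1, hl⟩, rfl⟩ (hc l')
  refine ⟨_, ⟨κ, _, _, hκ, hκω, hstrand, rfl⟩,
    iUnion_subset fun i => image_mono (Ico_subset_Ico_left (hcd _)),
    f '' Icc c (d (e m)), (hIcc _ _).isClosed, hpIcc _, ?_⟩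
  rintro _ ⟨w, hw, rfl⟩
  rcases le_total w (d (e m)) with h | h
  · exact .inl ⟨w, ⟨hw.1, h⟩, rfl⟩
  · exact .inr (mem_iUnion_of_mem m ⟨w, ⟨h, hw.2⟩, rfl⟩)

end

/-! ### Embedding obstructions -/

section Embed

variable {X : Type u} [TopologicalSpace X]

theorem nonempty_homeomorph_range [T2Space X] {Y : Type*} [TopologicalSpace Y] [CompactSpace Y]
    {g : Y → X}
    (hg : Continuous g) (hinj : Function.Injective g) : Nonempty (range g ≃ₜ Y) :=
  ⟨(hg.isClosedEmbedding hinj).isEmbedding.toHomeomorph.symm⟩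

/-- A copy of `κ + 1` with last point `p` whose other points belong to `B`. -/
def IsSpike (p : X) (κ : Cardinal.{u}) (B : Set X) : Prop :=
  ∃ φ : UpTo κ → X, Continuous φ ∧ Function.Injective φ ∧ φ ⊤ = p ∧ ∀ i : Below κ, φ i ∈ B

theorem IsStrand.isSpike [CompactSpace X] {p : X} {κ : Cardinal.{u}} {T : Below κ → Set X}
    {y : Below κ → X} (h : IsStrand p κ T y) (hκ : κ.IsRegular) : IsSpike p κ (⋃ i, T i) :=
  ⟨tower p y, h.continuous_tower hκ, h.injective_tower, rfl,
    fun i => mem_iUnion_of_mem i (h.mem i)⟩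

theorem IsArm.exists_isSpike [CompactSpace X] {p : X} {E : Set X} (h : IsArm p E) :
    ∃ κ : Cardinal.{u}, κ.IsRegular ∧ ℵ₀ < κ ∧ IsSpike p κ E := by
  obtain ⟨κ, T, y, hκ, hω, hs, rfl⟩ := h
  exact ⟨κ, hκ, hω, hs.isSpike hκ⟩

/-- Below its top, `ℵ₀ + 1` has no limit point, so continuity amounts to convergence of the
sequence. -/
theorem isSpike_aleph0 {p : X} {B : Set X} {s : ℕ → X} (hs : Function.Injective s)
    (hB : ∀ n, s n ∈ B) (hp : p ∉ B) (hlim : Tendsto s atTop (𝓝 p)) : IsSpike p ℵ₀ B := by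
  have hcard : Cardinal.lift.{0} #(Below (ℵ₀ : Cardinal.{u})) = Cardinal.lift.{u} #ℕ := by simp
  obtain ⟨g⟩ := Cardinal.lift_mk_eq'.1 hcard
  have hfin : ∀ i : Below (ℵ₀ : Cardinal.{u}), (Iio i).Finite := fun i =>
    Cardinal.lt_aleph0_iff_set_finite.1 (mk_Iio_lt i)
  have hne : ∀ n, s n ≠ p := fun n h => hp (h ▸ hB n)
  refine ⟨tower p (s ∘ g), ⟨fun V hV => isOpen_of_forall_isSuccLimit fun i hi hlim' => ?_⟩, ?_, rfl,
    fun i => hB _⟩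
  · induction i using WithTop.recTopCoe with
    | top =>
      have hV' : V ∈ 𝓝 p := hV.mem_nhds hi
      have h1 : {n | s n ∉ V}.Finite := by
        have := hlim.eventually hV'
        rw [← Nat.cofinite_eq_atTop] at this
        exact this
      have h2 : {i | s (g i) ∉ V}.Finite := h1.preimage g.injective.injOn
      obtain ⟨b, hb⟩ := exists_forall_lt_of_mk_lt isRegular_aleph0
        (Cardinal.lt_aleph0_iff_set_finite.2 h2)
      refine ⟨b, WithTop.coe_lt_top b, fun k hk => ?_⟩
      induction k using WithTop.recTopCoe with
      | top => exact hi
      | coe k =>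
        by_contra hc
        exact (hb k hc).not_gt (WithTop.coe_lt_coe.1 hk.1)
    | coe i =>
      exfalso
      rw [isSuccLimit_iff_forall_exists] at hlim'
      obtain ⟨⟨j, hj⟩, h2⟩ := hlim'
      lift j to Below (ℵ₀ : Cardinal.{u}) using hj.ne_top
      obtain ⟨k, hk, hmax⟩ := (hfin i).exists_maximal ⟨j, WithTop.coe_lt_coe.1 hj⟩
      obtain ⟨l, hl, hli⟩ := h2 k (WithTop.coe_lt_coe.2 hk)
      lift l to Below (ℵ₀ : Cardinal.{u}) using hli.ne_top
      exact (hmax (WithTop.coe_lt_coe.1 hli) (WithTop.coe_lt_coe.1 hl).le).not_gt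
        (WithTop.coe_lt_coe.1 hl)
  · intro i j hij
    induction i using WithTop.recTopCoe with
    | top =>
      induction j using WithTop.recTopCoe with
      | top => rfl
      | coe j => exact absurd hij.symm (hne _)
    | coe i =>
      induction j using WithTop.recTopCoe with
      | top => exact absurd hij (hne _)
      | coe j => exact congrArg _ (g.injective (hs hij))

/-- The three maps agree exactly at their tops, so together they factor through the quotient as a
continuous injection of a compact space. -/
theorem exists_isObstruction_of_spikes [T2Space X] {p : X} {κ l μ : Cardinal.{u}}
    (hlegal : IsLegalTriple κ l μ) {B₁ B₂ B₃ : Set X} (h₁ : IsSpike p κ B₁) (h₂ : IsSpike p l B₂)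
    (h₃ : IsSpike p μ B₃)
    (hp₁ : p ∉ B₁) (hp₂ : p ∉ B₂) (hp₃ : p ∉ B₃) (h₁₂ : Disjoint B₁ B₂) (h₁₃ : Disjoint B₁ B₃)
    (h₂₃ : Disjoint B₂ B₃) : ∃ A : Set X, IsObstruction A := by
  obtain ⟨φ₁, hc₁, hi₁, ht₁, hm₁⟩ := h₁
  obtain ⟨φ₂, hc₂, hi₂, ht₂, hm₂⟩ := h₂
  obtain ⟨φ₃, hc₃, hi₃, ht₃, hm₃⟩ := h₃
  let g : TripleSum κ l μ → X := Sum.elim φ₁ (Sum.elim φ₂ φ₃)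
  have hg : Continuous g := hc₁.sumElim (hc₂.sumElim hc₃)
  have hends : ∀ x ∈ tripleEnds κ l μ, g x = p := by
    rintro x (rfl | rfl | rfl)
    exacts [ht₁, ht₂, ht₃]
  have cross : ∀ {κ₁ κ₂ : Cardinal.{u}} {ψ₁ : UpTo κ₁ → X} {ψ₂ : UpTo κ₂ → X} {C₁ C₂ : Set X},
      ψ₁ ⊤ = p → ψ₂ ⊤ = p → (∀ i : Below κ₁, ψ₁ i ∈ C₁) → (∀ i : Below κ₂, ψ₂ i ∈ C₂) →
      p ∉ C₁ → p ∉ C₂ → Disjoint C₁ C₂ → ∀ i j, ψ₁ i = ψ₂ j → i = ⊤ ∧ j = ⊤ := by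
    intro κ₁ κ₂ ψ₁ ψ₂ C₁ C₂ t₁ t₂ m₁ m₂ n₁ n₂ hd i j hij
    induction i using WithTop.recTopCoe with
    | top =>
      refine ⟨rfl, ?_⟩
      induction j using WithTop.recTopCoe with
      | top => rfl
      | coe j => exact absurd (by rw [← t₁, hij]; exact m₂ j) n₂
    | coe i =>
      exfalso
      induction j using WithTop.recTopCoe with
      | top => exact n₁ (by rw [← t₂, ← hij]; exact m₁ i)
      | coe j => exact disjoint_left.1 hd (m₁ i) (hij ▸ m₂ j)
  have hsound : ∀ x y, (tripleSetoid κ l μ).r x y → g x = g y := by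
    rintro x y (rfl | ⟨hx, hy⟩)
    · rfl
    · rw [hends x hx, hends y hy]
  have hexact : ∀ x y, g x = g y → (tripleSetoid κ l μ).r x y := by
    rintro (i | i | i) (j | j | j) hij
    · exact .inl (congrArg _ (hi₁ hij))
    · obtain ⟨rfl, rfl⟩ := cross ht₁ ht₂ hm₁ hm₂ hp₁ hp₂ h₁₂ i j hij
      exact .inr ⟨by simp [tripleEnds], by simp [tripleEnds]⟩
    · obtain ⟨rfl, rfl⟩ := cross ht₁ ht₃ hm₁ hm₃ hp₁ hp₃ h₁₃ i j hij
      exact .inr ⟨by simp [tripleEnds], by simp [tripleEnds]⟩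
    · obtain ⟨rfl, rfl⟩ := cross ht₁ ht₂ hm₁ hm₂ hp₁ hp₂ h₁₂ j i hij.symm
      exact .inr ⟨by simp [tripleEnds], by simp [tripleEnds]⟩
    · exact .inl (congrArg _ (congrArg _ (hi₂ hij)))
    · obtain ⟨rfl, rfl⟩ := cross ht₂ ht₃ hm₂ hm₃ hp₂ hp₃ h₂₃ i j hij
      exact .inr ⟨by simp [tripleEnds], by simp [tripleEnds]⟩
    · obtain ⟨rfl, rfl⟩ := cross ht₁ ht₃ hm₁ hm₃ hp₁ hp₃ h₁₃ j i hij.symm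
      exact .inr ⟨by simp [tripleEnds], by simp [tripleEnds]⟩
    · obtain ⟨rfl, rfl⟩ := cross ht₂ ht₃ hm₂ hm₃ hp₂ hp₃ h₂₃ j i hij.symm
      exact .inr ⟨by simp [tripleEnds], by simp [tripleEnds]⟩
    · exact .inl (congrArg _ (congrArg _ (hi₃ hij)))
  let G : TripleSpace κ l μ → X := Quotient.lift g hsound
  have hG : Continuous G := hg.quotient_lift hsound
  have hGi : Function.Injective G := by
    intro a b
    induction a using Quotient.inductionOn
    induction b using Quotient.inductionOn
    exact fun h => Quotient.sound (hexact _ _ h)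
  exact ⟨range G, .inl ⟨κ, l, μ, hlegal, nonempty_homeomorph_range hG hGi⟩⟩

/-- Uncountably many points which converge to `p` give the one-point compactification of an
uncountable discrete space. -/
theorem exists_isObstruction_of_uncountable [T2Space X] {p : X} {ι : Type*} [Uncountable ι]
    {x : ι → X}
    (hx : ∀ i, x i ≠ p) (hlim : ∀ V, IsOpen V → p ∈ V → {i | x i ∉ V}.Finite) :
    ∃ A : Set X, IsObstruction A := by
  -- The family may repeat points, but convergence to `p` makes its fibres finite.
  have hR : ¬ (range x).Countable := by
    intro hR
    have huniv : (univ : Set ι) = ⋃ a ∈ range x, x ⁻¹' {a} := by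
      ext i; simp
    refine not_countable_univ (α := ι) ?_
    rw [huniv]
    refine hR.biUnion ?_
    rintro _ ⟨i, rfl⟩
    have := hlim {x i}ᶜ isOpen_compl_singleton (Ne.symm (hx i))
    exact (this.subset fun j hj => by simpa using hj).countable
  have hle : ℵ_ 1 ≤ #(range x) := by
    rw [← succ_aleph0, succ_le_iff, ← not_le, le_aleph0_iff_set_countable]
    exact hR
  obtain ⟨D, hDR, hD⟩ := le_mk_iff_exists_subset.1 hle
  let τ : TopologicalSpace D := ⊥
  have hdisc : DiscreteTopology D := ⟨rfl⟩
  have hDp : ∀ d : D, (d : X) ≠ p := by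
    rintro ⟨d, hd⟩
    obtain ⟨i, rfl⟩ := hDR hd
    exact hx i
  let g : OnePoint D → X := fun a => a.elim p (fun d => (d : X))
  have hg : Continuous g := by
    rw [OnePoint.continuous_iff_from_discrete]
    rw [tendsto_def]
    intro V hV
    obtain ⟨W, hWV, hW, hpW⟩ := mem_nhds_iff.1 hV
    have hfin : (x '' {i | x i ∉ W}).Finite := (hlim W hW hpW).image x
    rw [mem_cofinite]
    refine (hfin.preimage Subtype.val_injective.injOn).subset ?_
    intro d hd
    obtain ⟨i, hi⟩ := hDR d.2
    exact ⟨i, fun hiW => hd (hWV (by change (d : X) ∈ W; rw [← hi]; exact hiW)), hi⟩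
  have hinj : Function.Injective g := by
    intro a b hab
    induction a using OnePoint.rec with
    | infty =>
      induction b using OnePoint.rec with
      | infty => rfl
      | coe b => exact absurd hab.symm (hDp b)
    | coe a =>
      induction b using OnePoint.rec with
      | infty => exact absurd hab (hDp a)
      | coe b => exact congrArg _ (Subtype.ext hab)
  exact ⟨range g, .inr (.inr ⟨D, τ, hdisc, hD, nonempty_homeomorph_range hg hinj⟩)⟩

end Embed

/-! ### Sets whose approach to a point is countable -/

section Sequence

variable {X : Type u} [TopologicalSpace X] [T2Space X] [CompactSpace X]
  [TotallyDisconnectedSpace X]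

theorem IsSigmaCompact.exists_isClopen_exhaustion {p : X} {B : Set X} (hB : IsSigmaCompact B)
    (hp : p ∉ B) : ∃ U : ℕ → Set X, Monotone U ∧ (∀ n, IsClopen (U n)) ∧ (∀ n, p ∉ U n) ∧
      B ⊆ ⋃ n, U n := by
  obtain ⟨C, hC, rfl⟩ := hB
  have : ∀ n, ∃ W, IsClopen W ∧ C n ⊆ W ∧ W ⊆ {p}ᶜ := fun n =>
    exists_clopen_of_closed_subset_open (hC n).isClosed isOpen_compl_singleton
      fun x hx hxp => hp (mem_iUnion_of_mem n (by rwa [← (show x = p from hxp)]))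
  choose W hW hCW hWp using this
  refine ⟨fun n => ⋃ k ∈ Finset.range (n + 1), W k, fun m n hmn => ?_, fun n => ?_, fun n h => ?_,
    iUnion_subset fun n x hx => ?_⟩
  · exact biUnion_subset_biUnion_left (by simpa using hmn)
  · exact isClopen_biUnion_finset fun k _ => hW k
  · simp only [mem_iUnion] at h
    obtain ⟨k, -, hk⟩ := h
    exact hWp k hk rfl
  · exact mem_iUnion_of_mem n (mem_biUnion (x := n) (by simp) (hCW n hx))

/-- Choose `t n ∈ B` outside the `n`-th set of a clopen exhaustion. Off a neighbourhood of `p`,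
`insert p B` is compact and lies in one stage, so `t` converges. The stage at which `t n` is caught
tends to infinity, and a subsequence along which it increases strictly is injective. -/
theorem exists_seq_of_mem_closure {p : X} {B : Set X} (hB : IsSigmaCompact B) (hp : p ∉ B)
    (hBp : IsClosed (insert p B)) (hcl : p ∈ closure B) :
    ∃ s : ℕ → X, Function.Injective s ∧ (∀ n, s n ∈ B) ∧ Tendsto s atTop (𝓝 p) := by
  obtain ⟨U, hmono, hU, hpU, hBU⟩ := IsSigmaCompact.exists_isClopen_exhaustion hB hp
  have : ∀ n, ∃ x ∈ B, x ∉ U n := by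
    intro n
    by_contra! hc
    exact hpU n (closure_minimal hc (hU n).1 hcl)
  choose t ht htU using this
  have hlev : ∀ n, ∃ m, t n ∈ U m := fun n => mem_iUnion.1 (hBU (ht n))
  classical
  let ℓ : ℕ → ℕ := fun n => Nat.find (hlev n)
  have hℓ : ∀ n, n ≤ ℓ n := by
    intro n
    by_contra hc
    exact htU n (hmono (not_le.1 hc).le (Nat.find_spec (hlev n)))
  obtain ⟨φ, hφ, hφ'⟩ := strictMono_subseq_of_tendsto_atTop
    (tendsto_atTop_mono hℓ tendsto_id)
  have hlim : Tendsto t atTop (𝓝 p) := by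
    rw [tendsto_nhds]
    intro V hV hpV
    have hcpt : IsCompact (insert p B \ V) := (hBp.sdiff hV).isCompact
    obtain ⟨N, hN⟩ := hcpt.elim_directed_cover U (fun n => (hU n).2) (fun x hx => by
      rcases hx.1 with rfl | h
      · exact absurd hpV hx.2
      · exact hBU h) hmono.directed_le
    filter_upwards [eventually_ge_atTop N] with n hn
    by_contra hc
    exact htU n (hmono hn (hN ⟨.inr (ht n), hc⟩))
  refine ⟨t ∘ φ, fun m n hmn => hφ'.injective ?_, fun n => ht _, hlim.comp hφ.tendsto_atTop⟩
  have hmn : t (φ m) = t (φ n) := hmn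
  simp only [Function.comp, ℓ, hmn]

/-- If all closed subsets of `Y` which omit `p` are orderable and `Y` is the union of `{p}` and a
σ-compact set, then `Y` can be ordered with largest element `p`. -/
theorem ordMax_of_isSigmaCompact {p : X} {Y : Set X} (hY : IsClosed Y) (hp : p ∈ Y)
    (hσ : IsSigmaCompact (Y \ {p})) (hord : ∀ K ⊆ Y, IsClosed K → p ∉ K → Orderable K) :
    OrdMax Y p := by
  obtain ⟨U, hmono, hU, hpU, hYU⟩ := IsSigmaCompact.exists_isClopen_exhaustion hσ
    (p := p) (fun h => h.2 rfl)
  refine ordMax_of_chain hY hp hU hmono hpU (fun x hx hxp => mem_iUnion.1 (hYU ⟨hx, hxp⟩))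
    fun n => .inl ?_
  -- Only finitely many stages precede `n`, so their union is closed and each piece may be ordered
  -- arbitrarily.
  have hV : IsClopen (⋃ j < n, U j) := (finite_lt_nat n).isClopen_biUnion fun k _ => hU k
  exact ⟨hY.inter hV.1, hord _ inter_subset_left (hY.inter ((hU n).1.sdiff hV.2))
    fun h => hpU n h.2.1⟩

end Sequence

/-! ### The topology of the spaces over stationary sets -/

namespace StationarySpace

variable {l : Cardinal.{u}} {S : Set (Below l)} {μ : S → Cardinal.{u}}

theorem IsBasic.isOpen {B : Set (StationarySpace l S μ)} (hB : IsBasic B) : IsOpen B :=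
  TopologicalSpace.isOpen_generateFrom_of_mem hB

/-- The projection which collapses the fibers. -/
def proj : StationarySpace l S μ → UpTo l := Sum.elim id fun x => ((x.1 : Below l) : UpTo l)

@[simp] theorem proj_base (β : UpTo l) : proj (base β : StationarySpace l S μ) = β := rfl

@[simp] theorem proj_long (α : S) (γ : Below (μ α)) :
    proj (long α γ) = ((α : Below l) : UpTo l) := rfl

@[simp] theorem proj_short (α : S) (n : ℕ) :
    proj (short α n : StationarySpace l S μ) = ((α : Below l) : UpTo l) := rfl

@[elab_as_elim]
theorem cases_on {P : StationarySpace l S μ → Prop} (x : StationarySpace l S μ)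
    (hbase : ∀ β, P (base β)) (hlong : ∀ α γ, P (long α γ)) (hshort : ∀ α n, P (short α n)) :
    P x := by
  rcases x with β | ⟨α, γ | n⟩
  · exact hbase β
  · exact hlong α γ
  · exact hshort α n

theorem long_inj {α α' : S} {γ : Below (μ α)} {γ' : Below (μ α')} :
    (long α γ : StationarySpace l S μ) = long α' γ' ↔ (⟨α, γ⟩ : Σ α, Below (μ α)) = ⟨α', γ'⟩ := by
  constructor
  · intro h
    have h := Sum.inr_injective h
    rw [Sigma.mk.injEq] at h
    obtain ⟨rfl, h⟩ := h
    rw [Sum.inl_injective (eq_of_heq h)]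
  · intro h
    rw [Sigma.mk.injEq] at h
    obtain ⟨rfl, h⟩ := h
    rw [eq_of_heq h]

theorem short_inj {α α' : S} {n n' : ℕ} :
    (short α n : StationarySpace l S μ) = short α' n' ↔ α = α' ∧ n = n' := by
  constructor
  · intro h
    have h := Sum.inr_injective h
    rw [Sigma.mk.injEq] at h
    obtain ⟨rfl, h⟩ := h
    exact ⟨rfl, Sum.inr_injective (eq_of_heq h)⟩
  · rintro ⟨rfl, rfl⟩
    rfl

theorem base_ne_long (β : UpTo l) (α : S) (γ : Below (μ α)) :
    (base β : StationarySpace l S μ) ≠ long α γ := Sum.inl_ne_inr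

theorem base_ne_short (β : UpTo l) (α : S) (n : ℕ) :
    (base β : StationarySpace l S μ) ≠ short α n := Sum.inl_ne_inr

theorem long_ne_short (α α' : S) (γ : Below (μ α)) (n : ℕ) :
    (long α γ : StationarySpace l S μ) ≠ short α' n := by
  intro h
  have h := Sum.inr_injective h
  rw [Sigma.mk.injEq] at h
  obtain ⟨rfl, h⟩ := h
  exact Sum.inl_ne_inr (eq_of_heq h)

section BasicSet

variable {W : Set (UpTo l)} {σ : Finset S} {F : ∀ i : S, Set (UpTo (μ i))} {G : S → Set ℕ}

theorem base_mem_basicSet {β : UpTo l} :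
    (base β : StationarySpace l S μ) ∈ basicSet W σ F G ↔ β ∈ W := by
  simp only [basicSet, fiber, Set.mem_sdiff, mem_union, mem_image, mem_iUnion, mem_range]
  constructor
  · rintro ⟨⟨β', hβ, h⟩ | ⟨α, hα, ⟨γ, h⟩ | ⟨n, h⟩⟩, -⟩
    · rwa [← Sum.inl_injective h]
    · exact absurd h.symm (base_ne_long _ _ _)
    · exact absurd h.symm (base_ne_short _ _ _)
  · refine fun hβ => ⟨.inl ⟨β, hβ, rfl⟩, ?_⟩
    rintro ⟨i, hi, ⟨γ, hγ, h⟩ | ⟨n, hn, h⟩⟩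
    · exact base_ne_long _ _ _ h.symm
    · exact base_ne_short _ _ _ h.symm

theorem long_mem_basicSet {α : S} {γ : Below (μ α)} :
    (long α γ : StationarySpace l S μ) ∈ basicSet W σ F G ↔
      ((α : Below l) : UpTo l) ∈ W ∧ (α ∈ σ → (γ : UpTo (μ α)) ∉ F α) := by
  simp only [basicSet, fiber, Set.mem_sdiff, mem_union, mem_image, mem_iUnion, mem_range]
  constructor
  · rintro ⟨⟨β', hβ, h⟩ | ⟨α', hα, ⟨γ', h⟩ | ⟨n, h⟩⟩, h'⟩
    · exact absurd h (base_ne_long _ _ _)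
    · rw [long_inj, Sigma.mk.injEq] at h
      obtain ⟨rfl, h⟩ := h
      obtain rfl := eq_of_heq h
      exact ⟨hα, fun hσ hF => h' ⟨α', hσ, .inl ⟨γ', hF, rfl⟩⟩⟩
    · exact absurd h.symm (long_ne_short _ _ _ _)
  · rintro ⟨hα, hF⟩
    refine ⟨.inr ⟨α, hα, .inl ⟨γ, rfl⟩⟩, ?_⟩
    rintro ⟨i, hi, ⟨γ', hγ, h⟩ | ⟨n, hn, h⟩⟩
    · rw [long_inj, Sigma.mk.injEq] at h
      obtain ⟨rfl, h⟩ := h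
      obtain rfl := eq_of_heq h
      exact hF hi hγ
    · exact long_ne_short _ _ _ _ h.symm

theorem short_mem_basicSet {α : S} {n : ℕ} :
    (short α n : StationarySpace l S μ) ∈ basicSet W σ F G ↔
      ((α : Below l) : UpTo l) ∈ W ∧ (α ∈ σ → n ∉ G α) := by
  simp only [basicSet, fiber, Set.mem_sdiff, mem_union, mem_image, mem_iUnion, mem_range]
  constructor
  · rintro ⟨⟨β', hβ, h⟩ | ⟨α', hα, ⟨γ', h⟩ | ⟨n, h⟩⟩, h'⟩
    · exact absurd h (base_ne_short _ _ _)
    · exact absurd h (long_ne_short _ _ _ _)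
    · rw [short_inj] at h
      obtain ⟨rfl, rfl⟩ := h
      exact ⟨hα, fun hσ hG => h' ⟨α', hσ, .inr ⟨n, hG, rfl⟩⟩⟩
  · rintro ⟨hα, hG⟩
    refine ⟨.inr ⟨α, hα, .inr ⟨n, rfl⟩⟩, ?_⟩
    rintro ⟨i, hi, ⟨γ', hγ, h⟩ | ⟨n', hn, h⟩⟩
    · exact long_ne_short _ _ _ _ h
    · rw [short_inj] at h
      obtain ⟨rfl, rfl⟩ := h
      exact hG hi hn

end BasicSet

theorem preimage_proj_eq (W : Set (UpTo l)) :
    (proj ⁻¹' W : Set (StationarySpace l S μ)) = basicSet W ∅ (fun _ => ∅) (fun _ => ∅) := by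
  ext x
  cases x using cases_on with
  | hbase β => simp [base_mem_basicSet]
  | hlong α γ => simp [long_mem_basicSet]
  | hshort α n => simp [short_mem_basicSet]

theorem continuous_proj : Continuous (proj : StationarySpace l S μ → UpTo l) := by
  refine ⟨fun W hW => ?_⟩
  rw [preimage_proj_eq]
  exact (IsBasic.base W hW ∅ (by simp) _ (by simp) _ (by simp)).isOpen

theorem continuous_base : Continuous (base : UpTo l → StationarySpace l S μ) := by
  refine continuous_generateFrom_iff.2 fun B hB => ?_
  rcases hB with ⟨α, U, hU⟩ | ⟨α, V⟩ | ⟨W, hW, σ, hσ, F, hF, G, hG⟩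
  · convert isOpen_empty
    ext β
    simpa using fun γ _ h => base_ne_long β α γ h.symm
  · convert isOpen_empty
    ext β
    simpa using fun γ _ h => base_ne_short β α γ h.symm
  · convert hW
    ext β
    exact base_mem_basicSet

/-- The copy of `μ_α + 1` with last point `α`. -/
def longMap (α : S) : UpTo (μ α) → StationarySpace l S μ :=
  tower (base ((α : Below l) : UpTo l)) (long α)

@[simp] theorem longMap_coe (α : S) (γ : Below (μ α)) : longMap α (γ : UpTo (μ α)) = long α γ := rfl

@[simp] theorem longMap_top (α : S) :
    longMap α (⊤ : UpTo (μ α)) = base ((α : Below l) : UpTo l) := rfl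

theorem isOpen_image_coe {κ : Cardinal.{u}} {U : Set (Below κ)} (hU : IsOpen U) :
    IsOpen ((fun i : Below κ => (i : UpTo κ)) '' U) := by
  refine isOpen_of_forall_isSuccLimit ?_
  rintro _ ⟨i, hi, rfl⟩ hlim
  obtain ⟨j, hj⟩ := not_isMin_iff.1 hlim.1
  lift j to Below κ using hj.ne_top
  obtain ⟨k, hk, hkU⟩ := exists_Ioc_subset_of_mem_nhds (hU.mem_nhds hi) ⟨j, WithTop.coe_lt_coe.1 hj⟩
  refine ⟨k, WithTop.coe_lt_coe.2 hk, fun m hm => ?_⟩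
  lift m to Below κ using (hm.2.trans_lt (WithTop.coe_lt_top i)).ne
  exact ⟨m, hkU ⟨WithTop.coe_lt_coe.1 hm.1, WithTop.coe_le_coe.1 hm.2⟩, rfl⟩

theorem continuous_longMap (α : S) : Continuous (longMap (μ := μ) α) := by
  refine continuous_generateFrom_iff.2 fun B hB => ?_
  rcases hB with ⟨α', U, hU⟩ | ⟨α', V⟩ | ⟨W, hW, σ, hσ, F, hF, G, hG⟩
  · by_cases hα : α' = α
    · subst hα
      convert isOpen_image_coe hU
      ext i
      induction i using WithTop.recTopCoe with
      | top => simpa using fun γ _ h => base_ne_long _ _ γ h.symm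
      | coe i => simp [long_inj]
    · convert isOpen_empty
      ext i
      induction i using WithTop.recTopCoe with
      | top => simpa using fun γ _ h => base_ne_long _ _ γ h.symm
      | coe i => simp [long_inj, hα]
  · convert isOpen_empty
    ext i
    induction i using WithTop.recTopCoe with
    | top => simpa using fun γ _ h => base_ne_short _ _ γ h.symm
    | coe i => simpa using fun γ _ h => long_ne_short _ _ _ γ h.symm
  · by_cases hα : ((α : Below l) : UpTo l) ∈ W
    · by_cases hασ : α ∈ σ
      · convert (hF α hασ).1.isOpen_compl
        ext i
        induction i using WithTop.recTopCoe with
        | top => simp [base_mem_basicSet, hα, (hF α hασ).2]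
        | coe i => simp [long_mem_basicSet, hα, hασ]
      · convert isOpen_univ
        ext i
        induction i using WithTop.recTopCoe with
        | top => simp [base_mem_basicSet, hα]
        | coe i => simp [long_mem_basicSet, hα, hασ]
    · convert isOpen_empty
      ext i
      induction i using WithTop.recTopCoe with
      | top => simp [base_mem_basicSet, hα]
      | coe i => simp [long_mem_basicSet, hα]

theorem tendsto_short (α : S) :
    Tendsto (short (μ := μ) α) atTop (𝓝 (base ((α : Below l) : UpTo l))) := by
  refine TopologicalSpace.tendsto_nhds_generateFrom_iff.2 fun B hB hα => ?_
  rcases hB with ⟨α', U, hU⟩ | ⟨α', V⟩ | ⟨W, hW, σ, hσ, F, hF, G, hG⟩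
  · obtain ⟨γ, -, h⟩ := hα
    exact absurd h.symm (base_ne_long _ _ _)
  · obtain ⟨γ, -, h⟩ := hα
    exact absurd h.symm (base_ne_short _ _ _)
  · have hα := base_mem_basicSet.1 hα
    rw [← Nat.cofinite_eq_atTop]
    by_cases hασ : α ∈ σ
    · refine (hG α hασ).subset fun n hn => ?_
      by_contra hc
      exact hn (short_mem_basicSet.2 ⟨hα, fun _ => hc⟩)
    · exact univ_mem' fun n => short_mem_basicSet.2 ⟨hα, fun h => absurd h hασ⟩

/-- What a basic set removes is compact: finitely many finite sets and images of closed subsets of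
`μ_i + 1`. The property survives intersections and unions. -/
theorem exists_isCompact_of_isOpen {O : Set (StationarySpace l S μ)} (hO : IsOpen O) {β : UpTo l}
    (hβ : base β ∈ O) : ∃ W C, IsOpen W ∧ β ∈ W ∧ IsCompact C ∧ proj ⁻¹' W ⊆ O ∪ C := by
  induction hO with
  | basic B hB =>
    rcases hB with ⟨α', U, hU⟩ | ⟨α', V⟩ | ⟨W, hW, σ, hσ, F, hF, G, hG⟩
    · obtain ⟨γ, -, h⟩ := hβ
      exact absurd h.symm (base_ne_long _ _ _)
    · obtain ⟨γ, -, h⟩ := hβ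
      exact absurd h.symm (base_ne_short _ _ _)
    · refine ⟨W, ⋃ i ∈ σ, (longMap i '' F i ∪ short i '' G i), hW, base_mem_basicSet.1 hβ, ?_, ?_⟩
      · refine σ.isCompact_biUnion fun i hi => ?_
        exact ((hF i hi).1.isCompact.image (continuous_longMap i)).union
          ((hG i hi).image _).isCompact
      · intro x hx
        cases x using cases_on with
        | hbase β => exact .inl (base_mem_basicSet.2 hx)
        | hlong α γ =>
          by_cases h : α ∈ σ ∧ (γ : UpTo (μ α)) ∈ F α
          · exact .inr (mem_biUnion h.1 (.inl ⟨γ, h.2, rfl⟩))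
          · exact .inl (long_mem_basicSet.2 ⟨hx, fun h1 h2 => h ⟨h1, h2⟩⟩)
        | hshort α n =>
          by_cases h : α ∈ σ ∧ n ∈ G α
          · exact .inr (mem_biUnion h.1 (.inr ⟨n, h.2, rfl⟩))
          · exact .inl (short_mem_basicSet.2 ⟨hx, fun h1 h2 => h ⟨h1, h2⟩⟩)
  | univ => exact ⟨univ, ∅, isOpen_univ, trivial, isCompact_empty, fun _ _ => .inl trivial⟩
  | inter s t _ _ ihs iht =>
    obtain ⟨W, C, hW, hβW, hC, h⟩ := ihs hβ.1
    obtain ⟨W', C', hW', hβW', hC', h'⟩ := iht hβ.2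
    refine ⟨W ∩ W', C ∪ C', hW.inter hW', ⟨hβW, hβW'⟩, hC.union hC', fun x hx => ?_⟩
    rcases h hx.1 with h1 | h1
    · rcases h' hx.2 with h2 | h2
      · exact .inl ⟨h1, h2⟩
      · exact .inr (.inr h2)
    · exact .inr (.inl h1)
  | sUnion 𝒮 _ ih =>
    obtain ⟨s, hs, hβs⟩ := hβ
    obtain ⟨W, C, hW, hβW, hC, h⟩ := ih s hs hβs
    exact ⟨W, C, hW, hβW, hC, h.trans (union_subset_union_left _ (subset_sUnion_of_mem hs))⟩

/-- Well-founded induction along `l + 1`: a member of the cover containing `base β` takes in all but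
a compact part of the fibres over a neighbourhood of `β`, and the rest lies over some `Iic γ` with
`γ < β`. -/
instance : CompactSpace (StationarySpace l S μ) := by
  classical
  refine ⟨isCompact_of_finite_subcover fun {ι} U hU hcov => ?_⟩
  let P : Set (StationarySpace l S μ) → Prop := fun A => ∃ t : Finset ι, A ⊆ ⋃ i ∈ t, U i
  have hPu : ∀ A B, P A → P B → P (A ∪ B) := by
    rintro A B ⟨s, hs⟩ ⟨t, ht⟩
    refine ⟨s ∪ t, union_subset (hs.trans ?_) (ht.trans ?_)⟩
    · exact biUnion_subset_biUnion_left fun i hi => Finset.mem_union_left _ hi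
    · exact biUnion_subset_biUnion_left fun i hi => Finset.mem_union_right _ hi
  have hPm : ∀ A B, A ⊆ B → P B → P A := fun A B hAB ⟨t, ht⟩ => ⟨t, hAB.trans ht⟩
  have hPc : ∀ C, IsCompact C → P C := fun C hC =>
    hC.elim_finite_subcover U hU ((subset_univ C).trans hcov)
  have key : ∀ β : UpTo l, P (proj ⁻¹' Iic β) := by
    intro β
    induction β using WellFoundedLT.induction with
    | ind β ih =>
      obtain ⟨i, hi⟩ := mem_iUnion.1 (hcov (mem_univ (base β)))
      obtain ⟨W, C, hW, hβW, hC, h⟩ := exists_isCompact_of_isOpen (hU i) hi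
      have hPW : P (proj ⁻¹' W) :=
        hPm _ _ h (hPu _ _ ⟨{i}, by simp⟩ (hPc C hC))
      by_cases hβ : ∃ γ, γ < β
      · obtain ⟨γ, hγ, hγW⟩ := exists_Ioc_subset_of_mem_nhds (hW.mem_nhds hβW) hβ
        refine hPm _ _ (fun x hx => ?_) (hPu _ _ hPW (ih γ hγ))
        rcases le_or_gt (proj x) γ with h1 | h1
        · exact .inr h1
        · exact .inl (hγW ⟨h1, hx⟩)
      · push Not at hβ
        refine hPm _ _ (fun x hx => ?_) hPW
        rw [mem_preimage, le_antisymm hx (hβ _)]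
        exact hβW
  exact hPm _ (proj ⁻¹' Iic ⊤) (fun x _ => le_top (a := proj x)) (key ⊤)

end StationarySpace

open StationarySpace in
/-- A sequence of length `κ` at whose members, for a stationary set of indices, both an uncountable
spike and a sequence are attached. -/
theorem exists_isObstruction_of_isStationary {X : Type u} [TopologicalSpace X] [T2Space X]
    {κ : Cardinal.{u}} (hκ : κ.IsRegular) (hω : ℵ₀ < κ) {p : X} {M : Below κ → Set X}
    {y : Below κ → X} (hM : ∀ i j, i ≠ j → Disjoint (M i) (M j)) (hy : ∀ i, y i ∈ M i)
    (hp : ∀ i, p ∉ M i) (htop : ∀ V, IsOpen V → p ∈ V → ∃ i, ∀ j, i < j → M j ⊆ V)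
    (hlim : ∀ i, IsSuccLimit i → ∀ V, IsOpen V → y i ∈ V → ∃ j < i, ∀ k, j < k → k < i → M k ⊆ V)
    {S : Set (Below κ)} (hS : IsStationary S) {μ : S → Cardinal.{u}}
    (hμ : ∀ α, (μ α).IsRegular ∧ ℵ₀ < μ α) {φ : ∀ α, UpTo (μ α) → X} {s : S → ℕ → X}
    (hφ : ∀ α, Continuous (φ α)) (hφi : ∀ α, Function.Injective (φ α)) (hφt : ∀ α, φ α ⊤ = y α)
    (hφM : ∀ α (γ : Below (μ α)), φ α γ ∈ M α) (hsi : ∀ α, Function.Injective (s α))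
    (hsM : ∀ (α : S) n, s α n ∈ M α) (hslim : ∀ α, Tendsto (s α) atTop (𝓝 (y α)))
    (hsφ : ∀ α n γ, s α n ≠ φ α γ) : ∃ A : Set X, IsObstruction A := by
  classical
  let Φ : StationarySpace κ S μ → X :=
    Sum.elim (tower p y) fun x => Sum.elim (fun γ : Below (μ x.1) => φ x.1 γ) (s x.1) x.2
  have hΦb : ∀ β : Below κ, Φ (base β) = y β := fun _ => rfl
  have hΦt : Φ (base ⊤) = p := rfl
  have hΦl : ∀ α γ, Φ (long α γ) = φ α γ := fun _ _ => rfl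
  have hΦs : ∀ α n, Φ (short α n) = s α n := fun _ _ => rfl
  have hΦM : ∀ x (β : Below κ), proj x = β → Φ x ∈ M β := by
    intro x β hx
    cases x using cases_on with
    | hbase β' =>
      obtain rfl : β' = β := hx
      exact hy β
    | hlong α γ =>
      obtain rfl : α.1 = β := WithTop.coe_injective hx
      exact hφM α γ
    | hshort α n =>
      obtain rfl : α.1 = β := WithTop.coe_injective hx
      exact hsM α n
  have hΦp : ∀ x : StationarySpace κ S μ, proj x = ⊤ → x = base ⊤ := by
    intro x hx
    cases x using cases_on with
    | hbase β' => rw [show β' = ⊤ from hx]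
    | hlong α γ => exact absurd hx WithTop.coe_ne_top
    | hshort α n => exact absurd hx WithTop.coe_ne_top
  have hinj : Function.Injective Φ := by
    -- Disjointness of the sets `M i`, none of which contains `p`, makes the image determine the
    -- index.
    have hproj : ∀ x x', Φ x = Φ x' → proj x = proj x' := by
      intro x x' h
      rcases eq_or_ne (proj x) ⊤ with hx | hx
      · rcases eq_or_ne (proj x') ⊤ with hx' | hx'
        · rw [hx, hx']
        · obtain ⟨β', hβ'⟩ := WithTop.ne_top_iff_exists.1 hx'
          rw [hΦp x hx, hΦt] at h
          exact absurd (h ▸ hΦM x' β' hβ'.symm) (hp β')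
      · obtain ⟨β, hβ⟩ := WithTop.ne_top_iff_exists.1 hx
        rcases eq_or_ne (proj x') ⊤ with hx' | hx'
        · rw [hΦp x' hx', hΦt] at h
          exact absurd (h ▸ hΦM x β hβ.symm) (hp β)
        · obtain ⟨β', hβ'⟩ := WithTop.ne_top_iff_exists.1 hx'
          rw [← hβ, ← hβ', WithTop.coe_inj]
          by_contra hne
          exact disjoint_left.1 (hM _ _ hne) (hΦM x β hβ.symm) (h ▸ hΦM x' β' hβ'.symm)
    have hsy : ∀ α n, s α n ≠ y α := fun α n => hφt α ▸ hsφ α n ⊤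
    have hφy : ∀ α (γ : Below (μ α)), φ α γ ≠ y α := fun α γ h =>
      WithTop.coe_ne_top (hφi α (h.trans (hφt α).symm))
    intro x x' h
    have hpr := hproj x x' h
    cases x using cases_on with
    | hbase β =>
      cases x' using cases_on with
      | hbase β' => rw [show β = β' from hpr]
      | hlong α γ =>
        obtain rfl : β = ((α : Below κ) : UpTo κ) := hpr
        exact absurd h.symm (hφy α γ)
      | hshort α n =>
        obtain rfl : β = ((α : Below κ) : UpTo κ) := hpr
        exact absurd h.symm (hsy α n)
    | hlong α γ =>
      cases x' using cases_on with
      | hbase β =>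
        obtain rfl : ((α : Below κ) : UpTo κ) = β := hpr
        exact absurd h (hφy α γ)
      | hlong α' γ' =>
        obtain rfl : α = α' := Subtype.ext (WithTop.coe_injective hpr)
        rw [WithTop.coe_injective (hφi α h)]
      | hshort α' n =>
        obtain rfl : α = α' := Subtype.ext (WithTop.coe_injective hpr)
        exact absurd h.symm (hsφ α n γ)
    | hshort α n =>
      cases x' using cases_on with
      | hbase β =>
        obtain rfl : ((α : Below κ) : UpTo κ) = β := hpr
        exact absurd h (hsy α n)
      | hlong α' γ' =>
        obtain rfl : α = α' := Subtype.ext (WithTop.coe_injective hpr)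
        exact absurd h (hsφ α n γ')
      | hshort α' n' =>
        obtain rfl : α = α' := Subtype.ext (WithTop.coe_injective hpr)
        rw [hsi α h]
  have hcont : Continuous Φ := by
    refine ⟨fun V hV => isOpen_iff_forall_mem_open.2 fun x hx => ?_⟩
    cases x using cases_on with
    | hlong α γ =>
      refine ⟨long α '' {γ | φ α γ ∈ V}, ?_, (IsBasic.long α _ ?_).isOpen, ⟨γ, hx, rfl⟩⟩
      · rintro _ ⟨γ', h, rfl⟩
        exact h
      · exact hV.preimage ((hφ α).comp WithTop.continuous_coe)
    | hshort α n =>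
      refine ⟨short α '' {n}, ?_, (IsBasic.short α _).isOpen, ⟨n, rfl, rfl⟩⟩
      rintro _ ⟨n', rfl, rfl⟩
      exact hx
    | hbase β =>
      induction β using WithTop.recTopCoe with
      | top =>
        obtain ⟨i, hi⟩ := htop V hV hx
        refine ⟨proj ⁻¹' Ioi (i : UpTo κ), fun x hx' => ?_, isOpen_Ioi.preimage continuous_proj,
          WithTop.coe_lt_top i⟩
        rcases eq_or_ne (proj x) ⊤ with hxt | hxt
        · rw [hΦp x hxt]
          exact hx
        · obtain ⟨j, hj⟩ := WithTop.ne_top_iff_exists.1 hxt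
          rw [mem_preimage, ← hj] at hx'
          exact hi j (WithTop.coe_lt_coe.1 hx') (hΦM x j hj.symm)
      | coe i =>
        have hW : ∃ W : Set (UpTo κ), IsOpen W ∧ (i : UpTo κ) ∈ W ∧
            ∀ x : StationarySpace κ S μ, proj x ∈ W → proj x = i ∨ Φ x ∈ V := by
          by_cases hl : IsSuccLimit i
          · obtain ⟨j, hj, hjV⟩ := hlim i hl V hV hx
            refine ⟨Ioi (j : UpTo κ) ∩ Iic (i : UpTo κ),
              isOpen_Ioi.inter (isOpen_Iic_of_wellFoundedLT _),
              ⟨WithTop.coe_lt_coe.2 hj, self_mem_Iic⟩, fun x hx' => ?_⟩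
            rcases (mem_Iic.1 hx'.2).lt_or_eq with hlt | heq
            · obtain ⟨k, hk⟩ := WithTop.ne_top_iff_exists.1 hlt.ne_top
              have hjk := hx'.1
              rw [← hk] at hlt hjk
              exact .inr (hjV k (WithTop.coe_lt_coe.1 hjk) (WithTop.coe_lt_coe.1 hlt)
                (hΦM x k hk.symm))
            · exact .inl heq
          · refine ⟨{(i : UpTo κ)}, isOpen_of_forall_isSuccLimit ?_, rfl, fun x hx' => .inl hx'⟩
            rintro _ rfl hl'
            refine absurd ?_ hl
            rw [isSuccLimit_iff_forall_exists] at hl' ⊢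
            obtain ⟨⟨j, hj⟩, h2⟩ := hl'
            lift j to Below κ using hj.ne_top
            refine ⟨⟨j, WithTop.coe_lt_coe.1 hj⟩, fun j hj => ?_⟩
            obtain ⟨k, hk, hki⟩ := h2 j (WithTop.coe_lt_coe.2 hj)
            lift k to Below κ using hki.ne_top
            exact ⟨k, WithTop.coe_lt_coe.1 hk, WithTop.coe_lt_coe.1 hki⟩
        obtain ⟨W, hW, hiW, hWV⟩ := hW
        -- Fibres over the other indices in `W` map into `V`. Only the fibre over `i` itself, if
        -- there is one, has to be trimmed.
        let σ : Finset S := if h : i ∈ S then {⟨i, h⟩} else ∅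
        have hσ : ∀ α : S, α ∈ σ ↔ α.1 = i := by
          intro α
          by_cases h : i ∈ S
          · simp [σ, h, Subtype.ext_iff]
          · simp only [σ, dif_neg h, Finset.notMem_empty, false_iff]
            rintro rfl
            exact h α.2
        refine ⟨basicSet W σ (fun α => {γ | φ α γ ∉ V}) (fun α => {n | s α n ∉ V}), ?_,
          (IsBasic.base W hW σ (fun α hα => ?_) _ (fun α hα => ⟨?_, ?_⟩) _
            (fun α hα => ?_)).isOpen, base_mem_basicSet.2 hiW⟩
        · intro x hx'
          cases x using cases_on with
          | hbase β =>
            rcases hWV (base β) (base_mem_basicSet.1 hx') with h | h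
            · obtain rfl : β = i := h
              exact hx
            · exact h
          | hlong α γ =>
            rw [long_mem_basicSet] at hx'
            rcases hWV (long α γ) hx'.1 with h | h
            · exact not_not.1 (hx'.2 ((hσ α).2 (WithTop.coe_injective h)))
            · exact h
          | hshort α n =>
            rw [short_mem_basicSet] at hx'
            rcases hWV (short α n) hx'.1 with h | h
            · exact not_not.1 (hx'.2 ((hσ α).2 (WithTop.coe_injective h)))
            · exact h
        · rw [(hσ α).1 hα]
          exact hiW
        · exact (hV.preimage (hφ α)).isClosed_compl
        · have : φ α ⊤ ∈ V := by rw [hφt, (hσ α).1 hα]; exact hx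
          simpa using this
        · have : V ∈ 𝓝 (y α) := hV.mem_nhds (by rw [(hσ α).1 hα]; exact hx)
          have := (hslim α).eventually this
          rw [← Nat.cofinite_eq_atTop] at this
          exact this
  exact ⟨range Φ, .inr (.inl ⟨κ, S, μ, hκ, hω, hμ, hS, nonempty_homeomorph_range hcont hinj⟩)⟩

/-! ### Orders with a prescribed extreme point -/

section Extreme

variable {X : Type u} [TopologicalSpace X]

/-- If `z` is not a limit from above, the part above `z` is closed and can be moved below everything
else. -/
theorem OrdOn.ordMax_of_notMem_closure {r : X → X → Prop} {M : Set X} (hr : OrdOn r M)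
    {z : X} (hz : z ∈ M) (h : z ∉ closure {y ∈ M | r z y ∧ y ≠ z}) : OrdMax M z := by
  have hc : IsClosed {y ∈ M | r z y ∧ y ≠ z} := by
    refine isClosed_of_closure_subset fun x hx => ?_
    have hsub : {y ∈ M | r z y ∧ y ≠ z} ⊆ {y ∈ M | r z y} := fun y hy => ⟨hy.1, hy.2.1⟩
    have hx' : x ∈ {y ∈ M | r z y} := closure_minimal hsub (hr.upper z hz) hx
    exact ⟨hx'.1, hx'.2, fun he => h (he ▸ hx)⟩
  have hM : {y ∈ M | r z y ∧ y ≠ z} ∪ {y ∈ M | r y z} = M := by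
    ext y
    constructor
    · rintro (hy | hy)
      exacts [hy.1, hy.1]
    · intro hy
      by_cases h' : r y z
      · exact .inr ⟨hy, h'⟩
      · refine .inl ⟨hy, (hr.total y hy z hz).resolve_left h', ?_⟩
        rintro rfl
        exact h' (hr.refl hy)
  rw [← hM]
  refine OrdMax.union_left ⟨r, hr.mono (fun y hy => hy.1) hc⟩
    ⟨r, hr.mono (fun y hy => hy.1) (hr.lower z hz), ⟨hz, hr.refl hz⟩, fun x hx => hx.2⟩ hc
    (hr.lower z hz) (disjoint_left.2 fun y hy hy' => ?_)
  exact hy.2.2 (hr.antisymm y hy.1 z hz hy'.2 hy.2.1)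

theorem OrdOn.isClosed_insert_lower {r : X → X → Prop} {M : Set X} (hr : OrdOn r M) {z : X}
    (hz : z ∈ M) : IsClosed (insert z {y ∈ M | r y z ∧ y ≠ z}) := by
  convert hr.lower z hz using 1
  ext y
  constructor
  · rintro (rfl | hy)
    · exact ⟨hz, hr.refl hz⟩
    · exact ⟨hy.1, hy.2.1⟩
  · intro hy
    by_cases h : y = z
    · exact .inl h
    · exact .inr ⟨hy.1, hy.2, h⟩

variable [T2Space X] [CompactSpace X]

/-- The dichotomy for images of half-open intervals, applied to the inclusion of the ordered compact
set `M` and to the interval from its least element to `z`. -/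
theorem OrdOn.isArm_or_isSigmaCompact {r : X → X → Prop} {M : Set X} (hM : IsClosed M)
    (hr : OrdOn r M) {z : X} (hz : z ∈ M) :
    IsSigmaCompact {y ∈ M | r y z ∧ y ≠ z} ∨ ∃ E, IsArm z E ∧ E ⊆ {y ∈ M | r y z ∧ y ≠ z} := by
  obtain ⟨lo, ho, hle⟩ := hr.exists_linearOrder hM.isCompact
  have := isCompact_iff_compactSpace.1 hM.isCompact
  have : Nonempty M := ⟨⟨z, hz⟩⟩
  obtain ⟨c, -, hc⟩ := (isCompact_univ (X := M)).exists_isLeast univ_nonempty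
  have heq : {y ∈ M | r y z ∧ y ≠ z} = Subtype.val '' Ico c ⟨z, hz⟩ := by
    ext y
    constructor
    · rintro ⟨hy, hyz, hne⟩
      refine ⟨⟨y, hy⟩, ⟨hc (mem_univ _), lt_of_le_of_ne ((hle _ _).2 hyz) fun h => hne ?_⟩, rfl⟩
      exact congrArg Subtype.val h
    · rintro ⟨y, hy, rfl⟩
      exact ⟨y.2, (hle _ _).1 hy.2.le, fun h => hy.2.ne (Subtype.ext h)⟩
  rw [heq]
  rcases (hc (mem_univ ⟨z, hz⟩)).lt_or_eq with hlt | rfl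
  · rcases isArm_or_isSigmaCompact_image_Ico (p := z) continuous_subtype_val hlt rfl
      (fun x hx h => hx.2.ne (Subtype.ext h)) with h | ⟨E, hE, hE', -⟩
    exacts [.inl h, .inr ⟨E, hE, hE'⟩]
  · left
    rw [Ico_self, image_empty]
    exact isSigmaCompact_empty

/-- Either `M` can be ordered with least element `z`, or an uncountable arm and a sequence, or two
uncountable arms of `M` meet in `z`. -/
theorem Orderable.ordMin_or_exists_arm [TotallyDisconnectedSpace X] {M : Set X} (hM : IsClosed M)
    (h : Orderable M) {z : X} (hz : z ∈ M) :
    OrdMin M z ∨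
    (∃ E, ∃ s : ℕ → X, IsArm z E ∧ E ⊆ M ∧ Function.Injective s ∧
      (∀ n, s n ∈ M ∧ s n ≠ z ∧ s n ∉ E) ∧ Tendsto s atTop (𝓝 z)) ∨
    ∃ E E', IsArm z E ∧ IsArm z E' ∧ E ⊆ M ∧ E' ⊆ M ∧ Disjoint E E' := by
  obtain ⟨r, hr⟩ := h
  by_cases hR : z ∈ closure {y ∈ M | r z y ∧ y ≠ z}
  swap
  · exact .inl (hr.ordMax_of_notMem_closure hz hR).ordMin
  by_cases hL : z ∈ closure {y ∈ M | r y z ∧ y ≠ z}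
  swap
  · exact .inl (hr.flip.ordMax_of_notMem_closure hz hL).ordMin
  have hdisj : ∀ y ∈ M, r y z ∧ y ≠ z → ¬ (r z y ∧ y ≠ z) := fun y hy h1 h2 =>
    h1.2 (hr.antisymm y hy z hz h1.1 h2.1)
  have hcL := hr.isClosed_insert_lower hz
  have hcR := hr.flip.isClosed_insert_lower hz
  rcases hr.isArm_or_isSigmaCompact hM hz with hl | ⟨E, hE, hEM⟩
  · rcases hr.flip.isArm_or_isSigmaCompact hM hz with hr' | ⟨E', hE', hEM'⟩
    · left
      -- If both sides are σ-compact, the given order is abandoned and `M` is reordered along a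
      -- clopen exhaustion.
      refine (ordMax_of_isSigmaCompact hM hz ?_ fun K hK hKc _ => ⟨r, hr.mono hK hKc⟩).ordMin
      have : M \ {z} = ⋃ b : Bool, cond b {y ∈ M | r y z ∧ y ≠ z} {y ∈ M | r z y ∧ y ≠ z} := by
        rw [← union_eq_iUnion]
        ext y
        constructor
        · rintro ⟨hy, hne⟩
          rcases hr.total y hy z hz with h | h
          exacts [.inl ⟨hy, h, hne⟩, .inr ⟨hy, h, hne⟩]
        · rintro (hy | hy)
          exacts [⟨hy.1, hy.2.2⟩, ⟨hy.1, hy.2.2⟩]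
      rw [this]
      exact isSigmaCompact_iUnion _ (by rintro (_ | _); exacts [hr', hl])
    · obtain ⟨s, hs, hsB, hlim⟩ := exists_seq_of_mem_closure hl (fun h => h.2.2 rfl) hcL hL
      exact .inr (.inl ⟨E', s, hE', fun x hx => (hEM' hx).1, hs, fun n =>
        ⟨(hsB n).1, (hsB n).2.2, fun h => hdisj _ (hsB n).1 (hsB n).2 (hEM' h).2⟩, hlim⟩)
  · rcases hr.flip.isArm_or_isSigmaCompact hM hz with hr' | ⟨E', hE', hEM'⟩
    · obtain ⟨s, hs, hsB, hlim⟩ := exists_seq_of_mem_closure hr' (fun h => h.2.2 rfl) hcR hR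
      exact .inr (.inl ⟨E, s, hE, fun x hx => (hEM hx).1, hs, fun n =>
        ⟨(hsB n).1, (hsB n).2.2, fun h => hdisj _ (hsB n).1 (hEM h).2 (hsB n).2⟩, hlim⟩)
    · exact .inr (.inr ⟨E, E', hE, hE', fun x hx => (hEM hx).1, fun x hx => (hEM' hx).1,
        disjoint_left.2 fun x hx hx' => hdisj x (hEM hx).1 (hEM hx).2 (hEM' hx').2⟩)

theorem exists_isObstruction_of_three_arms {p : X} {E₁ E₂ E₃ : Set X} (h₁ : IsArm p E₁)
    (h₂ : IsArm p E₂) (h₃ : IsArm p E₃) (h₁₂ : Disjoint E₁ E₂) (h₁₃ : Disjoint E₁ E₃)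
    (h₂₃ : Disjoint E₂ E₃) : ∃ A : Set X, IsObstruction A := by
  obtain ⟨κ, hκ, hω, hs⟩ := h₁.exists_isSpike
  obtain ⟨l, hl, hlω, hs'⟩ := h₂.exists_isSpike
  obtain ⟨μ, hμ, hμω, hs''⟩ := h₃.exists_isSpike
  exact exists_isObstruction_of_spikes ⟨hκ, hl, hμ, hlω, hμω⟩ hs hs' hs'' h₁.notMem h₂.notMem
    h₃.notMem h₁₂ h₁₃ h₂₃

/-- A sequence in `B` that converges to `p` is the leg of length `ℵ₀`, which a legal triple permits
in its first place. -/
theorem exists_isObstruction_of_arms_and_isSigmaCompact [TotallyDisconnectedSpace X] {p : X}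
    {B E₁ E₂ : Set X} (h₁ : IsArm p E₁) (h₂ : IsArm p E₂) (hB : IsSigmaCompact B) (hp : p ∉ B)
    (hBp : IsClosed (insert p B)) (hcl : p ∈ closure B) (h₁₂ : Disjoint E₁ E₂)
    (hB₁ : Disjoint B E₁) (hB₂ : Disjoint B E₂) : ∃ A : Set X, IsObstruction A := by
  obtain ⟨s, hs, hsB, hlim⟩ := exists_seq_of_mem_closure hB hp hBp hcl
  obtain ⟨l, hl, hlω, hs'⟩ := h₁.exists_isSpike
  obtain ⟨μ, hμ, hμω, hs''⟩ := h₂.exists_isSpike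
  exact exists_isObstruction_of_spikes ⟨isRegular_aleph0, hl, hμ, hlω, hμω⟩
    (isSpike_aleph0 hs hsB hp hlim) hs' hs'' hp h₁.notMem h₂.notMem hB₁ hB₂ h₁₂

/-- Two arms at a limit point `y i` of a strand. -/
theorem IsStrand.exists_isObstruction_of_arms [TotallyDisconnectedSpace X] {p : X}
    {κ : Cardinal.{u}} {T : Below κ → Set X} {y : Below κ → X} (h : IsStrand p κ T y)
    (hκ : κ.IsRegular) {i : Below κ} (hi : IsSuccLimit i) {E₁ E₂ : Set X} (h₁ : IsArm (y i) E₁)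
    (h₂ : IsArm (y i) E₂) (h₁₂ : Disjoint E₁ E₂) (hy₁ : ∀ j < i, y j ∉ E₁)
    (hy₂ : ∀ j < i, y j ∉ E₂) : ∃ A : Set X, IsObstruction A := by
  obtain ⟨m, hm⟩ := exists_forall_le_below hκ
  obtain ⟨j₀, hj₀⟩ := not_isMin_iff.1 hi.1
  have hmi : (m : UpTo κ) < i := WithTop.coe_lt_coe.2 ((hm j₀).trans_lt hj₀)
  have hcont := h.continuous_tower hκ
  have hB : ∀ x ∈ tower p y '' Ico (m : UpTo κ) i, ∃ j < i, x = y j := by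
    rintro _ ⟨k, hk, rfl⟩
    lift k to Below κ using hk.2.ne_top
    exact ⟨k, WithTop.coe_lt_coe.1 hk.2, rfl⟩
  have hd : ∀ E : Set X, (∀ j < i, y j ∉ E) → Disjoint (tower p y '' Ico (m : UpTo κ) i) E := by
    intro E hE
    refine disjoint_left.2 fun x hx hxE => ?_
    obtain ⟨j, hj, rfl⟩ := hB x hx
    exact hE j hj hxE
  have hne : ∀ k ∈ Ico (m : UpTo κ) i, tower p y k ≠ y i := fun k hk he =>
    hk.2.ne (h.injective_tower (he.trans (tower_coe p y i).symm))
  -- The third leg is the strand's own sequence below `i`, countable or uncountable according to the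
  -- cofinality of `i`.
  rcases isArm_or_isSigmaCompact_image_Ico hcont hmi (tower_coe p y i) hne with hσ | ⟨E, hE, hEB, -⟩
  · refine exists_isObstruction_of_arms_and_isSigmaCompact h₁ h₂ hσ ?_ ?_ ?_ h₁₂ (hd _ hy₁)
      (hd _ hy₂)
    · rintro ⟨k, hk, he⟩
      exact hne k hk he
    · rw [← tower_coe p y i, ← image_insert_eq, Ico_insert_right hmi.le]
      exact (isClosed_Icc.isCompact.image hcont).isClosed
    · refine mem_closure_iff.2 fun V hV hyV => ?_
      obtain ⟨j, hj, hjV⟩ := h.exists_diff_subset hi hV hyV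
      exact ⟨y j, hjV ⟨h.mem j, h.notMem_of_lt j i hj⟩, j,
        ⟨WithTop.coe_le_coe.2 (hm j), WithTop.coe_lt_coe.2 hj⟩, rfl⟩
  · exact exists_isObstruction_of_three_arms hE h₁ h₂ ((hd _ hy₁).mono_left hEB)
      ((hd _ hy₂).mono_left hEB) h₁₂

/-- In the absence of obstructions, a set which is almost an arm can be ordered with largest
element `p`. -/
theorem IsArm.ordMax [TotallyDisconnectedSpace X] (hno : ∀ A : Set X, ¬ IsObstruction A) {p : X}
    {A E : Set X} (hE : IsArm p E) (hA : IsOpen A) (hAp : IsClosed (insert p A)) (hpA : p ∉ A)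
    (hord : ∀ K, IsClosed K → p ∉ K → Orderable K) (hEA : E ⊆ A) (hcov : CoverMod p A E) :
    OrdMax (insert p A) p := by
  obtain ⟨κ, T₀, y₀, hκ, hω, hs₀, rfl⟩ := hE
  obtain ⟨K, hK, hpK, hAK⟩ := hcov
  obtain ⟨m, hm⟩ := exists_forall_le_below hκ
  -- Starting beyond `i₁` keeps the strand away from the remainder `K`, so that `A \ T i` is closed
  -- up to `y i`.
  obtain ⟨i₁, hi₁⟩ := hs₀.exists_disjoint hκ hK hpK
  obtain ⟨e, he, hei⟩ := exists_isNormal_of_isClub hκ (isClub_Ioi hκ i₁)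
  have hs := hs₀.comp he
  obtain ⟨T, hT⟩ : ∃ T, T = T₀ ∘ e := ⟨_, rfl⟩
  obtain ⟨y, hy⟩ : ∃ y, y = y₀ ∘ e := ⟨_, rfl⟩
  rw [← hT, ← hy] at hs
  have hTA : ∀ i, T i ⊆ A := fun i => by
    rw [hT]; exact (subset_iUnion T₀ (e i)).trans hEA
  have hyA : ∀ i, y i ∈ A := fun i => hTA i (hs.mem i)
  let H : Below κ → Set X := fun i => A \ T i
  have hHc : ∀ i, IsClosed (insert (y i) (H i)) := by
    intro i
    convert (hK.inter hAp).union (hs₀.closed_diff m (e i) (hm _)) using 1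
    have hyi : y i = y₀ (e i) := by rw [hy]; rfl
    have hTi : T i = T₀ (e i) := by rw [hT]; rfl
    ext x
    constructor
    · rintro (rfl | ⟨hxA, hx⟩)
      · exact .inr (.inl hyi)
      · rcases hAK hxA with hxK | hxE
        · exact .inl ⟨hxK, .inr hxA⟩
        · obtain ⟨j, hj⟩ := mem_iUnion.1 hxE
          exact .inr (.inr ⟨hs₀.anti (hm j) hj, hTi ▸ hx⟩)
    · rintro (⟨hxK, hxA⟩ | hx | ⟨hxm, hx⟩)
      · refine .inr ⟨hxA.resolve_left fun h => hpK (h ▸ hxK), fun hxT => ?_⟩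
        exact disjoint_left.1 hi₁ hxK (hs₀.anti (le_of_lt (hei i)) (hTi ▸ hxT))
      · exact .inl (hx.trans hyi.symm)
      · exact .inr ⟨hEA (mem_iUnion_of_mem m hxm), hTi ▸ hx⟩
  have hHo : ∀ i, IsOpen (H i) := by
    intro i
    convert hA.sdiff (hs.closed i) using 1
    ext x
    constructor
    · rintro ⟨hxA, hx⟩
      exact ⟨hxA, fun h => h.elim (fun h => hpA (h ▸ hxA)) hx⟩
    · rintro ⟨hxA, hx⟩
      exact ⟨hxA, fun h => hx (.inr h)⟩
  have hHlt : ∀ i j, i < j → insert (y i) (H i) ⊆ H j := by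
    rintro i j hij x (rfl | ⟨hxA, hx⟩)
    · exact ⟨hyA i, hs.notMem_of_lt i j hij⟩
    · exact ⟨hxA, fun h => hx (hs.anti hij.le h)⟩
  have hmax := noMaxOrder_below hκ
  have hnext : ∀ i : Below κ, ∃ k, i < k ∧ ∀ j, i < j → k ≤ j := fun i =>
    ⟨WellFounded.min wellFounded_lt (Ioi i) (exists_gt i),
      WellFounded.min_mem wellFounded_lt (Ioi i) (exists_gt i),
      fun j hj => not_lt.1 (WellFounded.not_lt_min wellFounded_lt (Ioi i) hj)⟩
  choose nx hnx hnx' using hnext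
  -- Zero-dimensionality places a clopen set between the closed set `insert (y i) (H i)` and the
  -- open set `H` at the next index.
  choose U hU hHU hUH using fun i => exists_clopen_of_closed_subset_open (hHc i) (hHo (nx i))
    (hHlt i (nx i) (hnx i))
  have hHmono : ∀ i j, i ≤ j → H i ⊆ H j := fun i j hij x hx =>
    ⟨hx.1, fun h => hx.2 (hs.anti hij h)⟩
  have hUlt : ∀ i j, i < j → U i ⊆ H j := fun i j hij => (hUH i).trans (hHmono _ _ (hnx' i j hij))
  have hUmono : Monotone U := by
    intro i j hij
    rcases hij.lt_or_eq with hlt | rfl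
    · exact (hUlt i j hlt).trans ((subset_insert _ _).trans (hHU j))
    · exact le_rfl
  have hUA : ∀ i, U i ⊆ A := fun i => (hUH i).trans sdiff_subset
  have hpU : ∀ i, p ∉ U i := fun i h => hpA (hUA i h)
  have hVlim : ∀ i, IsSuccLimit i → ∀ x ∈ H i, ∃ j < i, x ∈ U j := by
    intro i hi x hx
    by_contra! hc
    refine hx.2 (hs.limit i hi x fun j hj => ?_)
    by_contra hxj
    exact hc j hj (hHU j (.inr ⟨hx.1, hxj⟩))
  -- At a limit `i` the earlier sets `U j` exhaust `H i`, which lacks at most `y i` for being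
  -- closed. Hence a good `M i` is one that can be ordered with `y i` least.
  let M : Below κ → Set X := fun i => U i \ ⋃ j < i, U j
  have hVo : ∀ i, IsOpen (⋃ j < i, U j) := fun i => isOpen_biUnion fun j _ => (hU j).2
  have hVH : ∀ i, (⋃ j < i, U j) ⊆ H i := fun i => iUnion₂_subset fun j hj => hUlt j i hj
  have hMc : ∀ i, IsClosed (M i) := fun i => (hU i).1.sdiff (hVo i)
  have hyM : ∀ i, y i ∈ M i := fun i =>
    ⟨hHU i (mem_insert _ _), fun h => (hVH i h).2 (hs.mem i)⟩
  have hMp : ∀ i, p ∉ M i := fun i h => hpU i h.1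
  by_cases hS : IsStationary {i | IsSuccLimit i ∧ ¬ OrdMin (M i) (y i)}
  · exfalso
    have hdata : ∀ α : {i | IsSuccLimit i ∧ ¬ OrdMin (M i) (y i)},
        ∃ E, ∃ s : ℕ → X, IsArm (y α) E ∧ E ⊆ M α ∧ Function.Injective s ∧
          (∀ n, s n ∈ M α ∧ s n ≠ y α ∧ s n ∉ E) ∧ Tendsto s atTop (𝓝 (y α)) := by
      rintro ⟨i, hi, hmin⟩
      rcases (hord (M i) (hMc i) (hMp i)).ordMin_or_exists_arm (hMc i) (hyM i) with h | h | h
      · exact absurd h hmin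
      · exact h
      -- Two arms inside `M i` avoid all earlier `y j`, so with the strand below `i` they make a
      -- triple obstruction. Only an arm with a sequence survives.
      · exfalso
        obtain ⟨E₁, E₂, h₁, h₂, hE₁, hE₂, h₁₂⟩ := h
        have hyj : ∀ j < i, y j ∉ M i := fun j hj h => h.2 (mem_biUnion hj (hyM j).1)
        obtain ⟨A', hA'⟩ := hs.exists_isObstruction_of_arms hκ hi h₁ h₂ h₁₂
          (fun j hj h => hyj j hj (hE₁ h)) (fun j hj h => hyj j hj (hE₂ h))
        exact hno A' hA'
    choose E s hE hEM hsi hsM hslim using hdata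
    choose μ hμ hμω φ hφ hφi hφt hφE using fun α => (hE α).exists_isSpike
    suffices h : ∃ A' : Set X, IsObstruction A' from h.elim hno
    refine exists_isObstruction_of_isStationary hκ hω (p := p) (M := M) (y := y)
      ?_ hyM hMp ?_ ?_ hS (μ := μ) (φ := φ) (s := s) (fun α => ⟨hμ α, hμω α⟩) hφ hφi hφt
      (fun α γ => hEM α (hφE α γ)) hsi (fun α n => (hsM α n).1) hslim ?_
    · have : ∀ i j, i < j → Disjoint (M i) (M j) := fun i j hij =>
        disjoint_left.2 fun x hx hx' => hx'.2 (mem_biUnion hij hx.1)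
      intro i j hij
      rcases lt_or_gt_of_ne hij with h | h
      exacts [this i j h, (this j i h).symm]
    · intro V hV hpV
      obtain ⟨i, hi⟩ := hs.exists_subset hκ hV hpV
      refine ⟨i, fun j hij x hx => hi ?_⟩
      by_contra hxT
      exact hx.2 (mem_biUnion hij (hHU i (.inr ⟨hUA j hx.1, hxT⟩)))
    · intro i hi V hV hyV
      obtain ⟨j, hj, hjV⟩ := hs.exists_diff_subset hi hV hyV
      refine ⟨j, hj, fun k hjk hki x hx => hjV ⟨?_, (hUlt k i hki hx.1).2⟩⟩
      by_contra hxT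
      exact hx.2 (mem_biUnion hjk (hHU j (.inr ⟨hUA k hx.1, hxT⟩)))
    · intro α n γ
      induction γ using WithTop.recTopCoe with
      | top => rw [hφt]; exact (hsM α n).2.1
      | coe γ => exact fun h => (hsM α n).2.2 (h ▸ hφE α γ)
  · obtain ⟨C, hC, hdisj⟩ := not_isStationary_iff.1 hS
    -- Bad limits avoid the club `C`, so the set is cut along `C` only; a longer piece between
    -- consecutive members is still orderable because its closure omits `p`.
    refine ordMax_of_chain (I := C) (U := fun i => U i) hAp (mem_insert _ _) (fun i => hU i)
      (fun i j hij => hUmono hij) (fun i => hpU i) (fun x hx hxp => ?_) (fun i => ?_)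
    · obtain ⟨i, hi⟩ := hs.exhaust x
      obtain ⟨c, hc, hic⟩ := hC.isCofinal i
      exact ⟨⟨c, hc⟩, hUmono hic (hHU i (.inr ⟨hx.resolve_left hxp, hi⟩))⟩
    · have hV : (⋃ j : C, ⋃ _ : j < i, U j) = ⋃ j ∈ C ∩ Iio i.1, U j := by
        ext x
        simp only [mem_iUnion, exists_prop, Subtype.exists, mem_inter_iff, mem_Iio]
        constructor
        · rintro ⟨j, hj, hji, hx⟩
          exact ⟨j, ⟨hj, hji⟩, hx⟩
        · rintro ⟨j, ⟨hj, hji⟩, hx⟩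
          exact ⟨j, hj, hji, hx⟩
      rw [hV]
      have hWo : IsOpen (⋃ j ∈ C ∩ Iio i.1, U j) := isOpen_biUnion fun j _ => (hU j).2
      have hpc : Orderable (insert p A ∩ (U i \ ⋃ j ∈ C ∩ Iio i.1, U j)) :=
        hord _ (hAp.inter ((hU i).1.sdiff hWo)) fun h => hpU i h.2.1
      rcases (C ∩ Iio i.1).eq_empty_or_nonempty with hemp | hne
      · left
        refine ⟨?_, hpc⟩
        rw [hemp]
        simp
      -- If `k < i`, then `k` is the predecessor of `i` in `C` and the earlier stages form the
      -- clopen set `U k`. If `k = i`, then `i` is a limit, the piece is `M i`, and it is good since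
      -- `i ∈ C`.
      obtain ⟨k, hk⟩ := exists_isLUB_of_wellFoundedLT (s := C ∩ Iio i.1) ⟨i, fun j hj => hj.2.le⟩
      have hkC : k ∈ C := hC.isLUB_mem inter_subset_left hne hk
      rcases (hk.2 (fun j hj => hj.2.le) : k ≤ i).lt_or_eq with hki | hki
      · left
        refine ⟨?_, hpc⟩
        have : (⋃ j ∈ C ∩ Iio i.1, U j) = U k :=
          subset_antisymm (iUnion₂_subset fun j hj => hUmono (hk.1 hj))
            fun x hx => mem_biUnion (show k ∈ C ∩ Iio i.1 from ⟨hkC, hki⟩) hx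
        rw [this]
        exact hAp.inter (hU k).1
      · right
        rw [hki] at hk
        have hcof : ∀ j < i.1, ∃ c ∈ C ∩ Iio i.1, j < c := fun j hj => (lt_isLUB_iff hk).1 hj
        have hlim : IsSuccLimit i.1 := by
          refine isSuccLimit_iff_forall_exists.2 ⟨?_, fun j hj => ?_⟩
          · obtain ⟨j, hj⟩ := hne
            exact ⟨j, hj.2⟩
          · obtain ⟨c, hc, hjc⟩ := hcof j hj
            exact ⟨c, hjc, hc.2⟩
        have hVi : (⋃ j ∈ C ∩ Iio i.1, U j) = ⋃ j < i.1, U j := by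
          refine (biUnion_subset_biUnion_left fun j hj => hj.2).antisymm
            (iUnion₂_subset fun j hj => ?_)
          obtain ⟨c, hc, hjc⟩ := hcof j hj
          exact (hUmono hjc.le).trans (subset_biUnion_of_mem (u := U) hc)
        have hVHi : (⋃ j < i.1, U j) = H i := by
          refine (hVH i).antisymm fun x hx => ?_
          obtain ⟨j, hj, hxj⟩ := hVlim i hlim x hx
          exact mem_biUnion hj hxj
        have hmin : OrdMin (M i) (y i) := by
          by_contra hc
          exact disjoint_left.1 hdisj ⟨hlim, hc⟩ i.2
        refine ⟨y i, ?_, ?_⟩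
        · rw [hVi, hVHi, inter_eq_right.2 (sdiff_subset.trans (subset_insert _ _))]
          exact hHc i
        · rw [hVi, inter_eq_right.2]
          · exact hmin
          · exact fun x hx => .inr (hUA i hx.1)

end Extreme

/-! ### Decomposition of the complement of a point -/

section Local

variable {X : Type u} [TopologicalSpace X] {p : X}

theorem isSigmaCompact_union {S T : Set X} (hS : IsSigmaCompact S) (hT : IsSigmaCompact T) :
    IsSigmaCompact (S ∪ T) := by
  rw [union_eq_iUnion]
  exact isSigmaCompact_iUnion _ (by rintro (_ | _); exacts [hT, hS])

theorem isSigmaCompact_of_isClosed_insert {S B : Set X} (hS : IsSigmaCompact S)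
    (hB : IsClosed (insert p B)) (hBS : B ⊆ S) (hp : p ∉ S) : IsSigmaCompact B := by
  obtain ⟨K, hK, rfl⟩ := hS
  refine ⟨fun n => K n ∩ insert p B, fun n => (hK n).inter_right hB, ?_⟩
  rw [← iUnion_inter]
  refine subset_antisymm ?_ fun x hx => ⟨hBS hx, .inr hx⟩
  rintro x ⟨hx, rfl | hxB⟩
  exacts [absurd hx hp, hxB]

/-- A family of sets, each of which is closed up to `p`, which converges to `p`. -/
structure IsFan (p : X) {ι : Type*} (h : ι → Set X) : Prop where
  notMem : ∀ i, p ∉ h i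
  closed : ∀ i, IsClosed (insert p (h i))
  finite : ∀ V, IsOpen V → p ∈ V → {i | ¬ h i ⊆ V}.Finite

variable {ι : Type*} {h : ι → Set X}

/-- Away from `p` only finitely many members matter, and each is closed up to `p`. -/
theorem IsFan.isClosed_insert_biUnion [T2Space X] (hh : IsFan p h) (s : Set ι) :
    IsClosed (insert p (⋃ i ∈ s, h i)) := by
  refine isClosed_of_closure_subset fun x hx => ?_
  by_contra hxn
  have hxp : p ≠ x := fun he => hxn (.inl he.symm)
  obtain ⟨V, W, hV, hW, hpV, hxW, hd⟩ := t2_separation hxp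
  have hcl : IsClosed (⋃ i ∈ {i | ¬ h i ⊆ V} ∩ s, insert p (h i)) :=
    ((hh.finite V hV hpV).inter_of_left s).isClosed_biUnion fun i _ => hh.closed i
  have hxc : x ∉ ⋃ i ∈ {i | ¬ h i ⊆ V} ∩ s, insert p (h i) := by
    intro hx'
    obtain ⟨i, hi, hxi⟩ := mem_iUnion₂.1 hx'
    rcases hxi with rfl | hxi
    · exact hxp rfl
    · exact hxn (.inr (mem_biUnion hi.2 hxi))
  obtain ⟨y, ⟨hyW, hyc⟩, hy⟩ := mem_closure_iff.1 hx _ (hW.sdiff hcl) ⟨hxW, hxc⟩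
  rcases hy with rfl | hy
  · exact disjoint_left.1 hd hpV hyW
  · obtain ⟨i, hi, hyi⟩ := mem_iUnion₂.1 hy
    by_cases hiV : h i ⊆ V
    · exact disjoint_left.1 hd (hiV hyi) hyW
    · exact hyc (mem_biUnion (show i ∈ {i | ¬ h i ⊆ V} ∩ s from ⟨hiV, hi⟩) (.inr hyi))

/-- One point from each member of an uncountable fan would converge to `p` and produce `X_{ℵ₁}`. -/
theorem IsFan.countable [T2Space X] (hno : ∀ A : Set X, ¬ IsObstruction A) (hh : IsFan p h)
    (hne : ∀ i, (h i).Nonempty) : Countable ι := by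
  by_contra hc
  have : Uncountable ι := not_countable_iff.1 hc
  choose x hx using hne
  obtain ⟨A, hA⟩ := exists_isObstruction_of_uncountable (p := p) (x := x)
    (fun i he => hh.notMem i (he ▸ hx i))
    fun V hV hpV => (hh.finite V hV hpV).subset fun i hi hiV => hi (hiV (hx i))
  exact hno A hA

variable [T2Space X] [CompactSpace X]

/-- Points of `E` in infinitely many members would include a countable set omitting `p`. A tail of
the arm misses that set, which therefore lies in a closed set omitting `p`; but only finitely many
members meet such a closed set. -/
theorem IsArm.finite_inter_nonempty (hh : IsFan p h) {E : Set X} (hE : IsArm p E) :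
    {i | (h i ∩ E).Nonempty}.Finite := by
  by_contra hinf
  have hinf : {i | (h i ∩ E).Nonempty}.Infinite := hinf
  have hx : ∀ n, ∃ x, x ∈ h (hinf.natEmbedding _ n) ∩ E := fun n => (hinf.natEmbedding _ n).2
  choose x hx using hx
  obtain ⟨E', -, -, ⟨K, hK, hpK, hEK⟩, hd⟩ := hE.exists_disjoint (D := range x)
    (by
      rw [← iUnion_singleton_eq_range]
      exact isSigmaCompact_iUnion_of_isCompact _ fun n => isCompact_singleton) (by
      rintro ⟨n, hn⟩
      exact hh.notMem _ (hn ▸ (hx n).1))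
  have hfin := hh.finite Kᶜ hK.isOpen_compl hpK
  refine infinite_univ (α := ℕ) ?_
  refine (hfin.preimage (f := fun n => (hinf.natEmbedding _ n : ι)) ?_).subset fun n _ hn => ?_
  · exact (Subtype.val_injective.comp (hinf.natEmbedding _).injective).injOn
  · rcases hEK (hx n).2 with hnK | hnE
    · exact hn (hx n).1 hnK
    · exact disjoint_left.1 hd (mem_range_self n) hnE

/-- In the absence of obstructions, a convergent family contains only finitely many arms. -/
theorem IsFan.finite_arms (hno : ∀ A : Set X, ¬ IsObstruction A) (hh : IsFan p h) {s : Set ι}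
    {E : ι → Set X} (hE : ∀ i ∈ s, IsArm p (E i) ∧ E i ⊆ h i) : s.Finite := by
  by_contra hinf
  have hinf : s.Infinite := hinf
  obtain ⟨i, hi⟩ := hinf.nonempty
  have hf₁ := IsArm.finite_inter_nonempty hh (hE i hi).1
  obtain ⟨j, hj, hj'⟩ := (hinf.sdiff hf₁).nonempty
  have hf₂ := IsArm.finite_inter_nonempty hh (hE j hj).1
  obtain ⟨k, hk, hk'⟩ := (hinf.sdiff (hf₁.union hf₂)).nonempty
  have hd : ∀ {a b}, b ∈ s → b ∉ {b | (h b ∩ E a).Nonempty} → Disjoint (E a) (E b) :=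
    fun {a b} hb hab => disjoint_left.2 fun x hx hx' => hab ⟨x, (hE b hb).2 hx', hx⟩
  obtain ⟨A, hA⟩ := exists_isObstruction_of_three_arms (hE i hi).1 (hE j hj).1 (hE k hk).1
    (hd hj hj') (hd hk fun h => hk' (.inl h)) (hd hk fun h => hk' (.inr h))
  exact hno A hA

/-- In the absence of obstructions, a finite union of arms is almost covered by at most two
disjoint arms. -/
theorem exists_coverMod_of_arms (hno : ∀ A : Set X, ¬ IsObstruction A) (s : Finset ι)
    {E : ι → Set X} (hE : ∀ i ∈ s, IsArm p (E i)) :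
    CoverMod p (⋃ i ∈ s, E i) ∅ ∨ (∃ F, IsArm p F ∧ CoverMod p (⋃ i ∈ s, E i) F) ∨
      ∃ F F', IsArm p F ∧ IsArm p F' ∧ Disjoint F F' ∧ CoverMod p (⋃ i ∈ s, E i) (F ∪ F') := by
  classical
  induction s using Finset.induction_on with
  | empty => exact .inl (.of_subset (by simp))
  | insert i s _ ih =>
    have hEi := hE i (Finset.mem_insert_self _ _)
    rw [Finset.set_biUnion_insert]
    rcases ih fun j hj => hE j (Finset.mem_insert_of_mem hj) with hc | ⟨F, hF, hc⟩ |
      ⟨F, F', hF, hF', hd, hc⟩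
    · refine .inr (.inl ⟨E i, hEi, ?_⟩)
      simpa using CoverMod.union (CoverMod.of_subset subset_rfl) hc
    · have hc' := CoverMod.union (CoverMod.of_subset (p := p) (subset_rfl (a := E i))) hc
      rcases hEi.merge_or_disjoint hF with ⟨G, hG, -, hGc⟩ | ⟨G, G', hG, hG', -, -, hGc, hGc', hd⟩
      · exact .inr (.inl ⟨G, hG, hc'.trans hGc⟩)
      · exact .inr (.inr ⟨G, G', hG, hG', hd, hc'.trans (hGc.union hGc')⟩)
    · have hc' := CoverMod.union (CoverMod.of_subset (p := p) (subset_rfl (a := E i))) hc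
      rw [← union_assoc] at hc'
      rcases hEi.merge_or_disjoint hF with ⟨G, hG, -, hGc⟩ |
        ⟨G, F₁, hG, hF₁, hGE, hFF, hGc, hFc, hd₁⟩
      · have hc'' := hc'.trans (hGc.union (.of_subset subset_rfl))
        rcases hG.merge_or_disjoint hF' with ⟨G', hG', -, hGc'⟩ |
          ⟨G₁, G₂, hG₁, hG₂, -, -, hGc₁, hGc₂, hd'⟩
        · exact .inr (.inl ⟨G', hG', hc''.trans hGc'⟩)
        · exact .inr (.inr ⟨G₁, G₂, hG₁, hG₂, hd', hc''.trans (hGc₁.union hGc₂)⟩)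
      · have hc'' := hc'.trans ((hGc.union hFc).union (.of_subset subset_rfl))
        rcases hG.merge_or_disjoint hF' with ⟨G', hG', hGG, hGc'⟩ |
          ⟨G₁, G₂, hG₁, hG₂, hGG₁, hGG₂, hGc₁, hGc₂, hd'⟩
        · refine .inr (.inr ⟨G', F₁, hG', hF₁, ?_, ?_⟩)
          · exact (disjoint_union_left.2 ⟨hd₁, (hd.mono_left hFF).symm⟩).mono_left hGG
          · refine hc''.trans ?_
            rw [union_right_comm]
            exact hGc'.union (.of_subset subset_rfl)
        -- The new arm merges with neither `F` nor `F'`, so disjoint tails form three arms at `p`.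
        · exfalso
          obtain ⟨A, hA⟩ := exists_isObstruction_of_three_arms hG₁ hF₁ hG₂
            (hd₁.mono_left hGG₁) hd' (hd.mono hFF hGG₂)
          exact hno A hA

/-- In the absence of obstructions, the complement of `p` consists of a σ-compact part and at most
two disjoint arms. -/
theorem IsFan.exists_isSigmaCompact (hno : ∀ A : Set X, ¬ IsObstruction A) (hh : IsFan p h)
    (hne : ∀ i, (h i).Nonempty) (hcov : ∀ x, x ≠ p → ∃ i, x ∈ h i)
    (harm : ∀ i, IsSigmaCompact (h i) ∨ ∃ E, IsArm p E ∧ E ⊆ h i ∧ CoverMod p (h i) E) :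
    ∃ D, IsSigmaCompact D ∧ p ∉ D ∧ IsClosed (insert p D) ∧ ({p}ᶜ ⊆ D ∨
      (∃ F, IsArm p F ∧ {p}ᶜ ⊆ D ∪ F) ∨
      ∃ F F', IsArm p F ∧ IsArm p F' ∧ Disjoint F F' ∧ {p}ᶜ ⊆ D ∪ (F ∪ F')) := by
  have := hh.countable hno hne
  have hE : ∀ i, ∃ E, ¬ IsSigmaCompact (h i) → IsArm p E ∧ E ⊆ h i ∧ CoverMod p (h i) E := by
    intro i
    by_cases hi : IsSigmaCompact (h i)
    · exact ⟨∅, fun h => absurd hi h⟩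
    · obtain ⟨E, hE⟩ := (harm i).resolve_left hi
      exact ⟨E, fun _ => hE⟩
  choose E hE using hE
  have hfin : {i | ¬ IsSigmaCompact (h i)}.Finite :=
    hh.finite_arms hno fun i hi => ⟨(hE i hi).1, (hE i hi).2.1⟩
  have hK : ∀ i, ∃ K, ¬ IsSigmaCompact (h i) → IsClosed K ∧ p ∉ K ∧ h i ⊆ K ∪ E i := by
    intro i
    by_cases hi : IsSigmaCompact (h i)
    · exact ⟨∅, fun h => absurd hi h⟩
    · obtain ⟨K, hK⟩ := (hE i hi).2.2
      exact ⟨K, fun _ => hK⟩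
  choose K hK using hK
  -- The σ-compact part collects the countably many σ-compact members and the closed remainders of
  -- the finitely many others.
  have hD₁ : IsSigmaCompact (⋃ i ∈ {i | IsSigmaCompact (h i)}, h i) :=
    isSigmaCompact_biUnion (to_countable _) fun i hi => hi
  have hD₁c := hh.isClosed_insert_biUnion {i | IsSigmaCompact (h i)}
  have hD₁p : p ∉ ⋃ i ∈ {i | IsSigmaCompact (h i)}, h i := by
    simpa using fun i _ => hh.notMem i
  have hD₂c : IsClosed (⋃ i ∈ {i | ¬ IsSigmaCompact (h i)}, K i) :=
    hfin.isClosed_biUnion fun i hi => (hK i hi).1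
  have hD₂p : p ∉ ⋃ i ∈ {i | ¬ IsSigmaCompact (h i)}, K i := by
    simpa using fun i hi => (hK i hi).2.1
  have hcover : {p}ᶜ ⊆ ((⋃ i ∈ {i | IsSigmaCompact (h i)}, h i) ∪
      ⋃ i ∈ {i | ¬ IsSigmaCompact (h i)}, K i) ∪ ⋃ i ∈ hfin.toFinset, E i := by
    intro x hx
    obtain ⟨i, hi⟩ := hcov x hx
    by_cases hs : IsSigmaCompact (h i)
    · exact .inl (.inl (mem_biUnion (show i ∈ {i | IsSigmaCompact (h i)} from hs) hi))
    · rcases (hK i hs).2.2 hi with hxK | hxE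
      · exact .inl (.inr (mem_biUnion (show i ∈ {i | ¬ IsSigmaCompact (h i)} from hs) hxK))
      · exact .inr (mem_biUnion (show i ∈ hfin.toFinset by simpa using hs) hxE)
  have key : ∀ G, CoverMod p (⋃ i ∈ hfin.toFinset, E i) G →
      ∃ D, IsSigmaCompact D ∧ p ∉ D ∧ IsClosed (insert p D) ∧ {p}ᶜ ⊆ D ∪ G := by
    rintro G ⟨K', hK', hpK', hEK'⟩
    refine ⟨_, (isSigmaCompact_union hD₁ (hD₂c.union hK').isCompact.isSigmaCompact), ?_, ?_,
      fun x hx => ?_⟩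
    · rintro (h | h | h)
      exacts [hD₁p h, hD₂p h, hpK' h]
    · rw [← insert_union]
      exact hD₁c.union (hD₂c.union hK')
    · rcases hcover hx with (h | h) | h
      · exact .inl (.inl h)
      · exact .inl (.inr (.inl h))
      · rcases hEK' h with h | h
        · exact .inl (.inr (.inr h))
        · exact .inr h
  rcases exists_coverMod_of_arms hno hfin.toFinset (E := E) (p := p)
    (fun i hi => (hE i (by simpa using hi)).1) with hc | ⟨F, hF, hc⟩ | ⟨F, F', hF, hF', hd, hc⟩
  · obtain ⟨D, hD, hDp, hDc, hcD⟩ := key _ hc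
    exact ⟨D, hD, hDp, hDc, .inl (by simpa using hcD)⟩
  · obtain ⟨D, hD, hDp, hDc, hcD⟩ := key _ hc
    exact ⟨D, hD, hDp, hDc, .inr (.inl ⟨F, hF, hcD⟩)⟩
  · obtain ⟨D, hD, hDp, hDc, hcD⟩ := key _ hc
    exact ⟨D, hD, hDp, hDc, .inr (.inr ⟨F, F', hF, hF', hd, hcD⟩)⟩

variable [TotallyDisconnectedSpace X]

/-- An arm is almost equal to an open set. -/
theorem IsArm.exists_isOpen {D F G : Set X} (hF : IsArm p F) (hD : IsSigmaCompact D) (hDp : p ∉ D)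
    (hDc : IsClosed (insert p D)) (hGc : IsClosed (insert p G)) (hFG : Disjoint F G)
    (hcov : {p}ᶜ ⊆ D ∪ (F ∪ G)) :
    ∃ A E N, IsOpen A ∧ IsClosed (insert p A) ∧ p ∉ A ∧ IsArm p E ∧ E ⊆ A ∧ E ⊆ F ∧
      CoverMod p A E ∧ CoverMod p F A ∧ IsClosed N ∧ p ∉ N ∧ A ⊆ F ∪ N := by
  obtain ⟨κ, T, y, hκ, hω, hs, rfl⟩ := hF
  obtain ⟨i, hi⟩ := hs.exists_disjoint_of_isSigmaCompact hκ hω hD hDp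
  obtain ⟨E, hE, hEi, hcE⟩ := hs.isArm_tail hκ hω i
  obtain ⟨m, hm⟩ := exists_forall_le_below hκ
  -- The tail `T i` without `y i` has a closed complement, so `T i` can fail to be open only at `y
  -- i`; a clopen neighbourhood of that point repairs this.
  obtain ⟨N, hN, hyN, hNp⟩ := exists_clopen_of_closed_subset_open (isClosed_singleton (x := y i))
    (isOpen_compl_singleton (x := p)) (by simpa using (hs.ne i).symm)
  have hpN : p ∉ N := fun h => hNp h rfl
  have hTF : T i ⊆ ⋃ j, T j := subset_iUnion T i
  refine ⟨T i ∪ N, E, N, ?_, ?_, ?_, hE, hEi.trans subset_union_left, hEi.trans hTF,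
    ?_, ?_, hN.1, hpN, union_subset_union_left _ hTF⟩
  · have hcl : IsClosed ((insert p D ∪ insert p G) ∪ insert (y i) (T m \ T i)) :=
      (hDc.union hGc).union (hs.closed_diff m i (hm i))
    have heq : T i ∪ N = ((insert p D ∪ insert p G) ∪ insert (y i) (T m \ T i))ᶜ ∪ N := by
      ext x
      constructor
      · rintro (hx | hx)
        · by_cases hxy : x = y i
          · exact .inr (hyN hxy)
          · refine .inl ?_
            have hxp : x ≠ p := fun h => hs.notMem i (h ▸ hx)
            rintro (((h | h) | (h | h)) | (h | h))
            exacts [hxp h, disjoint_left.1 hi h hx, hxp h, disjoint_left.1 hFG (hTF hx) h, hxy h,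
              h.2 hx]
        · exact .inr hx
      · rintro (hx | hx)
        · left
          by_contra hxT
          have hxp : x ≠ p := fun h => hx (.inl (.inl (.inl h)))
          rcases hcov hxp with h | h | h
          · exact hx (.inl (.inl (.inr h)))
          · obtain ⟨j, hj⟩ := mem_iUnion.1 h
            exact hx (.inr (.inr ⟨hs.anti (hm j) hj, hxT⟩))
          · exact hx (.inl (.inr (.inr h)))
        · exact .inr hx
    rw [heq]
    exact hcl.isOpen_compl.union hN.2
  · rw [← insert_union]
    exact (hs.closed i).union hN.1
  · rintro (h | h)
    exacts [hs.notMem i h, hpN h]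
  · have h₁ : CoverMod p (T i ∪ N) (T i) := ⟨N, hN.1, hpN, (union_comm _ _).subset⟩
    exact h₁.trans ((CoverMod.of_subset hTF).trans hcE)
  · exact (hs.coverMod hκ i).trans (.of_subset subset_union_left)

/-- Arms and σ-compact parts can each be ordered with `p` at the end, and a linear order offers `p`
two sides. With at most one arm, the arm and the remainder take one side each. With two arms both
sides are occupied, and the remainder has to be put elsewhere. -/
theorem orderable_univ_of_isSigmaCompact (hno : ∀ A : Set X, ¬ IsObstruction A)
    (hord : ∀ K, IsClosed K → p ∉ K → Orderable K) {D : Set X} (hD : IsSigmaCompact D)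
    (hDp : p ∉ D) (hDc : IsClosed (insert p D)) (h : {p}ᶜ ⊆ D ∨
      (∃ F, IsArm p F ∧ {p}ᶜ ⊆ D ∪ F) ∨
      ∃ F F', IsArm p F ∧ IsArm p F' ∧ Disjoint F F' ∧ {p}ᶜ ⊆ D ∪ (F ∪ F')) :
    Orderable (univ : Set X) := by
  have hσ : ∀ B, IsSigmaCompact B → p ∉ B → IsClosed (insert p B) → OrdMax (insert p B) p := by
    intro B hB hpB hBc
    refine ordMax_of_isSigmaCompact hBc (mem_insert _ _) ?_ fun K _ hK hpK => hord K hK hpK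
    rwa [insert_sdiff_of_mem _ (mem_singleton p), sdiff_singleton_eq_self hpB]
  rcases h with h | ⟨F, hF, hcov⟩ | ⟨F, F', hF, hF', hFF, hcov⟩
  · have := (hσ D hD hDp hDc).orderable
    rwa [(eq_univ_iff_forall.2 fun x => or_iff_not_imp_left.2 fun hx => h hx :
      insert p D = (Set.univ : Set X))] at this
  · obtain ⟨A, E, N, hA, hAc, hpA, hE, hEA, -, hcA, ⟨K, hK, hpK, hFK⟩, -⟩ :=
      hF.exists_isOpen hD hDp hDc (G := ∅) (by simp) (by simp) (by simpa using hcov)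
    have hB : insert p ({p}ᶜ \ A) = Aᶜ := by
      ext x
      by_cases hx : x = p
      · simp [hx, hpA]
      · simp [hx]
    have hBσ : IsSigmaCompact ({p}ᶜ \ A) := by
      refine isSigmaCompact_of_isClosed_insert (p := p)
        (isSigmaCompact_union hD hK.isCompact.isSigmaCompact) ?_ ?_ ?_
      · rw [hB]
        exact hA.isClosed_compl
      · rintro x ⟨hx, hxA⟩
        rcases hcov hx with h | h
        · exact .inl h
        · exact .inr ((hFK h).resolve_right hxA)
      · exact fun h => h.elim hDp hpK
    have h₁ := hE.ordMax hno hA hAc hpA hord hEA hcA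
    have h₂ := hσ _ hBσ (fun h => h.1 rfl) (hB ▸ hA.isClosed_compl)
    rw [hB] at h₂
    have := h₁.glue h₂.ordMin hAc hA.isClosed_compl (by
      ext x
      constructor
      · rintro ⟨h | h, h'⟩
        exacts [h, absurd h h']
      · rintro rfl
        exact ⟨.inl rfl, hpA⟩)
    rwa [insert_union, union_compl_self, insert_eq_of_mem (mem_univ p)] at this
  · obtain ⟨A, E, N, hA, hAc, hpA, hE, hEA, hEF, hcA, hFA, hN, hpN, hAN⟩ :=
      hF.exists_isOpen hD hDp hDc hF'.isClosed_insert hFF hcov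
    obtain ⟨F₁, hF₁, hFF₁, ⟨K₁, hK₁, hpK₁, hFK₁⟩, hNF₁⟩ :=
      hF'.exists_disjoint hN.isCompact.isSigmaCompact hpN
    obtain ⟨K, hK, hpK, hFK⟩ := hFA
    have hF₁A : Disjoint F₁ A := by
      refine (disjoint_union_right.2 ⟨?_, hNF₁.symm⟩).mono_right hAN
      exact (hFF.mono_right hFF₁).symm
    obtain ⟨A₂, E₂, -, hA₂, hA₂c, hpA₂, hE₂, hEA₂, hEF₂, hcA₂, ⟨K₂, hK₂, hpK₂, hFK₂⟩, -⟩ :=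
      hF₁.exists_isOpen (D := D ∪ (K ∪ K₁)) (G := A)
        (isSigmaCompact_union hD (hK.union hK₁).isCompact.isSigmaCompact)
        (fun h => h.elim hDp fun h => h.elim hpK hpK₁)
        (by rw [← insert_union]; exact hDc.union (hK.union hK₁)) hAc hF₁A (by
          intro x hx
          rcases hcov hx with h | h | h
          · exact .inl (.inl h)
          · rcases hFK h with h | h
            exacts [.inl (.inr (.inl h)), .inr (.inr h)]
          · rcases hFK₁ h with h | h
            exacts [.inl (.inr (.inr h)), .inr (.inl h)])
    have hins : insert p (A₂ \ A) = insert p A₂ \ A := by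
      rw [insert_sdiff_of_notMem _ hpA]
    have hA' : IsOpen (A₂ \ A) := by
      have : A₂ \ A = A₂ \ insert p A := by
        ext x
        refine ⟨fun hx => ⟨hx.1, ?_⟩, fun hx => ⟨hx.1, fun h => hx.2 (.inr h)⟩⟩
        rintro (rfl | h)
        exacts [hpA₂ hx.1, hx.2 h]
      rw [this]
      exact hA₂.sdiff hAc
    have hA'c : IsClosed (insert p (A₂ \ A)) := hins ▸ hA₂c.sdiff hA
    have h₁ := hE.ordMax hno hA hAc hpA hord hEA hcA
    have hEA' : E₂ ⊆ A₂ \ A := fun x hx => ⟨hEA₂ hx, disjoint_left.1 hF₁A (hEF₂ hx)⟩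
    have h₂ := hE₂.ordMax hno hA' hA'c (fun h => hpA₂ h.1) hord hEA'
      ((CoverMod.of_subset sdiff_subset).trans hcA₂)
    let B : Set X := (insert p A ∪ A₂)ᶜ
    have hBo : IsOpen B := by
      have : B = (insert p A ∪ insert p A₂)ᶜ := by
        rw [union_insert, insert_eq_of_mem]
        exact .inl (.inl rfl)
      rw [this]
      exact (hAc.union hA₂c).isOpen_compl
    have hBi : insert p B = (A ∪ A₂)ᶜ := by
      ext x
      by_cases hx : x = p
      · simp [hx, hpA, hpA₂]
      · simp [B, hx]
    have hBc : IsClosed (insert p B) := hBi ▸ (hA.union hA₂).isClosed_compl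
    have hpB : p ∉ B := fun h => h (.inl (.inl rfl))
    have hBσ : IsSigmaCompact B := by
      refine isSigmaCompact_of_isClosed_insert (p := p)
        (isSigmaCompact_union hD (hK.union (hK₁.union hK₂)).isCompact.isSigmaCompact) hBc ?_ ?_
      · intro x hx
        have hxp : x ≠ p := fun h => hx (.inl (.inl h))
        rcases hcov hxp with h | h | h
        · exact .inl h
        · exact .inr (.inl ((hFK h).resolve_right fun h => hx (.inl (.inr h))))
        · rcases hFK₁ h with h | h
          · exact .inr (.inr (.inl h))
          · exact .inr (.inr (.inr ((hFK₂ h).resolve_right fun h => hx (.inr h))))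
      · rintro (h | h | h | h)
        exacts [hDp h, hpK h, hpK₁ h, hpK₂ h]
    -- If the remainder accumulates at `p` it is a third leg. If not, it is closed and is placed
    -- before the first arm.
    by_cases hcl : p ∈ closure B
    · obtain ⟨Y, hY⟩ := exists_isObstruction_of_arms_and_isSigmaCompact hE hE₂ hBσ hpB hBc hcl
        ((disjoint_left.2 fun x hx hx' => (hEA' hx').2 hx : Disjoint A E₂).mono_left hEA)
        (disjoint_left.2 fun x hx hx' => hx (.inl (.inr (hEA hx'))))
        (disjoint_left.2 fun x hx hx' => hx (.inr (hEA₂ hx')))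
      exact absurd hY (hno Y)
    · have hBc' : IsClosed B := by
        refine isClosed_of_closure_subset fun x hx => ?_
        rcases closure_minimal (subset_insert p B) hBc hx with rfl | h
        exacts [absurd hx hcl, h]
      have h₁' := OrdMax.union_left (hord B hBc' hpB) h₁ hBc' hAc
        (disjoint_left.2 fun x hx hx' => hx (.inl hx'))
      have := h₁'.glue h₂.ordMin (hBc'.union hAc) hA'c (by
        ext x
        constructor
        · rintro ⟨h | h | h, h' | h'⟩
          · exact h'
          · exact absurd (.inr h'.1) h
          · exact h
          · exact h
          · exact h'
          · exact absurd h h'.2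
        · rintro rfl
          exact ⟨.inr (.inl rfl), .inl rfl⟩)
      convert this
      refine (eq_univ_iff_forall.2 fun x => ?_).symm
      by_cases hx : x ∈ insert p A
      · exact .inl (.inr hx)
      · by_cases hx' : x ∈ A₂
        · exact .inr (.inr ⟨hx', fun h => hx (.inr h)⟩)
        · exact .inl (.inl fun h => h.elim hx hx')

end Local

/-! ### Images of compact ordered spaces -/

section Image

variable {X : Type u} [TopologicalSpace X] [T2Space X] {p : X}

/-- The set in question is `Ico c b` for the first `b ≥ c` with `f b = p`, or all of `Ici c`, which
is compact, when there is no such `b`. -/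
theorem isClosed_insert_image_right {L : Type v} [TopologicalSpace L] [LinearOrder L]
    [OrderTopology L] [CompactSpace L] {f : L → X} (hf : Continuous f) (p : X) (c : L)
    (hc : f c ≠ p) :
    IsClosed (insert p (f '' {y | c ≤ y ∧ ∀ z, c ≤ z → z ≤ y → f z ≠ p})) ∧
    (IsSigmaCompact (f '' {y | c ≤ y ∧ ∀ z, c ≤ z → z ≤ y → f z ≠ p}) ∨
      ∃ E, IsArm p E ∧ E ⊆ f '' {y | c ≤ y ∧ ∀ z, c ≤ z → z ≤ y → f z ≠ p} ∧
        CoverMod p (f '' {y | c ≤ y ∧ ∀ z, c ≤ z → z ≤ y → f z ≠ p}) E) := by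
  by_cases hne : (f ⁻¹' {p} ∩ Ici c).Nonempty
  · obtain ⟨b, ⟨hb, hcb⟩, hmin⟩ :=
      ((isClosed_singleton.preimage hf).inter isClosed_Ici).isCompact.exists_isLeast hne
    have hcb : c < b := lt_of_le_of_ne hcb fun h => hc (h ▸ hb)
    have heq : {y | c ≤ y ∧ ∀ z, c ≤ z → z ≤ y → f z ≠ p} = Ico c b := by
      ext y
      constructor
      · rintro ⟨hy, hz⟩
        exact ⟨hy, not_le.1 fun h => hz b hcb.le h hb⟩
      · rintro ⟨hy, hyb⟩
        exact ⟨hy, fun z hz hzy h => (hmin ⟨h, hz⟩).not_gt (hzy.trans_lt hyb)⟩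
    rw [heq]
    refine ⟨?_, isArm_or_isSigmaCompact_image_Ico hf hcb hb fun x hx h =>
      (hmin ⟨h, hx.1⟩).not_gt hx.2⟩
    rw [← show f b = p from hb, ← image_insert_eq, Ico_insert_right hcb.le]
    exact (isClosed_Icc.isCompact.image hf).isClosed
  · have heq : {y | c ≤ y ∧ ∀ z, c ≤ z → z ≤ y → f z ≠ p} = Ici c := by
      ext y
      exact ⟨fun h => h.1, fun h => ⟨h, fun z hz _ h' => hne ⟨z, h', hz⟩⟩⟩
    have hcomp : IsCompact (f '' Ici c) := isClosed_Ici.isCompact.image hf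
    rw [heq]
    exact ⟨isClosed_singleton.union hcomp.isClosed, .inl hcomp.isSigmaCompact⟩

/-- The members are the images of the convex components of the complement of the fibre of `p`, each
halved at a representative. The components are open and disjoint, so the compact complement of `f
⁻¹' V` meets only finitely many of them. -/
theorem exists_isFan {L : Type v} [TopologicalSpace L] [LinearOrder L] [OrderTopology L]
    [CompactSpace L] {f : L → X} (hf : Continuous f) (hsurj : Function.Surjective f) (p : X) :
    ∃ (ι : Type v) (h : ι → Set X), IsFan p h ∧ (∀ i, (h i).Nonempty) ∧
      (∀ x, x ≠ p → ∃ i, x ∈ h i) ∧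
      ∀ i, IsSigmaCompact (h i) ∨ ∃ E, IsArm p E ∧ E ⊆ h i ∧ CoverMod p (h i) E := by
  let Z : Set L := (f ⁻¹' {p})ᶜ
  have hZ : IsOpen Z := (isClosed_singleton.preimage hf).isOpen_compl
  let R : L → Bool → Set L := fun c b => cond b {y | c ≤ y ∧ ∀ z, c ≤ z → z ≤ y → f z ≠ p}
    {y | y ≤ c ∧ ∀ z, z ≤ c → y ≤ z → f z ≠ p}
  have hR : ∀ c y, y ∈ Z.ordConnectedComponent c ↔ ∃ b, y ∈ R c b := by
    intro c y
    rw [mem_ordConnectedComponent]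
    constructor
    · intro h
      rcases le_total c y with hcy | hcy
      · refine ⟨true, hcy, fun z hz hzy => h ?_⟩
        rw [uIcc_of_le hcy]
        exact ⟨hz, hzy⟩
      · refine ⟨false, hcy, fun z hz hzy => h ?_⟩
        rw [uIcc_of_ge hcy]
        exact ⟨hzy, hz⟩
    · rintro ⟨_ | _, hcy, hy⟩ z hz
      · rw [uIcc_of_ge hcy] at hz
        exact hy z hz.2 hz.1
      · rw [uIcc_of_le hcy] at hz
        exact hy z hz.1 hz.2
  have hself : ∀ c ∈ Z, ∀ b, c ∈ R c b := by
    rintro c hc (_ | _)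
    · exact ⟨le_rfl, fun z h h' => by rwa [le_antisymm h h']⟩
    · exact ⟨le_rfl, fun z h h' => by rwa [le_antisymm h' h]⟩
  have hmain : ∀ c ∈ Z, ∀ b, IsClosed (insert p (f '' R c b)) ∧ (IsSigmaCompact (f '' R c b) ∨
      ∃ E, IsArm p E ∧ E ⊆ f '' R c b ∧ CoverMod p (f '' R c b) E) := by
    rintro c hc (_ | _)
    · have : CompactSpace Lᵒᵈ := ‹CompactSpace L›
      exact isClosed_insert_image_right (L := Lᵒᵈ) (f := f ∘ OrderDual.ofDual)
        (hf.comp continuous_ofDual) p (OrderDual.toDual c) hc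
    · exact isClosed_insert_image_right hf p c hc
  refine ⟨Z.ordConnectedSection × Bool, fun i => f '' R i.1 i.2, ⟨?_, ?_, ?_⟩, ?_, ?_, ?_⟩
  · rintro ⟨c, b⟩ ⟨y, hy, hyp⟩
    exact ordConnectedComponent_subset ((hR c y).2 ⟨b, hy⟩) hyp
  · exact fun i => (hmain i.1 (ordConnectedSection_subset i.1.2) i.2).1
  · intro V hV hpV
    have hcomp : IsCompact (f ⁻¹' V)ᶜ := (hV.preimage hf).isClosed_compl.isCompact
    obtain ⟨t, ht⟩ := hcomp.elim_finite_subcover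
      (fun c : Z.ordConnectedSection => Z.ordConnectedComponent c)
      (fun c => isOpen_iff_mem_nhds.2 fun y hy => by
        rw [ordConnectedComponent_eq hy]
        exact ordConnectedComponent_mem_nhds.2 (hZ.mem_nhds (ordConnectedComponent_subset hy))) (by
        intro x hx
        have hxZ : x ∈ Z := fun h => hx (by rw [mem_preimage, show f x = p from h]; exact hpV)
        refine mem_iUnion.2 ⟨⟨_, mem_range_self ⟨x, hxZ⟩⟩, ?_⟩
        exact mem_ordConnectedComponent_ordConnectedProj Z ⟨x, hxZ⟩)
    refine ((t.finite_toSet.prod (finite_univ (α := Bool)))).subset ?_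
    rintro ⟨c, b⟩ hcb
    refine ⟨?_, mem_univ _⟩
    by_contra hct
    refine hcb ?_
    rintro _ ⟨y, hy, rfl⟩
    by_contra hyV
    obtain ⟨d, hd, hyd⟩ := mem_iUnion₂.1 (ht (show y ∈ (f ⁻¹' V)ᶜ from hyV))
    have hyc := (hR c y).2 ⟨b, hy⟩
    have : c = d := Subtype.ext (eq_of_mem_ordConnectedSection_of_uIcc_subset c.2 d.2
      (mem_ordConnectedComponent_trans hyc (mem_ordConnectedComponent_comm.1 hyd)))
    exact hct (this ▸ hd)
  · exact fun i => ⟨f i.1, mem_image_of_mem f (hself i.1 (ordConnectedSection_subset i.1.2) i.2)⟩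
  · intro x hx
    obtain ⟨y, rfl⟩ := hsurj x
    have hyZ : y ∈ Z := hx
    obtain ⟨b, hb⟩ := (hR _ y).1 (mem_ordConnectedComponent_ordConnectedProj Z ⟨y, hyZ⟩)
    have hc : Z.ordConnectedProj ⟨y, hyZ⟩ ∈ Z.ordConnectedSection := mem_range_self _
    exact ⟨(⟨_, hc⟩, b), mem_image_of_mem f hb⟩
  · exact fun i => (hmain i.1 (ordConnectedSection_subset i.1.2) i.2).2

/-- In the absence of obstructions, a zero-dimensional image of a compact ordered space can be
ordered if it can be ordered away from one point. -/
theorem orderable_univ [CompactSpace X] [TotallyDisconnectedSpace X]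
    (hno : ∀ A : Set X, ¬ IsObstruction A) {L : Type v} [TopologicalSpace L] [LinearOrder L]
    [OrderTopology L] [CompactSpace L] {f : L → X} (hf : Continuous f)
    (hsurj : Function.Surjective f) (hord : ∀ K, IsClosed K → p ∉ K → Orderable K) :
    Orderable (univ : Set X) := by
  obtain ⟨ι, h, hh, hne, hcov, harm⟩ := exists_isFan hf hsurj p
  obtain ⟨D, hD, hDp, hDc, h⟩ := hh.exists_isSigmaCompact hno hne hcov harm
  exact orderable_univ_of_isSigmaCompact hno hord hD hDp hDc h

end Image

/-! ### Scattered images of compact ordered spaces -/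

section Scattered

theorem IsIntervalSpace.of_injective {X : Type u} {Y : Type v} [TopologicalSpace X]
    [TopologicalSpace Y] [CompactSpace Y] (h : IsIntervalSpace X) {g : Y → X} (hg : Continuous g)
    (hinj : Function.Injective g) : IsIntervalSpace Y := by
  obtain ⟨_, _⟩ := h
  let _ := LinearOrder.lift' g hinj
  exact ⟨inferInstance, orderTopology_of_isClosed_rays (fun x => isClosed_Iic.preimage hg)
    fun x => isClosed_Ici.preimage hg⟩

variable {X : Type u} [TopologicalSpace X]

/-- An isolated point of a preconnected set with two points would split it. With compactness this
supplies the clopen sets used throughout. -/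
theorem IsScattered.totallyDisconnectedSpace [T1Space X] (hX : IsScattered X) :
    TotallyDisconnectedSpace X := by
  refine ⟨fun A _ hA => ?_⟩
  by_contra hne
  have hne : A.Nontrivial := not_subsingleton_iff.1 hne
  obtain ⟨x, hx, U, hU, hUA⟩ := hX A hne.nonempty
  have hxU : x ∈ U := (hUA.symm.subset rfl).1
  obtain ⟨y, hy, hyx⟩ := hne.exists_ne x
  obtain ⟨z, hzA, hzU, hzx⟩ := hA U {x}ᶜ hU isOpen_compl_singleton
    (fun w _ => or_iff_not_imp_right.2 fun h => (not_not.1 h : w = x) ▸ hxU) ⟨x, hx, hxU⟩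
    ⟨y, hy, hyx⟩
  exact hzx (hUA.subset ⟨hzU, hzA⟩)

theorem IsObstruction.image_val {N : Set X} {A : Set N} (hA : IsObstruction A) :
    IsObstruction (Subtype.val '' A : Set X) := by
  have e := (IsEmbedding.subtypeVal.homeomorphImage A).symm
  rcases hA with ⟨κ, l, μ, h, ⟨g⟩⟩ | ⟨l, S, μ, h₁, h₂, h₃, h₄, ⟨g⟩⟩ | ⟨D, t, h₁, h₂, ⟨g⟩⟩
  · exact .inl ⟨κ, l, μ, h, ⟨e.trans g⟩⟩
  · exact .inr (.inl ⟨l, S, μ, h₁, h₂, h₃, h₄, ⟨e.trans g⟩⟩)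
  · exact .inr (.inr ⟨D, t, h₁, h₂, ⟨e.trans g⟩⟩)

theorem orderable_of_forall_exists_isClopen {K : Set X} (hK : IsCompact K) (hKc : IsClosed K)
    (h : ∀ x ∈ K, ∃ N, IsClopen N ∧ x ∈ N ∧ Orderable N) : Orderable K := by
  obtain ⟨N, hN, hNo, hKN⟩ : ∃ N, IsClopen N ∧ Orderable N ∧ K ⊆ N := by
    refine hK.induction_on (p := fun S => ∃ N, IsClopen N ∧ Orderable N ∧ S ⊆ N) ?_ ?_ ?_ ?_
    · exact ⟨∅, isClopen_empty, orderable_empty, subset_rfl⟩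
    · rintro S T hST ⟨N, hN, hNo, hT⟩
      exact ⟨N, hN, hNo, hST.trans hT⟩
    · rintro S T ⟨N, hN, hNo, hS⟩ ⟨M, hM, hMo, hT⟩
      refine ⟨N ∪ M \ N, hN.union (hM.diff hN), hNo.union (hMo.mono sdiff_subset (hM.diff hN).1)
        hN.1 (hM.diff hN).1 disjoint_sdiff_right, ?_⟩
      rw [union_sdiff_self]
      exact union_subset_union hS hT
    · intro x hx
      obtain ⟨N, hN, hxN, hNo⟩ := h x hx
      exact ⟨N, mem_nhdsWithin_of_mem_nhds (hN.2.mem_nhds hxN), N, hN, hNo, subset_rfl⟩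
  exact hNo.mono hKN hKc

/-- If some point had no orderable clopen neighbourhood, scatteredness would isolate such a `p`
among all of them. In a clopen `N` where `p` is the only bad point, closed sets omitting `p` are
orderable, and `orderable_univ` orders `N`, a contradiction. -/
theorem isIntervalSpace_of_forall_not_isObstruction [T2Space X] (hX : IsScattered X) {L : Type v}
    [TopologicalSpace L] [CompactSpace L] (hL : IsIntervalSpace L) {f : L → X}
    (hf : Continuous f) (hsurj : Function.Surjective f) (hno : ∀ A : Set X, ¬ IsObstruction A) :
    IsIntervalSpace X := by
  obtain ⟨_, _⟩ := hL
  have : CompactSpace X := ⟨by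
    rw [← hsurj.range_eq]
    exact isCompact_range hf⟩
  have := hX.totallyDisconnectedSpace
  suffices hF : {x : X | ¬ ∃ N, IsClopen N ∧ x ∈ N ∧ Orderable N} = ∅ by
    have h := orderable_of_forall_exists_isClopen (isCompact_univ (X := X)) isClosed_univ
      fun x _ => by
        by_contra hx
        exact eq_empty_iff_forall_notMem.1 hF x hx
    exact (h.isIntervalSpace isCompact_univ).of_injective (g := fun x => ⟨x, mem_univ x⟩)
      (by fun_prop) fun x y hxy => congrArg Subtype.val hxy
  by_contra hne
  obtain ⟨p, hp, U, hU, hUp⟩ := hX _ (nonempty_iff_ne_empty.2 hne)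
  have hpU : p ∈ U := (hUp.symm.subset rfl).1
  obtain ⟨N, hN, hpN, hNU⟩ := exists_clopen_of_closed_subset_open (isClosed_singleton (x := p)) hU
    (singleton_subset_iff.2 hpU)
  have hpN : p ∈ N := hpN rfl
  refine hp ⟨N, hN, hpN, ?_⟩
  have : CompactSpace N := isCompact_iff_compactSpace.1 hN.1.isCompact
  have hfN : IsCompact (f ⁻¹' N) := (hN.1.preimage hf).isCompact
  have : CompactSpace (f ⁻¹' N) := isCompact_iff_compactSpace.1 hfN
  have : OrderTopology (f ⁻¹' N) := orderTopology_subtype hfN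
  have h := orderable_univ (X := N) (p := ⟨p, hpN⟩) (fun A hA => hno _ hA.image_val)
    (f := fun x : f ⁻¹' N => (⟨f x, x.2⟩ : N)) (by fun_prop) (by
      rintro ⟨x, hx⟩
      obtain ⟨y, rfl⟩ := hsurj x
      exact ⟨⟨y, hx⟩, rfl⟩) (by
      intro K hK hpK
      have hKc : IsClosed (Subtype.val '' K : Set X) :=
        hN.1.isClosedEmbedding_subtypeVal.isClosedMap K hK
      obtain ⟨r, hr⟩ := orderable_of_forall_exists_isClopen hKc.isCompact hKc (by
        rintro _ ⟨x, hx, rfl⟩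
        by_contra hxF
        have : (x : X) = p := hUp.subset ⟨hNU x.2, hxF⟩
        exact hpK ((Subtype.ext this : x = ⟨p, hpN⟩) ▸ hx))
      have := hr.preimage (g := (Subtype.val : N → X)) continuous_subtype_val Subtype.val_injective
      rw [preimage_image_eq _ Subtype.val_injective] at this
      exact ⟨_, this⟩)
  refine IsIntervalSpace.orderable hN.1 ?_
  exact (h.isIntervalSpace isCompact_univ).of_injective (g := fun x => ⟨x, mem_univ x⟩)
    (by fun_prop) fun x y hxy => congrArg Subtype.val hxy

end Scattered

/-! ### The obstructions are not interval spaces -/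

section OneSided

theorem tendsto_coe_atTop {κ : Cardinal.{u}} (hκ : κ.IsRegular) {Y : Type v} [TopologicalSpace Y]
    {φ : UpTo κ → Y} (hφ : Continuous φ) :
    Tendsto (fun i : Below κ => φ i) atTop (𝓝 (φ ⊤)) := by
  have := nonempty_below hκ
  have := noMaxOrder_below hκ
  refine (hφ.tendsto ⊤).comp ?_
  refine nhds_top_basis.tendsto_right_iff.2 fun i hi => ?_
  lift i to Below κ using hi.ne
  exact (eventually_gt_atTop i).mono fun j hj => WithTop.coe_lt_coe.2 hj

theorem tendsto_of_strictMono {κ : Cardinal.{u}} (hκ : κ.IsRegular) (hω : ℵ₀ < κ) {Y : Type v}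
    [TopologicalSpace Y] {φ : UpTo κ → Y}
    (hφ : Continuous φ) {a : ℕ → Below κ} (ha : StrictMono a) :
    ∃ i : Below κ, Tendsto (fun n => φ (a n)) atTop (𝓝 (φ i)) := by
  obtain ⟨b, hb⟩ := exists_forall_lt_of_countable hκ hω a
  obtain ⟨i, hi⟩ := exists_isLUB_of_wellFoundedLT (s := range a)
    ⟨b, by rintro _ ⟨n, rfl⟩; exact (hb n).le⟩
  refine ⟨i, (hφ.tendsto _).comp ?_⟩
  exact (WithTop.continuous_coe.tendsto i).comp (tendsto_atTop_isLUB ha.monotone hi)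

theorem frequently_lt_or_frequently_gt {Y : Type v} [LinearOrder Y] {p : Y} {κ : Cardinal.{u}}
    (hκ : κ.IsRegular) {φ : Below κ → Y} (hφ : ∀ i, φ i ≠ p) :
    (∃ᶠ i in atTop, φ i < p) ∨ ∃ᶠ i in atTop, p < φ i := by
  have := nonempty_below hκ
  rw [← frequently_or_distrib]
  exact Frequently.of_forall fun i => lt_or_gt_of_ne (hφ i)

variable {Y : Type v} [TopologicalSpace Y] [LinearOrder Y] [OrderTopology Y] {p : Y}
  {κ l : Cardinal.{u}}

/-- A transfinite sequence of uncountable regular length and a countable family cannot converge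
to `p` from the same side. -/
theorem not_frequently_lt_of_countable (hκ : κ.IsRegular) (hω : ℵ₀ < κ) {φ : Below κ → Y}
    (hφ : Tendsto φ atTop (𝓝 p)) (hφp : ∃ᶠ i in atTop, φ i < p) {ι : Type*} [Countable ι]
    {F : Filter ι} {s : ι → Y} (hs : Tendsto s F (𝓝 p)) : ¬ ∃ᶠ n in F, s n < p := by
  intro hsp
  have := nonempty_below hκ
  have h : ∀ n, ∃ i : Below κ, s n < p → ∀ j ≥ i, s n < φ j := by
    intro n
    by_cases hn : s n < p
    · obtain ⟨i, hi⟩ := eventually_atTop.1 (hφ.eventually_const_lt hn)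
      exact ⟨i, fun _ => hi⟩
    · exact ⟨Classical.arbitrary _, fun h => absurd h hn⟩
  choose i hi using h
  obtain ⟨b, hb⟩ := exists_forall_lt_of_countable hκ hω i
  obtain ⟨j, hbj, hj⟩ := frequently_atTop.1 hφp b
  obtain ⟨n, hn, hjn⟩ := (hsp.and_eventually (hs.eventually_const_lt hj)).exists
  exact hjn.not_gt (hi n hn j ((hb n).le.trans hbj))

/-- Two continuous transfinite sequences of uncountable regular lengths which converge to `p` from
below have a common value. -/
theorem exists_eq_of_frequently_lt (hκ : κ.IsRegular) (hω : ℵ₀ < κ) (hl : l.IsRegular)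
    (hlω : ℵ₀ < l) {φ : UpTo κ → Y} (hφ : Continuous φ) (hφt : φ ⊤ = p) {ψ : UpTo l → Y}
    (hψ : Continuous ψ) (hψt : ψ ⊤ = p) (hφp : ∃ᶠ i : Below κ in atTop, φ i < p)
    (hψp : ∃ᶠ i : Below l in atTop, ψ i < p) : ∃ (i : Below κ) (j : Below l), φ i = ψ j := by
  have := nonempty_below hκ
  have := nonempty_below hl
  have := noMaxOrder_below hκ
  have := noMaxOrder_below hl
  have htφ := tendsto_coe_atTop hκ hφ
  have htψ := tendsto_coe_atTop hl hψ
  rw [hφt] at htφ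
  rw [hψt] at htψ
  have hnφ : ∀ (i : Below κ) (y : Y), y < p → ∃ i', i < i' ∧ y < φ i' ∧ φ i' < p := by
    intro i y hy
    obtain ⟨i', h₁, h₂, h₃⟩ := (hφp.and_eventually
      ((htφ.eventually_const_lt hy).and (eventually_gt_atTop i))).exists
    exact ⟨i', h₃, h₂, h₁⟩
  have hnψ : ∀ (j : Below l) (y : Y), y < p → ∃ j', j < j' ∧ y < ψ j' ∧ ψ j' < p := by
    intro i y hy
    obtain ⟨i', h₁, h₂, h₃⟩ := (hψp.and_eventually
      ((htψ.eventually_const_lt hy).and (eventually_gt_atTop i))).exists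
    exact ⟨i', h₃, h₂, h₁⟩
  -- The two sequences are interleaved below `p`. After `ω` steps the indices converge below the
  -- uncountable lengths, and the interleaved values have the same limit.
  have hstep : ∀ x : {x : Below κ × Below l // φ x.1 < ψ x.2 ∧ ψ x.2 < p},
      ∃ x' : {x : Below κ × Below l // φ x.1 < ψ x.2 ∧ ψ x.2 < p},
        x.1.1 < x'.1.1 ∧ x.1.2 < x'.1.2 ∧ ψ x.1.2 < φ x'.1.1 := by
    rintro ⟨⟨i, j⟩, -, hj⟩
    obtain ⟨i', hi', h₁, h₂⟩ := hnφ i _ hj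
    obtain ⟨j', hj', h₃, h₄⟩ := hnψ j _ h₂
    exact ⟨⟨(i', j'), h₃, h₄⟩, hi', hj', h₁⟩
  choose F hF₁ hF₂ hF₃ using hstep
  obtain ⟨i₀, hi₀⟩ := hφp.exists
  obtain ⟨j₀, -, h₁, h₂⟩ := hnψ (Classical.arbitrary _) _ hi₀
  let x : ℕ → {x : Below κ × Below l // φ x.1 < ψ x.2 ∧ ψ x.2 < p} :=
    fun n => F^[n] ⟨(i₀, j₀), h₁, h₂⟩
  have hx : ∀ n, x (n + 1) = F (x n) := fun n => Function.iterate_succ_apply' F n _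
  obtain ⟨i, hi⟩ := tendsto_of_strictMono hκ hω hφ (a := fun n => (x n).1.1)
    (strictMono_nat_of_lt_succ fun n => by rw [hx]; exact hF₁ _)
  obtain ⟨j, hj⟩ := tendsto_of_strictMono hl hlω hψ (a := fun n => (x n).1.2)
    (strictMono_nat_of_lt_succ fun n => by rw [hx]; exact hF₂ _)
  refine ⟨i, j, le_antisymm (le_of_tendsto_of_tendsto' hi hj fun n => (x n).2.1.le) ?_⟩
  refine le_of_tendsto_of_tendsto' hj ((tendsto_add_atTop_iff_nat 1).2 hi) fun n => ?_
  rw [hx]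
  exact (hF₃ _).le

/-- For uncountable `κ` the sequences would meet. For `κ = ℵ₀` the countable sequence cannot keep
pace with the uncountable one. -/
theorem not_frequently_lt (hκ : κ.IsRegular) (hl : l.IsRegular) (hlω : ℵ₀ < l) {φ : UpTo κ → Y}
    (hφ : Continuous φ) (hφt : φ ⊤ = p) {ψ : UpTo l → Y} (hψ : Continuous ψ) (hψt : ψ ⊤ = p)
    (hne : ∀ (i : Below κ) (j : Below l), φ i ≠ ψ j) (hφp : ∃ᶠ i : Below κ in atTop, φ i < p) :
    ¬ ∃ᶠ i : Below l in atTop, ψ i < p := by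
  intro hψp
  rcases hκ.1.lt_or_eq with hω | hω
  · obtain ⟨i, j, h⟩ := exists_eq_of_frequently_lt hκ hω hl hlω hφ hφt hψ hψt hφp hψp
    exact hne i j h
  · have : Countable (Below κ) := by
      rw [← mk_le_aleph0_iff, mk_ord_toType, hω]
    have htφ := tendsto_coe_atTop hκ hφ
    have htψ := tendsto_coe_atTop hl hψ
    rw [hφt] at htφ
    rw [hψt] at htψ
    exact not_frequently_lt_of_countable hl hlω htψ hψp htφ hφp

theorem not_frequently_gt (hκ : κ.IsRegular) (hl : l.IsRegular) (hlω : ℵ₀ < l) {φ : UpTo κ → Y}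
    (hφ : Continuous φ) (hφt : φ ⊤ = p) {ψ : UpTo l → Y} (hψ : Continuous ψ) (hψt : ψ ⊤ = p)
    (hne : ∀ (i : Below κ) (j : Below l), φ i ≠ ψ j) (hφp : ∃ᶠ i : Below κ in atTop, p < φ i) :
    ¬ ∃ᶠ i : Below l in atTop, p < ψ i :=
  not_frequently_lt (Y := Yᵒᵈ) hκ hl hlω hφ hφt hψ hψt hne hφp

end OneSided

/-- Pigeonhole: three legs, two sides of the common point, and any two legs include an uncountable
one. -/
theorem not_isIntervalSpace_tripleSpace {κ l μ : Cardinal.{u}} (h : IsLegalTriple κ l μ) :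
    ¬ IsIntervalSpace (TripleSpace κ l μ) := by
  rintro ⟨_, _⟩
  obtain ⟨hκ, hl, hμ, hlω, hμω⟩ := h
  let q : TripleSum κ l μ → TripleSpace κ l μ := Quotient.mk _
  have hq : Continuous q := continuous_quot_mk
  let p : TripleSpace κ l μ := q (.inl ⊤)
  have hends : ∀ x ∈ tripleEnds κ l μ, q x = p := fun x hx =>
    Quotient.sound (.inr ⟨hx, .inl rfl⟩)
  have hne : ∀ x y, q x = q y → x = y ∨ x ∈ tripleEnds κ l μ ∧ y ∈ tripleEnds κ l μ :=
    fun x y hxy => Quotient.exact hxy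
  have h₁ : Continuous fun i : UpTo κ => q (.inl i) := by fun_prop
  have h₂ : Continuous fun i : UpTo l => q (.inr (.inl i)) := by fun_prop
  have h₃ : Continuous fun i : UpTo μ => q (.inr (.inr i)) := by fun_prop
  have hp₂ : q (.inr (.inl ⊤)) = p := hends _ (by simp [tripleEnds])
  have hp₃ : q (.inr (.inr ⊤)) = p := hends _ (by simp [tripleEnds])
  have hn₁ : ∀ i : Below κ, q (.inl i) ≠ p := fun i hi => by
    rcases hne _ _ hi with h | h <;> simp [tripleEnds] at h
  have hn₂ : ∀ i : Below l, q (.inr (.inl i)) ≠ p := fun i hi => by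
    rcases hne _ _ hi with h | h <;> simp [tripleEnds] at h
  have hn₃ : ∀ i : Below μ, q (.inr (.inr i)) ≠ p := fun i hi => by
    rcases hne _ _ hi with h | h <;> simp [tripleEnds] at h
  have hn₁₂ : ∀ (i : Below κ) (j : Below l), q (.inl i) ≠ q (.inr (.inl j)) := fun i j hi => by
    rcases hne _ _ hi with h | h <;> simp [tripleEnds] at h
  have hn₁₃ : ∀ (i : Below κ) (j : Below μ), q (.inl i) ≠ q (.inr (.inr j)) := fun i j hi => by
    rcases hne _ _ hi with h | h <;> simp [tripleEnds] at h
  have hn₂₃ : ∀ (i : Below l) (j : Below μ), q (.inr (.inl i)) ≠ q (.inr (.inr j)) :=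
    fun i j hi => by rcases hne _ _ hi with h | h <;> simp [tripleEnds] at h
  have a₁₂ := not_frequently_lt hκ hl hlω h₁ rfl h₂ hp₂ hn₁₂
  have a₁₃ := not_frequently_lt hκ hμ hμω h₁ rfl h₃ hp₃ hn₁₃
  have a₂₃ := not_frequently_lt hl hμ hμω h₂ hp₂ h₃ hp₃ hn₂₃
  have b₁₂ := not_frequently_gt hκ hl hlω h₁ rfl h₂ hp₂ hn₁₂
  have b₁₃ := not_frequently_gt hκ hμ hμω h₁ rfl h₃ hp₃ hn₁₃
  have b₂₃ := not_frequently_gt hl hμ hμω h₂ hp₂ h₃ hp₃ hn₂₃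
  have c₁ := frequently_lt_or_frequently_gt hκ hn₁
  have c₂ := frequently_lt_or_frequently_gt hl hn₂
  have c₃ := frequently_lt_or_frequently_gt hμ hn₃
  rcases c₁ with c₁ | c₁
  · exact b₂₃ (c₂.resolve_left (a₁₂ c₁)) (c₃.resolve_left (a₁₃ c₁))
  · exact a₂₃ (c₂.resolve_right (b₁₂ c₁)) (c₃.resolve_right (b₁₃ c₁))

/-! ### Separation of a point from compact sets in a linear order -/

section Gap

variable {Y : Type v} [TopologicalSpace Y] [LinearOrder Y] [OrderTopology Y] {p : Y}

/-- The part of `K` below `p` is empty or has a greatest element, and points near `p` exceed it. -/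
theorem eventually_forall_lt_of_isCompact {K : Set Y} (hK : IsCompact K) (hp : p ∉ K) :
    ∀ᶠ x in 𝓝 p, ∀ y ∈ K, y < p → y < x := by
  rcases (K ∩ Iic p).eq_empty_or_nonempty with h | h
  · exact Eventually.of_forall fun x y hy hyp =>
      absurd ⟨hy, hyp.le⟩ (eq_empty_iff_forall_notMem.1 h y)
  · obtain ⟨m, ⟨hmK, hmp⟩, hm⟩ := (hK.inter_right isClosed_Iic).exists_isGreatest h
    have hmp : m < p := lt_of_le_of_ne hmp fun h => hp (h ▸ hmK)
    filter_upwards [Ioi_mem_nhds hmp] with x hx y hy hyp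
    exact (hm ⟨hy, hyp.le⟩).trans_lt hx

theorem eventually_forall_gt_of_isCompact {K : Set Y} (hK : IsCompact K) (hp : p ∉ K) :
    ∀ᶠ x in 𝓝 p, ∀ y ∈ K, p < y → x < y :=
  eventually_forall_lt_of_isCompact (Y := Yᵒᵈ) hK hp

/-- If `A` accumulates at `q < p`, a point which exceeds all points of `A` below `p` is at least
`q`. -/
theorem le_of_mem_closure {A : Set Y} {q z : Y} (hq : q ∈ closure A) (hqp : q < p)
    (h : ∀ x ∈ A, x < p → x < z) : q ≤ z := by
  by_contra hlt
  obtain ⟨x, ⟨hx, hxp⟩, hxA⟩ := mem_closure_iff.1 hq _ (isOpen_Ioo (a := z) (b := p))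
    ⟨not_le.1 hlt, hqp⟩
  exact hx.not_gt (h x hxA hxp)

end Gap

/-! ### Spaces over stationary sets are not orderable -/

namespace StationarySpace

variable {l : Cardinal.{u}} {S : Set (Below l)} {μ : S → Cardinal.{u}}

theorem eq_base_of_proj_eq_top {x : StationarySpace l S μ} (hx : proj x = ⊤) : x = base ⊤ := by
  cases x using cases_on with
  | hbase β => exact congrArg base hx
  | hlong α γ => exact absurd hx (WithTop.coe_ne_top)
  | hshort α n => exact absurd hx (WithTop.coe_ne_top)

theorem exists_forall_mem_of_mem_nhds (hl : l.IsRegular) {V : Set (StationarySpace l S μ)}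
    (hV : V ∈ 𝓝 (base ⊤)) :
    ∃ g : Below l, ∀ x : StationarySpace l S μ, (g : UpTo l) ≤ proj x → x ∈ V := by
  obtain ⟨U, hUV, hU, hpU⟩ := mem_nhds_iff.1 hV
  have := nonempty_below hl
  have := noMaxOrder_below hl
  rcases Uᶜ.eq_empty_or_nonempty with h | h
  · exact ⟨Classical.arbitrary _, fun x _ => hUV (not_not.1 fun hx =>
      eq_empty_iff_forall_notMem.1 h x hx)⟩
  · obtain ⟨_, ⟨x, hx, rfl⟩, hm⟩ :=
      (hU.isClosed_compl.isCompact.image continuous_proj).exists_isGreatest (h.image _)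
    have hxt : proj x ≠ ⊤ := fun h => hx (by rwa [eq_base_of_proj_eq_top h])
    obtain ⟨m, hxm⟩ := WithTop.ne_top_iff_exists.1 hxt
    obtain ⟨g, hg⟩ := exists_gt m
    refine ⟨g, fun y hy => hUV (not_not.1 fun hyU => ?_)⟩
    have := hm (mem_image_of_mem _ hyU)
    rw [← hxm] at this
    exact (hy.trans this).not_gt (WithTop.coe_lt_coe.2 hg)

theorem base_mem_closure {i : Below l} (hi : IsSuccLimit i) :
    (base (i : UpTo l) : StationarySpace l S μ) ∈ closure {x | proj x < i} := by
  have hc : i ∈ closure (Iio i) := hi.isLUB_Iio.mem_closure (not_isMin_iff.1 hi.1)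
  have hcont : Continuous fun j : Below l => (base (j : UpTo l) : StationarySpace l S μ) :=
    continuous_base.comp WithTop.continuous_coe
  have hsub : (fun j : Below l => (base (j : UpTo l) : StationarySpace l S μ)) '' Iio i ⊆
      {x | proj x < i} := image_subset_iff.2 fun j hj => WithTop.coe_lt_coe.2 hj
  exact closure_mono hsub (image_closure_subset_closure_image hcont (mem_image_of_mem _ hc))

/-- Points far out in the space are closer to `base ⊤` than a given compact initial part, on either
side. At an index `i ∈ S` closed under the corresponding function, everything over `i` lies on the
`base ⊤` side of all that precedes, hence on one side of `base i`. The long and the short sequence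
over `i` then converge to it from the same side. -/
theorem not_isIntervalSpace (hl : l.IsRegular) (hlω : ℵ₀ < l)
    (hμ : ∀ α, (μ α).IsRegular ∧ ℵ₀ < μ α) (hS : IsStationary S) :
    ¬ IsIntervalSpace (StationarySpace l S μ) := by
  rintro ⟨_, _⟩
  have hg : ∀ j : Below l, ∃ g : Below l, ∀ z : StationarySpace l S μ, (g : UpTo l) ≤ proj z →
      ∀ x, proj x ≤ (j : UpTo l) → (x < base ⊤ → x < z) ∧ (base ⊤ < x → z < x) := by
    intro j
    have hK : IsCompact {x : StationarySpace l S μ | proj x ≤ (j : UpTo l)} :=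
      (isClosed_Iic.preimage continuous_proj).isCompact
    have hp : base ⊤ ∉ {x : StationarySpace l S μ | proj x ≤ (j : UpTo l)} := fun h =>
      (WithTop.coe_lt_top j).not_ge h
    obtain ⟨g, hg⟩ := exists_forall_mem_of_mem_nhds hl
      ((eventually_forall_lt_of_isCompact hK hp).and (eventually_forall_gt_of_isCompact hK hp))
    exact ⟨g, fun z hz x hx => ⟨(hg z hz).1 x hx, (hg z hz).2 x hx⟩⟩
  choose g hg using hg
  -- The only use of stationarity: an index in `S` that is a limit and is closed under `g`.
  obtain ⟨i, hiS, hlim, hi⟩ := hS (isClub_closurePoints hl hlω g)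
  have hsep : ∀ z : StationarySpace l S μ, (i : UpTo l) ≤ proj z → ∀ x, proj x < i →
      (x < base ⊤ → x < z) ∧ (base ⊤ < x → z < x) := by
    intro z hz x hx
    obtain ⟨j, hj⟩ := WithTop.ne_top_iff_exists.1 (hx.trans (WithTop.coe_lt_top i)).ne
    rw [← hj] at hx
    exact hg j z ((WithTop.coe_le_coe.2 (hi j (WithTop.coe_lt_coe.1 hx)).le).trans hz) x hj.ge
  have hcl := base_mem_closure (S := S) (μ := μ) hlim
  have := nonempty_below (hμ ⟨i, hiS⟩).1
  have htl := tendsto_coe_atTop (hμ ⟨i, hiS⟩).1 (continuous_longMap (μ := μ) ⟨i, hiS⟩)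
  have hts := tendsto_short (μ := μ) ⟨i, hiS⟩
  have hne : (base (i : UpTo l) : StationarySpace l S μ) ≠ base ⊤ := fun h =>
    WithTop.coe_ne_top (Sum.inl_injective h)
  rcases lt_or_gt_of_ne hne with hlt | hgt
  · have hle : ∀ z : StationarySpace l S μ, (i : UpTo l) ≤ proj z → base (i : UpTo l) ≤ z :=
      fun z hz => le_of_mem_closure hcl hlt fun x hx => (hsep z hz x hx).1
    exact not_frequently_lt_of_countable (Y := (StationarySpace l S μ)ᵒᵈ) (hμ ⟨i, hiS⟩).1
      (hμ ⟨i, hiS⟩).2 htl (Frequently.of_forall fun γ => lt_of_le_of_ne (hle _ le_rfl)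
        (base_ne_long _ _ _).symm) hts (Frequently.of_forall fun n => lt_of_le_of_ne (hle _ le_rfl)
        (base_ne_short _ _ _).symm)
  · have hle : ∀ z : StationarySpace l S μ, (i : UpTo l) ≤ proj z → z ≤ base (i : UpTo l) :=
      fun z hz => le_of_mem_closure (Y := (StationarySpace l S μ)ᵒᵈ) hcl hgt
        fun x hx => (hsep z hz x hx).2
    exact not_frequently_lt_of_countable (hμ ⟨i, hiS⟩).1
      (hμ ⟨i, hiS⟩).2 htl (Frequently.of_forall fun γ => lt_of_le_of_ne (hle _ le_rfl)
        (base_ne_long _ _ _).symm) hts (Frequently.of_forall fun n => lt_of_le_of_ne (hle _ le_rfl)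
        (base_ne_short _ _ _).symm)

end StationarySpace

/-! ### The one-point compactification, and the "only if" half -/

theorem countable_Iio_of_finite_Iic {Y : Type v} [LinearOrder Y] {p : Y}
    (h : ∀ x < p, (Iic x).Finite) : (Iio p).Countable := by
  refine countable_iff_exists_injOn.2 ⟨fun x => (Iic x).ncard, StrictMonoOn.injOn ?_⟩
  intro x _ y hy hxy
  exact ncard_lt_ncard (Iic_ssubset_Iic.2 hxy) (h y hy)

/-- Closed rays that omit `∞` are compact in a discrete space, hence finite. Counting predecessors
then shows both sides of `∞` to be countable. -/
theorem not_isIntervalSpace_onePoint {D : Type u} [TopologicalSpace D] [DiscreteTopology D]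
    (hD : ℵ₀ < #D) : ¬ IsIntervalSpace (OnePoint D) := by
  rintro ⟨_, _⟩
  have hfin : ∀ K : Set (OnePoint D), IsClosed K → OnePoint.infty ∉ K → K.Finite := by
    intro K hK hp
    have h := ((OnePoint.isClosed_iff_of_notMem hp).1 hK).2.finite_of_discrete
    refine (h.image (fun x : D => (x : OnePoint D))).subset fun x hx => ?_
    induction x using OnePoint.rec with
    | infty => exact absurd hx hp
    | coe x => exact ⟨x, hx, rfl⟩
  have h₁ : (Iio (OnePoint.infty : OnePoint D)).Countable :=
    countable_Iio_of_finite_Iic fun x hx => hfin _ isClosed_Iic fun h => hx.not_ge h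
  have h₂ : (Ioi (OnePoint.infty : OnePoint D)).Countable :=
    countable_Iio_of_finite_Iic (Y := (OnePoint D)ᵒᵈ)
      fun x hx => hfin _ isClosed_Ici fun h => hx.not_ge h
  have h₃ : (univ : Set D).Countable := by
    refine ((h₁.union h₂).preimage_of_injOn (f := fun x : D => (x : OnePoint D))
      (OnePoint.coe_injective).injOn).mono fun x _ => ?_
    exact lt_or_gt_of_ne (OnePoint.coe_ne_infty x)
  exact hD.not_ge (mk_le_aleph0_iff.2 (countable_univ_iff.1 h₃))

theorem not_isObstruction_of_isIntervalSpace {X : Type u} [TopologicalSpace X]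
    (hX : IsIntervalSpace X) (A : Set X) : ¬ IsObstruction A := by
  have key : ∀ (Y : Type u) [TopologicalSpace Y] [CompactSpace Y], (A ≃ₜ Y) → IsIntervalSpace Y :=
    fun Y _ _ e => hX.of_injective (g := fun y => (e.symm y : X)) (by fun_prop)
      (Subtype.val_injective.comp e.symm.injective)
  rintro (⟨κ, l, μ, h, ⟨e⟩⟩ | ⟨l, S, μ, hl, hlω, hμ, hS, ⟨e⟩⟩ | ⟨D, t, hd, hD, ⟨e⟩⟩)
  · exact not_isIntervalSpace_tripleSpace h (key _ e)
  · exact StationarySpace.not_isIntervalSpace hl hlω hμ hS (key _ e)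
  · exact not_isIntervalSpace_onePoint (hD ▸ aleph0_lt_aleph_one) (key _ e)

end IntervalSpaces

end

theorem theorem2p1 {X : Type u} [TopologicalSpace X] [T2Space X]
    (hX : IntervalSpaces.IsScattered X)
    {L : Type v} [TopologicalSpace L] [CompactSpace L] (hL : IntervalSpaces.IsIntervalSpace L)
    (f : L → X) (hf : Continuous f) (hsurj : Function.Surjective f) :
    IntervalSpaces.IsIntervalSpace X ↔ ∀ A : Set X, ¬ IntervalSpaces.IsObstruction A :=
  ⟨IntervalSpaces.not_isObstruction_of_isIntervalSpace,
    IntervalSpaces.isIntervalSpace_of_forall_not_isObstruction hX hL hf hsurj⟩
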